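/- **Setting.** Let $(X,\mathrm{dist})$ be a metric space, $P\subseteq X$ a set of $n$ points, $r$ a radius, $c>1$. For $q\in X$ let $N(q,r)=\{p\in P:\mathrm{dist}(q,p)\le r\}$. Let $\mathcal H$ be an $(r,cr,p_1,p_2)$-sensitive family of hash functions on $X$, $0<p_2<p_1\le 1$: for a random $h\in\mathcal H$, $\Pr[h(x)=h(y)]\ge p_1$ if $\mathrm{dist}(x,y)\le r$, and $\Pr[h(x)=h(y)]\le p_2$ if $\mathrm{dist}(x,y)>cr$. The corresponding $c$-approximate LSH data structure concatenates $k=\lceil \log_{1/p_2} n\rceil$ functions of $\mathcal H$ and has $L=\lceil p_1^{-k}\rceil$ hash tables; let $S(n,c)=nL$ and $Q(n,c)=(k+1)L$ be its space and its query time ($kL$ hash evaluations and $L$ table accesses), both up to polylogarithmic factors. **Model.** A query is answered by a fixed randomized program on a word RAM. Each instruction takes unit time: arithmetic on words, reading or writing a memory cell, drawing a uniformly random element of $\{0,\dots,y-1\}$, comparing the values of a stored hash function at $q$ and at a stored point, and comparing the distance of $q$ to a stored point with $r$ and $cr$. The word length $w$ may be any integer with $(n+k+L+2)^b\le 2^w$,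 and $\varepsilon$ is passed to the query as the integer $s=\lceil\log_2(1/\varepsilon)\rceil$, where $(s+2)^b\le 2^w$. Preprocessing draws independent functions from $\mathcal H$ and, from them and $P$, sets up the memory. Space counts the $n$ stored points, the stored hash functions, and all memory cells, including the working memory of the queries. **Statement.** There is a constant $a$ such that for every $\gamma>0$ there are a query program and constants $A,b$, which depend only on $\gamma$, such that for all $X,P,r,c,\mathcal H,w$ as above there is a data structure, independent of $q$ and $\varepsilon$, that always uses space at most $$A\cdot S(n,c)\cdot \log^a(n+2),$$ and such that for every $q\in X$ with $N(q,r)\ne\emptyset$ and every $\varepsilon\in(0,1)$ as above the following holds with probability at least $1-n^{-\gamma}$ over the preprocessing. Let $\mu_p$ be the probability, over the fresh random choices of the query alone, that the query with $q$ and $\varepsilon$ reports $p$ and leaves the data structure unchanged. Then $\mu$ is a probability distribution on $N(q,r)$, $$\frac{1}{(1+\varepsilon)\,|N(q,r)|}\le\mu_p\le\frac{1+\varepsilon}{|N(q,r)|}\qquad\text{for all }p\in N(q,r),$$ and with probability at least $1-n^{-\gamma}$ over these random choices the query does so after at most $$A\cdot Q(n,c)\cdot\frac{|N(q,cr)|}{|N(q,r)|}\cdot\bigl(1+\log(1/\varepsilon)\bigr)\cdot\log^a(n+2)$$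 steps. -/

import Mathlib

open MeasureTheory
open scoped ENNReal

universe u v x

/-! ## Locality sensitive hashing -/

/-- `h ω : X → U`, with `ω` drawn from `ν`, is an `(r, R, p₁, p₂)`-sensitive family of hash
functions: points at distance at most `r` collide with probability at least `p₁`, points at distance
more than `R` collide with probability at most `p₂`. -/
structure IsSensitive {X U Ω : Type*} [MetricSpace X] [MeasurableSpace Ω]
    (ν : Measure Ω) (h : Ω → X → U) (r R p₁ p₂ : ℝ) : Prop where
  measurable_collision : ∀ x y, MeasurableSet {ω | h ω x = h ω y}
  near : ∀ x y, dist x y ≤ r → ENNReal.ofReal p₁ ≤ ν {ω | h ω x = h ω y}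
  far : ∀ x y, R < dist x y → ν {ω | h ω x = h ω y} ≤ ENNReal.ofReal p₂

/-- The number `k = ⌈log_{1/p₂} n⌉` of hash functions that LSH concatenates into one function
`g = (h₁, …, h_k)`, so that a far point collides with a query under `g` with probability
at most `1/n`. -/
noncomputable def lshConcat (n : ℕ) (p₂ : ℝ) : ℕ :=
  ⌈Real.log n / Real.log (1 / p₂)⌉₊

/-- The number `L = ⌈(1/p₁)^k⌉` of hash tables (functions `g₁, …, g_L`) of LSH. -/
noncomputable def lshTables (n : ℕ) (p₁ p₂ : ℝ) : ℕ :=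
  ⌈(1 / p₁) ^ lshConcat n p₂⌉₊

/-- The space of LSH: `L` tables, each holding the `n` points. -/
noncomputable def lshSpace (n : ℕ) (p₁ p₂ : ℝ) : ℕ :=
  n * lshTables n p₁ p₂

/-- The query time of LSH: for each of the `L` tables, `k` hash evaluations and one access. -/
noncomputable def lshQuery (n : ℕ) (p₁ p₂ : ℝ) : ℕ :=
  (lshConcat n p₂ + 1) * lshTables n p₁ p₂

/-- The (indices of the points in the) `r`-neighborhood of `q` in the point set `P`. -/
noncomputable def nbr {X : Type*} [MetricSpace X] {n : ℕ} (P : Fin n ↪ X) (q : X) (r : ℝ) :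
    Finset (Fin n) :=
  Finset.univ.filter fun i => dist q (P i) ≤ r

/-! ## A randomized word RAM -/

/-- Arithmetic operations of the machine. Comparisons return `1` or `0`. -/
inductive BinOp
  | add | sub | mul | div | mod | lt | eq

/-- Programs of the machine. Registers are named by natural numbers. -/
inductive Stmt
  /-- `x := v` -/
  | const (x v : ℕ)
  /-- `x := y op z` -/
  | arith (op : BinOp) (x y z : ℕ)
  /-- `x := mem[y]` -/
  | load (x y : ℕ)
  /-- `mem[x] := y` -/
  | store (x y : ℕ)
  /-- `x :=` a fresh uniformly random element of `{0, …, y - 1}` -/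
  | rand (x y : ℕ)
  /-- `x :=` the outcome of comparing the query and the stored point number `b` under the stored
  hash function number `a` -/
  | hash (x a b : ℕ)
  /-- `x :=` the outcome of comparing the distance of the query to the stored point number `b`
  with `r` and `c * r` -/
  | near (x b : ℕ)
  | seq (s t : Stmt)
  /-- `if x ≠ 0 then s else t` -/
  | ite (x : ℕ) (s t : Stmt)
  /-- `while x ≠ 0 do s` -/
  | loop (x : ℕ) (s : Stmt)

/-- Arithmetic on words of `w` bits; subtraction is truncated at `0`. -/
def BinOp.eval (w : ℕ) : BinOp → ℕ → ℕ → ℕ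
  | .add, y, z => (y + z) % 2 ^ w
  | .sub, y, z => y - z
  | .mul, y, z => (y * z) % 2 ^ w
  | .div, y, z => y / z
  | .mod, y, z => y % z
  | .lt, y, z => if y < z then 1 else 0
  | .eq, y, z => if y = z then 1 else 0

/-- A configuration: the statements still to be executed, the registers, and the memory, whose
cells are the entries of a list of fixed length. -/
structure Config where
  code : List Stmt
  reg : ℕ → ℕ
  mem : List ℕ

/-- The uniform distribution on `{0, …, y - 1}` (the point mass at `0` if `y = 0`). -/
noncomputable def unif (y : ℕ) : PMF ℕ :=
  if hy : y = 0 then PMF.pure 0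
  else PMF.uniformOfFinset (Finset.range y) (Finset.nonempty_range_iff.mpr hy)

/-- One step of the machine with word length `w`, where `H a b` and `D b` are the answers to the
instructions `hash` and `near`. A configuration without code has halted. Reading outside the memory
gives `0`, writing outside of it has no effect. -/
noncomputable def step (w : ℕ) (H : ℕ → ℕ → ℕ) (D : ℕ → ℕ) : Config → PMF Config
  | ⟨[], g, M⟩ => PMF.pure ⟨[], g, M⟩
  | ⟨.const x v :: K, g, M⟩ => PMF.pure ⟨K, Function.update g x (v % 2 ^ w), M⟩
  | ⟨.arith op x y z :: K, g, M⟩ =>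
      PMF.pure ⟨K, Function.update g x (op.eval w (g y) (g z)), M⟩
  | ⟨.load x y :: K, g, M⟩ => PMF.pure ⟨K, Function.update g x (M.getD (g y) 0), M⟩
  | ⟨.store x y :: K, g, M⟩ => PMF.pure ⟨K, g, M.set (g x) (g y)⟩
  | ⟨.rand x y :: K, g, M⟩ => (unif (g y)).map fun v => ⟨K, Function.update g x v, M⟩
  | ⟨.hash x a b :: K, g, M⟩ => PMF.pure ⟨K, Function.update g x (H (g a) (g b)), M⟩
  | ⟨.near x b :: K, g, M⟩ => PMF.pure ⟨K, Function.update g x (D (g b)), M⟩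
  | ⟨.seq s t :: K, g, M⟩ => PMF.pure ⟨s :: t :: K, g, M⟩
  | ⟨.ite x s t :: K, g, M⟩ => PMF.pure ⟨(if g x ≠ 0 then s else t) :: K, g, M⟩
  | ⟨.loop x s :: K, g, M⟩ => PMF.pure ⟨if g x ≠ 0 then s :: .loop x s :: K else K, g, M⟩

/-- The distribution of the configuration after `T` steps. -/
noncomputable def run (w : ℕ) (H : ℕ → ℕ → ℕ) (D : ℕ → ℕ) : ℕ → Config → PMF Config
  | 0, C => PMF.pure C
  | T + 1, C => (step w H D C).bind (run w H D T)

/-- Answers to `hash`, for stored hash functions `f`, stored points `P` and query `q`: `0`, `1`, `2`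
according to whether `f a q` is less than, equal to, or greater than `f a (P b)`
(`3` if there is no such function or point). -/
def hashOracle {X U : Type*} [LinearOrder U] {m n : ℕ} (f : Fin m → X → U)
    (P : Fin n ↪ X) (q : X) (a b : ℕ) : ℕ :=
  if ha : a < m then
    if hb : b < n then
      if f ⟨a, ha⟩ q < f ⟨a, ha⟩ (P ⟨b, hb⟩) then 0
      else if f ⟨a, ha⟩ q = f ⟨a, ha⟩ (P ⟨b, hb⟩) then 1 else 2
    else 3
  else 3

/-- Answers to `near`: `0` if the distance is at most `r`, `1` if it is larger than `r` but at most
`c * r`, `2` if it is larger than both (`3` if there is no such point). -/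
noncomputable def distOracle {X : Type*} [MetricSpace X] {n : ℕ} (P : Fin n ↪ X)
    (r c : ℝ) (q : X) (b : ℕ) : ℕ :=
  if hb : b < n then
    if dist q (P ⟨b, hb⟩) ≤ r then 0 else if dist q (P ⟨b, hb⟩) ≤ c * r then 1 else 2
  else 3

/-! ## Answering a query -/

/-- The configuration in which a query with accuracy parameter `s` starts: `s` is in register `1`,
the other registers are `0`, and the memory holds the data structure `M`. -/
def start (prog : Stmt) (s : ℕ) (M : List ℕ) : Config :=
  ⟨[prog], fun x => if x = 1 then s else 0, M⟩

/-- The probability that a query has halted within `T` steps, with the index `i` of the reported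
point in register `0`, and with the memory `M` restored (so that further queries find the data
structure unchanged). -/
noncomputable def reportWithin (prog : Stmt) (w : ℕ) (H : ℕ → ℕ → ℕ) (D : ℕ → ℕ) (M : List ℕ)
    (s T i : ℕ) : ℝ≥0∞ :=
  (run w H D T (start prog s M)).toOuterMeasure {C | C.code = [] ∧ C.reg 0 = i ∧ C.mem = M}

/-- The probability `μ_i` that a query reports the point with index `i`. -/
noncomputable def reportProb (prog : Stmt) (w : ℕ) (H : ℕ → ℕ → ℕ) (D : ℕ → ℕ) (M : List ℕ)
    (s i : ℕ) : ℝ≥0∞ :=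
  ⨆ T, reportWithin prog w H D M s T i

/-- The number `⌈log₂ (1/ε)⌉` by which the accuracy `ε` is passed to the machine. -/
noncomputable def accuracy (ε : ℝ) : ℕ := ⌈Real.logb 2 (1 / ε)⌉₊

/-- For the stored hash functions `f`, the points `P` and the memory `M`, the query `q` with
accuracy `ε` is answered as it should be: the reported point is `(1 + ε)`-uniform on the
`r`-neighborhood `N` of `q`, and it is reported within `B` steps with probability `≥ 1 - δ`.
Both probabilities are over the random choices made during the query only. -/
def AnswersFairly {X U : Type*} [MetricSpace X] [LinearOrder U] {m n : ℕ} (prog : Stmt) (w : ℕ)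
    (f : Fin m → X → U) (P : Fin n ↪ X) (M : List ℕ) (r c : ℝ) (q : X) (ε B δ : ℝ) : Prop :=
  (∀ i ∈ nbr P q r,
    1 / ((nbr P q r).card : ℝ) / (1 + ε) ≤
        (reportProb prog w (hashOracle f P q) (distOracle P r c q) M (accuracy ε) i).toReal ∧
      (reportProb prog w (hashOracle f P q) (distOracle P r c q) M (accuracy ε) i).toReal ≤
        1 / ((nbr P q r).card : ℝ) * (1 + ε)) ∧
  ∑ i ∈ nbr P q r,
      reportProb prog w (hashOracle f P q) (distOracle P r c q) M (accuracy ε) i = 1 ∧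
  ∃ T : ℕ, (T : ℝ) ≤ B ∧
    ENNReal.ofReal (1 - δ) ≤ ∑ i ∈ nbr P q r,
      reportWithin prog w (hashOracle f P q) (distOracle P r c q) M (accuracy ε) T i

/-!
The query is answered by rejection sampling from hash tables, so the reported point is not only
nearly but exactly uniform on the `r`-neighborhood `N` of `q`, and the accuracy `ε` is not used.

*The data structure* (`memory`, `setup_memory`) consists of `G = O(γ log n)` independent groups of
`3 * L` tables. A table is the list of all points, sorted lexicographically by the values of its `k`
hash functions. As the machine can compare the hash values of `q` with those of a stored point, the
points that collide with `q` form an interval of each table, whose left end is found by binary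
search. The remaining cells are working memory, which every query restores.

*The choice of proposals.* For a length `s`, the interval of each table is covered by slots of `s`
consecutive positions. If `s` is at least the number of points within distance `c * r` of `q`, then
these points need at most one slot per table, and every far point adds at most one slot in a table
in which it collides with `q` (`length_groupSlots_le`). So a group has few slots unless it has many
far collisions. The query tries `s = 1, 2, 4, …` until more than half of the groups have few slots;
these groups are kept. Enumerating all collisions would be too slow, as the near points collide
with `q` in many tables.

*The rounds.* A round draws one of the positions covered by slots of kept groups uniformly. It is
accepted if it holds a point of `N` that collides with `q` and does so in no earlier kept table.
Every point of `N` is then accepted at exactly one position (`existsUnique_accepted`), which gives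
uniformity (`Rounds.iSup_hit`). For a fixed point the backward scans for an earlier table, begun at
its different occurrences, do not overlap (`sum_scanLength`); hence the total work over all positions
is small (`sum_roundWork_le`), and an exponential supermartingale bounds the running time with
high probability (`Rounds.one_sub_sum_hit_le`).

*The preprocessing* fails for `q` only if half of the groups have too many far collisions, or miss
one of the points of `N`. For one group this has probability at most `1 / 16` by Markov's inequality
and by the choice of `L`, so for half of the independent groups it has probability at most `2⁻¹ ^ G`
(`pi_bad_le`). If this does not happen, then each point of `N` is present in more than half of the
groups, hence in one of those kept (`queryProg_spec`).

If `k > n`, storing the hash functions could exceed the space bound, but then the time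
bound admits looking at all points, and a single table without hash functions serves the purpose.
-/

/-! ### Deterministic runs of the machine -/

section Machine

variable {w : ℕ} {H : ℕ → ℕ → ℕ} {D : ℕ → ℕ}

theorem run_zero (C : Config) : run w H D 0 C = PMF.pure C := rfl

theorem run_succ (T : ℕ) (C : Config) :
    run w H D (T + 1) C = (step w H D C).bind (run w H D T) := rfl

theorem run_add (S T : ℕ) (C : Config) :
    run w H D (S + T) C = (run w H D S C).bind (run w H D T) := by
  induction S generalizing C with
  | zero => simp [run_zero]
  | succ S ih =>
    rw [Nat.succ_add, run_succ, run_succ, PMF.bind_bind]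
    congr 1
    funext C'
    exact ih C'

theorem run_add_of_pure {S T : ℕ} {C C' : Config} (h : run w H D S C = PMF.pure C') :
    run w H D (S + T) C = run w H D T C' := by
  rw [run_add, h, PMF.pure_bind]

theorem run_one (C : Config) : run w H D 1 C = step w H D C := by
  rw [run_succ]
  exact PMF.bind_pure _

/-- The statement `s`, started with registers `g` and memory `M`, takes exactly `t` steps without
randomness and ends with registers `g'` and memory `M'`. -/
def ExecIn (w : ℕ) (H : ℕ → ℕ → ℕ) (D : ℕ → ℕ) (s : Stmt) (g : ℕ → ℕ) (M : List ℕ) (t : ℕ)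
    (g' : ℕ → ℕ) (M' : List ℕ) : Prop :=
  ∀ K, run w H D t ⟨s :: K, g, M⟩ = PMF.pure ⟨K, g', M'⟩

/-- The loop `while x ≠ 0 do s` ends, without randomness, in a state that satisfies `Q`; the last
arguments of `Q` and of the predicate are the numbers of steps taken so far. -/
def loopWp (w : ℕ) (H : ℕ → ℕ → ℕ) (D : ℕ → ℕ) (x : ℕ) (s : Stmt)
    (Q : (ℕ → ℕ) → List ℕ → ℕ → Prop) (g : ℕ → ℕ) (M : List ℕ) (c : ℕ) : Prop :=
  ∃ t g' M', ExecIn w H D (.loop x s) g M t g' M' ∧ Q g' M' (c + t)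

/-- The weakest precondition of a statement free of `rand`. The last argument of an assertion is the
number of steps taken so far. Loops are left to `Exec.loop`. -/
def wp (w : ℕ) (H : ℕ → ℕ → ℕ) (D : ℕ → ℕ) :
    Stmt → ((ℕ → ℕ) → List ℕ → ℕ → Prop) → (ℕ → ℕ) → List ℕ → ℕ → Prop
  | .const x v, Q => fun g M c => Q (Function.update g x (v % 2 ^ w)) M (c + 1)
  | .arith op x y z, Q => fun g M c =>
      Q (Function.update g x (op.eval w (g y) (g z))) M (c + 1)
  | .load x y, Q => fun g M c => Q (Function.update g x (M.getD (g y) 0)) M (c + 1)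
  | .store x y, Q => fun g M c => Q g (M.set (g x) (g y)) (c + 1)
  | .rand _ _, _ => fun _ _ _ => False
  | .hash x a b, Q => fun g M c => Q (Function.update g x (H (g a) (g b))) M (c + 1)
  | .near x b, Q => fun g M c => Q (Function.update g x (D (g b))) M (c + 1)
  | .seq s t, Q => fun g M c => wp w H D s (wp w H D t Q) g M (c + 1)
  | .ite x s t, Q => fun g M c =>
      if g x ≠ 0 then wp w H D s Q g M (c + 1) else wp w H D t Q g M (c + 1)
  | .loop x s, Q => loopWp w H D x s Q

/-- The statement `s` ends, without randomness and within `B` steps, in a state that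
satisfies `Q`. -/
def Exec (w : ℕ) (H : ℕ → ℕ → ℕ) (D : ℕ → ℕ) (s : Stmt) (g : ℕ → ℕ) (M : List ℕ) (B : ℕ)
    (Q : (ℕ → ℕ) → List ℕ → Prop) : Prop :=
  wp w H D s (fun g' M' t => t ≤ B ∧ Q g' M') g M 0

theorem ExecIn.seq {s t : Stmt} {g g' g'' : ℕ → ℕ} {M M' M'' : List ℕ} {a b : ℕ}
    (h : ExecIn w H D s g M a g' M') (h' : ExecIn w H D t g' M' b g'' M'') :
    ExecIn w H D (.seq s t) g M (1 + (a + b)) g'' M'' := by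
  intro K
  have h1 : run w H D 1 ⟨.seq s t :: K, g, M⟩ = PMF.pure ⟨s :: t :: K, g, M⟩ := by
    rw [run_one]; rfl
  rw [run_add_of_pure h1, run_add_of_pure (h _), h']

theorem ExecIn.ite {x : ℕ} {s t : Stmt} {g g' : ℕ → ℕ} {M M' : List ℕ} {a : ℕ}
    (h : ExecIn w H D (if g x ≠ 0 then s else t) g M a g' M') :
    ExecIn w H D (.ite x s t) g M (1 + a) g' M' := by
  intro K
  have h1 : run w H D 1 ⟨.ite x s t :: K, g, M⟩ =
      PMF.pure ⟨(if g x ≠ 0 then s else t) :: K, g, M⟩ := by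
    rw [run_one]; rfl
  rw [run_add_of_pure h1, h]

theorem ExecIn.loop_exit {x : ℕ} {s : Stmt} {g : ℕ → ℕ} {M : List ℕ} (hx : g x = 0) :
    ExecIn w H D (.loop x s) g M 1 g M := by
  intro K
  rw [run_one, step]
  simp [hx]

theorem ExecIn.loop_step {x : ℕ} {s : Stmt} {g g' g'' : ℕ → ℕ} {M M' M'' : List ℕ} {a b : ℕ}
    (hx : g x ≠ 0) (h : ExecIn w H D s g M a g' M')
    (h' : ExecIn w H D (.loop x s) g' M' b g'' M'') :
    ExecIn w H D (.loop x s) g M (1 + (a + b)) g'' M'' := by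
  intro K
  have h1 : run w H D 1 ⟨.loop x s :: K, g, M⟩ = PMF.pure ⟨s :: .loop x s :: K, g, M⟩ := by
    rw [run_one, step]; simp [hx]
  rw [run_add_of_pure h1, run_add_of_pure (h _), h']

/-- A statement that satisfies its weakest precondition runs, without randomness, to a state that
satisfies the assertion. -/
theorem wp_sound {s : Stmt} {Q : (ℕ → ℕ) → List ℕ → ℕ → Prop} {g : ℕ → ℕ} {M : List ℕ} {c : ℕ}
    (h : wp w H D s Q g M c) :
    ∃ t g' M', ExecIn w H D s g M t g' M' ∧ Q g' M' (c + t) := by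
  induction s generalizing Q g M c with
  | const x v => exact ⟨1, _, _, fun K => by rw [run_one]; rfl, h⟩
  | arith op x y z => exact ⟨1, _, _, fun K => by rw [run_one]; rfl, h⟩
  | load x y => exact ⟨1, _, _, fun K => by rw [run_one]; rfl, h⟩
  | store x y => exact ⟨1, _, _, fun K => by rw [run_one]; rfl, h⟩
  | rand x y => exact h.elim
  | hash x a b => exact ⟨1, _, _, fun K => by rw [run_one]; rfl, h⟩
  | near x b => exact ⟨1, _, _, fun K => by rw [run_one]; rfl, h⟩
  | seq s t ihs iht =>
    obtain ⟨a, g', M', h1, h2⟩ := ihs h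
    obtain ⟨b, g'', M'', h3, h4⟩ := iht h2
    exact ⟨_, g'', M'', h1.seq h3, by convert h4 using 1; omega⟩
  | ite x s t ihs iht =>
    by_cases hx : g x ≠ 0
    · simp only [wp, if_pos hx] at h
      obtain ⟨a, g', M', h1, h2⟩ := ihs h
      exact ⟨1 + a, g', M', ExecIn.ite (by rwa [if_pos hx]), by convert h2 using 1; omega⟩
    · simp only [wp, if_neg hx] at h
      obtain ⟨a, g', M', h1, h2⟩ := iht h
      exact ⟨1 + a, g', M', ExecIn.ite (by rwa [if_neg hx]), by convert h2 using 1; omega⟩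
  | loop x s _ => exact h

theorem wp_mono {s : Stmt} {Q Q' : (ℕ → ℕ) → List ℕ → ℕ → Prop} {g : ℕ → ℕ} {M : List ℕ} {c : ℕ}
    (h : wp w H D s Q g M c) (hQ : ∀ g M c, Q g M c → Q' g M c) : wp w H D s Q' g M c := by
  induction s generalizing Q Q' g M c with
  | rand x y => exact h.elim
  | seq s t ihs iht => exact ihs h fun g M c h' => iht h' hQ
  | ite x s t ihs iht =>
    simp only [wp] at h ⊢
    split_ifs with hx
    · exact ihs (by simpa [hx] using h) hQ
    · exact iht (by simpa [hx] using h) hQ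
  | loop x s _ =>
    obtain ⟨t, g', M', h1, h2⟩ := h
    exact ⟨t, g', M', h1, hQ _ _ _ h2⟩
  | _ => exact hQ _ _ _ h

/-- The step counter may start at any number. -/
theorem wp_shift {s : Stmt} {Q : (ℕ → ℕ) → List ℕ → ℕ → Prop} {g : ℕ → ℕ} {M : List ℕ}
    {c d : ℕ} (h : wp w H D s (fun g M t => Q g M (d + t)) g M c) : wp w H D s Q g M (d + c) := by
  induction s generalizing Q g M c with
  | rand x y => exact h.elim
  | seq s t ihs iht =>
    have := ihs (Q := wp w H D t Q) (wp_mono h fun g M c h' => iht h')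
    exact this
  | ite x s t ihs iht =>
    simp only [wp] at h ⊢
    split_ifs with hx
    · exact ihs (by simpa [hx] using h)
    · exact iht (by simpa [hx] using h)
  | loop x s _ =>
    obtain ⟨t, g', M', h1, h2⟩ := h
    exact ⟨t, g', M', h1, by rwa [add_assoc]⟩
  | _ => exact h

/-- Calling a block that has been specified by `Exec`. -/
theorem Exec.wp {s : Stmt} {P : (ℕ → ℕ) → List ℕ → Prop} {Q : (ℕ → ℕ) → List ℕ → ℕ → Prop}
    {g : ℕ → ℕ} {M : List ℕ} {B c : ℕ} (h : Exec w H D s g M B P)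
    (hQ : ∀ g' M', P g' M' → ∀ t ≤ B, Q g' M' (c + t)) : _root_.wp w H D s Q g M c :=
  wp_shift (c := 0) (wp_mono h fun g' M' t ht => hQ g' M' ht.2 t ht.1)

/-- Calling a loop that has been specified by `Exec`. -/
theorem Exec.loopWp {x : ℕ} {s : Stmt} {P : (ℕ → ℕ) → List ℕ → Prop}
    {Q : (ℕ → ℕ) → List ℕ → ℕ → Prop} {g : ℕ → ℕ} {M : List ℕ} {B c : ℕ}
    (h : Exec w H D (.loop x s) g M B P)
    (hQ : ∀ g' M', P g' M' → ∀ t ≤ B, Q g' M' (c + t)) : _root_.loopWp w H D x s Q g M c :=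
  h.wp hQ

theorem Exec.sound {s : Stmt} {g : ℕ → ℕ} {M : List ℕ} {B : ℕ} {Q : (ℕ → ℕ) → List ℕ → Prop}
    (h : Exec w H D s g M B Q) : ∃ t ≤ B, ∃ g' M', ExecIn w H D s g M t g' M' ∧ Q g' M' := by
  obtain ⟨t, g', M', h1, h2, h3⟩ := wp_sound h
  exact ⟨t, by omega, g', M', h1, h3⟩

theorem Exec.mono {s : Stmt} {Q Q' : (ℕ → ℕ) → List ℕ → Prop} {g : ℕ → ℕ} {M : List ℕ} {B B' : ℕ}
    (h : Exec w H D s g M B Q) (hB : B ≤ B') (hQ : ∀ g M, Q g M → Q' g M) :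
    Exec w H D s g M B' Q' :=
  wp_mono h fun _ _ _ h' => ⟨h'.1.trans hB, hQ _ _ h'.2⟩

theorem exec_loop_of_execIn {x : ℕ} {s : Stmt} {g g' : ℕ → ℕ} {M M' : List ℕ} {t B : ℕ}
    {Q : (ℕ → ℕ) → List ℕ → Prop} (h : ExecIn w H D (.loop x s) g M t g' M') (ht : t ≤ B)
    (hQ : Q g' M') : Exec w H D (.loop x s) g M B Q :=
  ⟨t, g', M', h, by omega, hQ⟩

/-- The rule for loops, by the number `B` of steps that the invariant `I` leaves. -/
theorem Exec.loop {x : ℕ} {s : Stmt} {Q : (ℕ → ℕ) → List ℕ → Prop}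
    (I : ℕ → (ℕ → ℕ) → List ℕ → Prop)
    (h0 : ∀ B g M, I B g M → g x = 0 → 1 ≤ B ∧ Q g M)
    (h1 : ∀ B g M, I B g M → g x ≠ 0 →
      ∃ c B', c + 1 + B' ≤ B ∧ Exec w H D s g M c (fun g' M' => I B' g' M'))
    {B : ℕ} {g : ℕ → ℕ} {M : List ℕ} (hI : I B g M) :
    Exec w H D (.loop x s) g M B Q := by
  suffices h : ∃ t ≤ B, ∃ g' M', ExecIn w H D (.loop x s) g M t g' M' ∧ Q g' M' by
    obtain ⟨t, ht, g', M', he, hQ⟩ := h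
    exact exec_loop_of_execIn he ht hQ
  induction B using Nat.strong_induction_on generalizing g M with
  | _ B ih =>
    by_cases hx : g x = 0
    · obtain ⟨hB, hQ⟩ := h0 B g M hI hx
      exact ⟨1, hB, g, M, ExecIn.loop_exit hx, hQ⟩
    · obtain ⟨c, B', hc, hE⟩ := h1 B g M hI hx
      obtain ⟨t, ht, g', M', he, hI'⟩ := hE.sound
      obtain ⟨t', ht', g'', M'', he', hQ⟩ := ih B' (by omega) hI'
      exact ⟨_, by omega, g'', M'', ExecIn.loop_step hx he he', hQ⟩

/-- A sequence of statements, nested to the right. As the machine has no empty statement, an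
assignment to the scratch register `99` takes its place, here and in branches without code. -/
def block : List Stmt → Stmt
  | [] => .const 99 0
  | [s] => s
  | s :: t :: l => .seq s (block (t :: l))

end Machine

/-! ### Comparing the query with a stored point in one table -/

section Compare

variable {w : ℕ} {H : ℕ → ℕ → ℕ} {D : ℕ → ℕ}

/-- The lexicographic comparison of the query with point `p` under the first `j` hash functions of
table `i`: the first answer that is not `1` (equal), or `1` if there is none. -/
def lexUpTo (H : ℕ → ℕ → ℕ) (k i p : ℕ) : ℕ → ℕ
  | 0 => 1
  | j + 1 => if lexUpTo H k i p j = 1 then H (i * k + j) p else lexUpTo H k i p j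

/-- The lexicographic comparison of the query with point `p` under all hash functions of
table `i`. -/
def lexVal (H : ℕ → ℕ → ℕ) (k i p : ℕ) : ℕ := lexUpTo H k i p k

/-- Once the comparison is decided, further hash functions do not change it. -/
theorem lexUpTo_eq_of_ne_one {k i p j : ℕ} (h : lexUpTo H k i p j ≠ 1) {j' : ℕ} (hj : j ≤ j') :
    lexUpTo H k i p j' = lexUpTo H k i p j := by
  induction j', hj using Nat.le_induction with
  | base => rfl
  | succ m _ ih => rw [lexUpTo, ih, if_neg h]

/-- Register `40 :=` the comparison of the query with the point in register `39` in the table in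
register `38`. -/
def compareProg : Stmt :=
  block [.arith .mul 41 38 3, .arith .add 42 41 3, .const 40 1, .arith .lt 43 41 42,
    .loop 43 (block [.hash 40 41 39, .arith .add 41 41 11, .arith .lt 43 41 42,
      .arith .eq 44 40 11, .arith .mul 43 43 44])]

theorem compareProg_spec {k N i p : ℕ} {g : ℕ → ℕ} {M : List ℕ} (h3 : g 3 = k) (h11 : g 11 = 1)
    (h38 : g 38 = i) (h39 : g 39 = p) (hi : i < N) (hN : N * k + 1 < 2 ^ w) :
    Exec w H D compareProg g M (10 * (k + 1))
      (fun g' M' => M' = M ∧ g' 40 = lexVal H k i p ∧ ∀ r < 40, g' r = g r) := by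
  have hik : i * k + k ≤ N * k := by nlinarith
  simp only [Exec, compareProg, block, wp, BinOp.eval]
  have e1 : (i * k) % 2 ^ w = i * k := Nat.mod_eq_of_lt (by omega)
  have e2 : (i * k + k) % 2 ^ w = i * k + k := Nat.mod_eq_of_lt (by omega)
  have e3 : 1 % 2 ^ w = 1 := Nat.mod_eq_of_lt (by omega)
  simp [h3, h38, e1, e2, e3]
  refine Exec.loopWp (P := fun g' M' => M' = M ∧ g' 40 = lexVal H k i p ∧ ∀ r < 40, g' r = g r)
    (B := 10 * k + 1) ?_ ?_
  -- invariant: the first `j` hash functions have been compared, and the flag in register `43` says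
  -- whether to go on
  · refine Exec.loop (fun B g' M' => ∃ j ≤ k, B = 10 * (k - j) + 1 ∧ M' = M ∧
      g' 41 = i * k + j ∧ g' 42 = i * k + k ∧ g' 40 = lexUpTo H k i p j ∧
      (g' 43 = if j < k ∧ lexUpTo H k i p j = 1 then 1 else 0) ∧ ∀ r < 40, g' r = g r) ?_ ?_ ?_
    · rintro B g' M' ⟨j, hj, rfl, rfl, h41, h42, h40, h43, hr⟩ h0
      refine ⟨by omega, rfl, ?_, hr⟩
      rw [h40, lexVal]
      rw [h43] at h0
      by_cases hjk : j = k
      · rw [hjk]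
      · refine (lexUpTo_eq_of_ne_one (fun h1 => ?_) hj).symm
        rw [if_pos ⟨by omega, h1⟩] at h0
        omega
    · rintro B g' M' ⟨j, hj, rfl, rfl, h41, h42, h40, h43, hr⟩ h0
      have hjk : j < k ∧ lexUpTo H k i p j = 1 := by
        by_contra hc
        rw [h43, if_neg hc] at h0
        omega
      refine ⟨9, 10 * (k - (j + 1)) + 1, by omega, ?_⟩
      have e4 : (i * k + j + 1) % 2 ^ w = i * k + j + 1 := Nat.mod_eq_of_lt (by omega)
      simp only [Exec, wp, BinOp.eval]
      simp [h41, h42, hr 11, hr 39, h11, h39, e4]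
      refine ⟨j + 1, by omega, rfl, by omega, ?_, ?_, ?_⟩
      · rw [lexUpTo, if_pos hjk.2]
      · rw [lexUpTo, if_pos hjk.2]
        by_cases hH : H (i * k + j) p = 1 <;> by_cases hlt : j + 1 < k <;>
          simp [hH, hlt, add_assoc, e3]
      · intro r hr'
        simp (disch := omega) only [Function.update_of_ne]
        exact hr r hr'
    · refine ⟨0, by omega, rfl, rfl, by simp, by simp, by simp [lexUpTo], ?_, ?_⟩
      · by_cases hk : 0 < k
        · simp [lexUpTo, hk]
        · simp [hk]
      · intro r hr
        simp (disch := omega) only [Function.update_of_ne]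
  · rintro g' M' h t ht
    exact ⟨by omega, h⟩

end Compare

/-! ### The data structure and binary search -/

/-- The sizes of a data structure: `n` points, `G` groups of `T` tables, `k` hash functions per
table, and room for `cap` slots per group. The memory consists of a header of `8` cells that lists
these sizes and the addresses below, the tables, one flag per group, and the slots. -/
structure Layout where
  n : ℕ
  k : ℕ
  T : ℕ
  G : ℕ
  cap : ℕ

namespace Layout

/-- The number of tables. -/
def tables (d : Layout) : ℕ := d.G * d.T

/-- The address of the flags of the groups. -/
def flags (d : Layout) : ℕ := 8 + d.tables * d.n

/-- The address of the slots. -/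
def slots (d : Layout) : ℕ := d.flags + d.G

/-- The size of the memory. -/
def size (d : Layout) : ℕ := d.slots + d.G * d.cap

theorem entry_lt (d : Layout) {i x : ℕ} (hi : i < d.tables) (hx : x < d.n) :
    i * d.n + x < d.tables * d.n := by nlinarith

end Layout

/-- The memory `M₀` holds the tables `tab` for the layout `d`: entry `x` of table `i` is the point
`tab i x`, and in table `i` the points that agree with the query under all hash functions of the
table are at the positions in `[lo i, hi i)`. Flags and slots are working memory and contain
zeros. -/
structure Setup (w : ℕ) (H : ℕ → ℕ → ℕ) (d : Layout) (tab : ℕ → ℕ → ℕ) (lo hi : ℕ → ℕ)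
    (M₀ : List ℕ) : Prop where
  n_pos : 0 < d.n
  T_pos : 0 < d.T
  G_pos : 0 < d.G
  T_lt : d.T < d.cap
  length_eq : M₀.length = d.size
  head_n : M₀.getD 0 0 = d.n
  head_k : M₀.getD 1 0 = d.k
  head_T : M₀.getD 2 0 = d.T
  head_G : M₀.getD 3 0 = d.G
  head_cap : M₀.getD 4 0 = d.cap
  head_flags : M₀.getD 5 0 = d.flags
  head_slots : M₀.getD 6 0 = d.slots
  head_size : M₀.getD 7 0 = d.size
  table : ∀ i < d.tables, ∀ x < d.n, M₀.getD (8 + (i * d.n + x)) 0 = tab i x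
  zero : ∀ a, d.flags ≤ a → M₀.getD a 0 = 0
  lo_le : ∀ i, lo i ≤ hi i
  hi_le : ∀ i, hi i ≤ d.n
  lexVal_eq : ∀ i < d.tables, ∀ x < d.n,
    lexVal H d.k i (tab i x) = if x < lo i then 2 else if x < hi i then 1 else 0
  word_hash : d.tables * d.k + 1 < 2 ^ w
  word_mem : d.size + 4 * d.n + 100 < 2 ^ w
  word_rand : d.G * d.cap * (2 * d.n) < 2 ^ w

/-- The registers `2, …, 13` hold the header of the memory and the constants `8`, `1`, `2`, `0`. -/
structure Env (d : Layout) (g : ℕ → ℕ) : Prop where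
  r2 : g 2 = d.n
  r3 : g 3 = d.k
  r4 : g 4 = d.T
  r5 : g 5 = d.G
  r6 : g 6 = d.cap
  r7 : g 7 = d.flags
  r8 : g 8 = d.slots
  r9 : g 9 = d.size
  r10 : g 10 = 8
  r11 : g 11 = 1
  r12 : g 12 = 2
  r13 : g 13 = 0

theorem Env.congr {d : Layout} {g g' : ℕ → ℕ} (h : Env d g)
    (hr : ∀ r, 2 ≤ r → r < 14 → g' r = g r) : Env d g' := by
  constructor <;> rw [hr _ (by norm_num) (by norm_num)]
  exacts [h.r2, h.r3, h.r4, h.r5, h.r6, h.r7, h.r8, h.r9, h.r10, h.r11, h.r12, h.r13]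

/-- The memory `M` agrees with `M₀` below the working memory. -/
def SameData (d : Layout) (M₀ M : List ℕ) : Prop :=
  M.length = M₀.length ∧ ∀ a < d.flags, M.getD a 0 = M₀.getD a 0

theorem List.getD_set_self {M : List ℕ} {a v : ℕ} (h : a < M.length) :
    (M.set a v).getD a 0 = v := by
  simp [List.getD_eq_getElem?_getD, h]

theorem List.getD_set_of_ne {M : List ℕ} {a b v : ℕ} (h : b ≠ a) :
    (M.set a v).getD b 0 = M.getD b 0 := by
  simp [List.getD_eq_getElem?_getD, List.getElem?_set_ne h.symm]

section Lower

variable {w : ℕ} {H : ℕ → ℕ → ℕ} {D : ℕ → ℕ} {d : Layout} {tab : ℕ → ℕ → ℕ} {lo hi : ℕ → ℕ}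
  {M₀ M : List ℕ} {g : ℕ → ℕ}

theorem Setup.getD_table (S : Setup w H d tab lo hi M₀) (hM : SameData d M₀ M) {i x : ℕ}
    (hi : i < d.tables) (hx : x < d.n) : M.getD (i * d.n + 8 + x) 0 = tab i x := by
  rw [show i * d.n + 8 + x = 8 + (i * d.n + x) by ring, hM.2 _ ?_, S.table i hi x hx]
  have := d.entry_lt hi hx
  rw [Layout.flags]
  omega

theorem Layout.entry_add_lt_size (d : Layout) {i x : ℕ} (hi : i < d.tables) (hx : x ≤ d.n) :
    i * d.n + 8 + x ≤ d.size := by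
  have : i * d.n + x ≤ d.tables * d.n := by nlinarith
  simp only [Layout.size, Layout.slots, Layout.flags]
  omega

/-- Register `30 :=` the first position in the table in register `38` at which the query is not
greater than the point there, and register `33 :=` the address of the table. -/
def lowerProg : Stmt :=
  block [.const 30 0, .arith .add 31 2 13, .arith .mul 33 38 2, .arith .add 33 33 10,
    .arith .lt 32 30 31,
    .loop 32 (block [.arith .add 34 30 31, .arith .div 34 34 12, .arith .add 35 33 34,
      .load 39 35, compareProg, .arith .eq 36 40 12,
      .ite 36 (.arith .add 30 34 11) (.arith .add 31 34 13), .arith .lt 32 30 31])]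

/-- Binary search works because the outcome of the comparison is `2` exactly at the positions of the
table before `lo i`. -/
theorem lowerProg_spec (S : Setup w H d tab lo hi M₀) (hE : Env d g) (hM : SameData d M₀ M)
    {i : ℕ} (h38 : g 38 = i) (hi' : i < d.tables) :
    Exec w H D lowerProg g M (37 * (d.k + 1) * d.n.size)
      (fun g' M' => M' = M ∧ g' 30 = lo i ∧ g' 33 = i * d.n + 8 ∧ g' 38 = i ∧
        ∀ r < 30, g' r = g r) := by
  have hw := S.word_mem
  have hlo : lo i ≤ d.n := (S.lo_le i).trans (S.hi_le i)
  have hin := d.entry_add_lt_size hi' le_rfl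
  have hsz : 0 < d.n.size := Nat.size_pos.mpr S.n_pos
  simp only [Exec, lowerProg, block, wp, BinOp.eval]
  have e1 : (i * d.n) % 2 ^ w = i * d.n := Nat.mod_eq_of_lt (by omega)
  have e2 : (i * d.n + 8) % 2 ^ w = i * d.n + 8 := Nat.mod_eq_of_lt (by omega)
  have e3 : d.n % 2 ^ w = d.n := Nat.mod_eq_of_lt (by omega)
  simp [h38, e1, e2, e3, hE.r2, hE.r13, hE.r10]
  refine Exec.loopWp (P := fun g' M' => M' = M ∧ g' 30 = lo i ∧ g' 33 = i * d.n + 8 ∧ g' 38 = i ∧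
    ∀ r < 30, g' r = g r) (B := 26 * (d.k + 1) * d.n.size + 1) ?_ ?_
  -- invariant: `lo i` lies in `[a, b]`, which is empty after at most `v` more halvings
  · refine Exec.loop (fun B g' M' => ∃ v a b, B = 26 * (d.k + 1) * v + 1 ∧ b - a < 2 ^ v ∧
      a ≤ lo i ∧ lo i ≤ b ∧ b ≤ d.n ∧ M' = M ∧ g' 30 = a ∧ g' 31 = b ∧
      (g' 32 = if a < b then 1 else 0) ∧ g' 33 = i * d.n + 8 ∧ g' 38 = i ∧
      ∀ r < 30, g' r = g r) ?_ ?_ ?_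
    · rintro B g' M' ⟨v, a, b, rfl, hab, ha, hb, hbn, rfl, h30, h31, h32, h33, h38', hr⟩ h0
      have : ¬ a < b := fun h => by rw [h32, if_pos h] at h0; omega
      exact ⟨by omega, rfl, by omega, h33, h38', hr⟩
    · rintro B g' M' ⟨v, a, b, rfl, hab, ha, hb, hbn, rfl, h30, h31, h32, h33, h38', hr⟩ h0
      have hlt : a < b := by
        by_contra h
        rw [h32, if_neg h] at h0
        omega
      obtain ⟨v, rfl⟩ : ∃ v', v = v' + 1 := by
        rcases v with _ | v
        · simp at hab; omega
        · exact ⟨v, rfl⟩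
      rw [pow_succ] at hab
      refine ⟨15 + 10 * (d.k + 1), 26 * (d.k + 1) * v + 1, by nlinarith, ?_⟩
      have hE' : Env d g' := hE.congr fun r _ h => hr r (by omega)
      have e4 : (a + b) % 2 ^ w = a + b := Nat.mod_eq_of_lt (by omega)
      obtain ⟨m, hm⟩ : ∃ m, m = (a + b) / 2 := ⟨_, rfl⟩
      have hmn : m < d.n := by omega
      have hme := d.entry_add_lt_size hi' hmn.le
      have e5 : (i * d.n + 8 + m) % 2 ^ w = i * d.n + 8 + m := Nat.mod_eq_of_lt (by omega)
      have e6 : (m + 1) % 2 ^ w = m + 1 := Nat.mod_eq_of_lt (by omega)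
      have e7 : m % 2 ^ w = m := Nat.mod_eq_of_lt (by omega)
      simp only [Exec, wp, BinOp.eval]
      simp [-List.getD_eq_getElem?_getD, h30, h31, h33, e4, ← hm, e5, hE'.r12, S.getD_table hM hi' hmn]
      refine (compareProg_spec (k := d.k) (i := i) (p := tab i m) (by simp [hE'.r3])
        (by simp [hE'.r11]) (by simp [h38']) (by simp) hi' S.word_hash).wp ?_
      rintro g'' M'' ⟨rfl, h40, hr'⟩ t ht
      have hE'' : Env d g'' := hE'.congr fun r _ h => by
        rw [hr' r (by omega)]
        simp (disch := omega) only [Function.update_of_ne]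
      rw [S.lexVal_eq i hi' m hmn] at h40
      have q30 : g'' 30 = a := by rw [hr' 30 (by omega)]; simp [h30]
      have q31 : g'' 31 = b := by rw [hr' 31 (by omega)]; simp [h31]
      have q33 : g'' 33 = i * d.n + 8 := by rw [hr' 33 (by omega)]; simp [h33]
      have q34 : g'' 34 = m := by rw [hr' 34 (by omega)]; simp
      have q38 : g'' 38 = i := by rw [hr' 38 (by omega)]; simp [h38']
      have qr : ∀ r < 30, g'' r = g r := fun r h => by
        rw [hr' r (by omega)]
        simp (disch := omega) only [Function.update_of_ne]
        exact hr r h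
      simp only [h40, hE''.r12]
      by_cases hml : m < lo i
      · simp [hml, q34, hE''.r11, e6, q31, q33, q38]
        refine ⟨by omega, by omega, hb, hbn, ?_⟩
        intro r h
        simp (disch := omega) only [Function.update_of_ne]
        exact qr r h
      · have h2 : (if m < hi i then 1 else 0) ≠ 2 := by split_ifs <;> omega
        simp [hml, q34, hE''.r13, e7, q30, q33, q38, h2]
        refine ⟨by omega, by omega, by omega, by omega, by omega, ?_⟩
        intro r h
        simp (disch := omega) only [Function.update_of_ne]
        exact qr r h
    · refine ⟨d.n.size, 0, d.n, rfl, by simpa using Nat.lt_size_self d.n, by omega, hlo, le_rfl,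
        rfl, by simp, by simp, by simp, by simp, by simp [h38], ?_⟩
      intro r hr
      simp (disch := omega) only [Function.update_of_ne]
  · rintro g' M' h t ht
    refine ⟨?_, h⟩
    have : 11 ≤ 11 * (d.k + 1) * d.n.size := by nlinarith
    nlinarith

end Lower

/-! ### Filling the slots -/

/-- The slots of table `i` with slot length `s`: the interval `[lo i, hi i)` of positions is cut into
pieces of length `s` (the last one may stick out), and a slot is the starting position of a
piece, as an index into the array of all tables. -/
def tableSlots (n : ℕ) (lo hi : ℕ → ℕ) (s i : ℕ) : List ℕ :=
  (List.range ((hi i - lo i + (s - 1)) / s)).map fun y => i * n + (lo i + s * y)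

/-- The slots of the first `t` tables of group `j`. -/
def partSlots (d : Layout) (lo hi : ℕ → ℕ) (s j t : ℕ) : List ℕ :=
  (List.range t).flatMap fun i => tableSlots d.n lo hi s (j * d.T + i)

/-- The slots of group `j`. -/
def groupSlots (d : Layout) (lo hi : ℕ → ℕ) (s j : ℕ) : List ℕ := partSlots d lo hi s j d.T

/-- Group `j` is kept with slot length `s` if it has fewer than `cap` slots. -/
def Kept (d : Layout) (lo hi : ℕ → ℕ) (s j : ℕ) : Prop :=
  (groupSlots d lo hi s j).length < d.cap

instance (d : Layout) (lo hi : ℕ → ℕ) (s j : ℕ) : Decidable (Kept d lo hi s j) :=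
  inferInstanceAs (Decidable (_ < _))

/-- The slots of the kept groups among the first `t` groups. -/
def keptSlots (d : Layout) (lo hi : ℕ → ℕ) (s t : ℕ) : List ℕ :=
  (List.range t).flatMap fun j => if Kept d lo hi s j then groupSlots d lo hi s j else []

/-- The number of kept groups among the first `t` groups. -/
def keptCount (d : Layout) (lo hi : ℕ → ℕ) (s t : ℕ) : ℕ :=
  ((Finset.range t).filter fun j => Kept d lo hi s j).card

/-- The memory holds the list `l` from address `a` on. -/
def Holds (M : List ℕ) (a : ℕ) (l : List ℕ) : Prop :=
  ∀ z < l.length, M.getD (a + z) 0 = l.getD z 0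

theorem Holds.snoc {M : List ℕ} {a : ℕ} {l : List ℕ} (h : Holds M a l) {v : ℕ}
    (hl : a + l.length < M.length) : Holds (M.set (a + l.length) v) a (l ++ [v]) := by
  intro z hz
  rw [List.length_append, List.length_singleton] at hz
  rcases eq_or_ne z l.length with rfl | hne
  · rw [List.getD_set_self hl]
    simp
  · rw [List.getD_set_of_ne (by omega), h z (by omega), List.getD_append _ _ _ _ (by omega)]

theorem Holds.congr {M M' : List ℕ} {a : ℕ} {l : List ℕ} (h : Holds M a l)
    (hM : ∀ b, a ≤ b → b < a + l.length → M'.getD b 0 = M.getD b 0) : Holds M' a l := by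
  intro z hz
  rw [hM _ (by omega) (by omega), h z hz]

theorem Holds.append {M : List ℕ} {a : ℕ} {l l' : List ℕ} (h : Holds M a l)
    (h' : Holds M (a + l.length) l') : Holds M a (l ++ l') := by
  intro z hz
  rw [List.length_append] at hz
  by_cases hzl : z < l.length
  · rw [h z hzl, List.getD_append _ _ _ _ hzl]
  · rw [List.getD_append_right _ _ _ _ (by omega), ← h' _ (by omega)]
    congr 1
    omega

theorem SameData.set {d : Layout} {M₀ M : List ℕ} (h : SameData d M₀ M) {a v : ℕ}
    (ha : d.flags ≤ a) : SameData d M₀ (M.set a v) :=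
  ⟨by simpa using h.1, fun b hb => by rw [List.getD_set_of_ne (by omega), h.2 b hb]⟩

theorem tableSlots_take_succ {n : ℕ} {lo hi : ℕ → ℕ} {s i y : ℕ} (hs : 0 < s)
    (hy : lo i + s * y < hi i) :
    (tableSlots n lo hi s i).take (y + 1) =
      (tableSlots n lo hi s i).take y ++ [i * n + (lo i + s * y)] := by
  have hlt : y < (hi i - lo i + (s - 1)) / s := by
    rw [Nat.lt_div_iff_mul_lt hs, mul_comm y s]
    omega
  rw [List.take_add_one, tableSlots]
  simp [hlt]

theorem tableSlots_take_of_le {n : ℕ} {lo hi : ℕ → ℕ} {s i y : ℕ} (hs : 0 < s)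
    (hy : hi i ≤ lo i + s * y) :
    (tableSlots n lo hi s i).take y = tableSlots n lo hi s i := by
  apply List.take_of_length_le
  rw [tableSlots, List.length_map, List.length_range, ← Nat.lt_succ_iff,
    Nat.div_lt_iff_lt_mul hs, Nat.succ_mul, mul_comm y s]
  omega

section Fill

variable {w : ℕ} {H : ℕ → ℕ → ℕ} {D : ℕ → ℕ} {d : Layout} {tab : ℕ → ℕ → ℕ} {lo hi : ℕ → ℕ}
  {M₀ M : List ℕ} {g : ℕ → ℕ} {s : ℕ}

/-- Append the slots of the table in register `38` to the slots of the current group, which start at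
slot number `g 15`; register `18` is their number, and at most `cap` of them are recorded. -/
def fillTableProg : Stmt :=
  block [lowerProg, .const 24 1, .loop 24 (block [.const 24 0, .arith .lt 25 30 2,
    .arith .lt 26 18 6, .arith .mul 25 25 26,
    .ite 25 (block [.arith .add 28 33 30, .load 39 28, compareProg, .arith .eq 26 40 11,
      .ite 26 (block [.arith .sub 27 28 10, .arith .add 26 8 15, .arith .add 26 26 18,
        .store 26 27, .arith .add 18 18 11, .arith .add 30 30 14, .const 24 1])
        (.const 99 0)]) (.const 99 0)])]

/-- The list `A` contains the slots of the previous tables of the group. The slots are truncated to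
`cap` elements throughout, so each of them is paid for by the length of the resulting list. -/
theorem fillTableProg_spec (S : Setup w H d tab lo hi M₀) (hE : Env d g) (hM : SameData d M₀ M)
    {i ptr : ℕ} {A : List ℕ} (h38 : g 38 = i) (hi' : i < d.tables) (h14 : g 14 = s)
    (hs : 0 < s) (hsn : s < 2 * d.n) (h15 : g 15 = ptr) (hptr : ptr + d.cap ≤ d.G * d.cap)
    (h18 : g 18 = (A.take d.cap).length) (hA : Holds M (d.slots + ptr) (A.take d.cap)) :
    Exec w H D fillTableProg g M (100 * (d.k + 1) * d.n.size +
        50 * (d.k + 1) * (((A ++ tableSlots d.n lo hi s i).take d.cap).length -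
          (A.take d.cap).length))
      (fun g' M' => SameData d M₀ M' ∧ (∀ a < d.slots + ptr, M'.getD a 0 = M.getD a 0) ∧
        g' 18 = ((A ++ tableSlots d.n lo hi s i).take d.cap).length ∧
        Holds M' (d.slots + ptr) ((A ++ tableSlots d.n lo hi s i).take d.cap) ∧ g' 38 = i ∧
        ∀ r < 24, r ≠ 18 → g' r = g r) := by
  have hw := S.word_mem
  have hin := d.entry_add_lt_size hi' le_rfl
  have hsz : 0 < d.n.size := Nat.size_pos.mpr S.n_pos
  have e1 : 1 % 2 ^ w = 1 := Nat.mod_eq_of_lt (by omega)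
  have hsize : d.slots + (ptr + d.cap) ≤ d.size := by rw [Layout.size]; omega
  have hfl : d.flags ≤ d.slots := by rw [Layout.slots]; omega
  simp only [Exec, fillTableProg, block, wp]
  refine (lowerProg_spec S hE hM h38 hi').wp ?_
  rintro g' M' ⟨rfl, h30, h33, h38', hr⟩ t ht
  rw [e1]
  set full := tableSlots d.n lo hi s i with hfull
  have hlen : ∀ y, ((A ++ full.take y).take d.cap).length ≤ ((A ++ full).take d.cap).length := by
    intro y
    simp only [List.length_take, List.length_append]
    omega
  refine Exec.loopWp (P := fun g' M'' => SameData d M₀ M'' ∧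
    (∀ a < d.slots + ptr, M''.getD a 0 = M'.getD a 0) ∧
        g' 18 = ((A ++ full).take d.cap).length ∧
        Holds M'' (d.slots + ptr) ((A ++ full).take d.cap) ∧ g' 38 = i ∧
        ∀ r < 24, r ≠ 18 → g' r = g r) (B := 50 * (d.k + 1) * (((A ++ full).take d.cap).length -
          (A.take d.cap).length) + 50 * (d.k + 1) + 1) ?_ ?_
  -- invariant: either the loop is about to end with all slots recorded, or the first `y` slots of the
  -- table have been, and register `30` holds the position of the next one
  · obtain ⟨I, hI⟩ : ∃ I : ℕ → (ℕ → ℕ) → List ℕ → Prop, ∀ B g' M'', I B g' M'' ↔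
      SameData d M₀ M'' ∧
      (∀ a < d.slots + ptr, M''.getD a 0 = M'.getD a 0) ∧ g' 38 = i ∧ g' 33 = i * d.n + 8 ∧
      (∀ r < 24, r ≠ 18 → g' r = g r) ∧ 1 ≤ B ∧
      (g' 24 = 0 ∧ g' 18 = ((A ++ full).take d.cap).length ∧
        Holds M'' (d.slots + ptr) ((A ++ full).take d.cap) ∨
       ∃ y, g' 30 = lo i + s * y ∧ (y = 0 ∨ lo i + s * (y - 1) < hi i) ∧
        B = 50 * (d.k + 1) * (((A ++ full).take d.cap).length -
          ((A ++ full.take y).take d.cap).length) + 50 * (d.k + 1) + 1 ∧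
        g' 24 = 1 ∧ g' 18 = ((A ++ full.take y).take d.cap).length ∧
        Holds M'' (d.slots + ptr) ((A ++ full.take y).take d.cap)) := ⟨_, fun _ _ _ => Iff.rfl⟩
    refine Exec.loop I ?_ ?_ ((hI _ _ _).2 ?_)
    · intro B g' M'' h h0
      obtain ⟨hD, hlow, hh38, hh33, hrr, hB, h | ⟨y, -, -, -, h24, -⟩⟩ := (hI _ _ _).1 h
      · exact ⟨hB, hD, hlow, h.2.1, h.2.2, hh38, hrr⟩
      · omega
    · intro B g' M'' h h0
      obtain ⟨hD, hlow, hh38, hh33, hrr, hB, h | ⟨y, hh30, hy, rfl, h24, hh18, hH⟩⟩ :=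
        (hI _ _ _).1 h
      · omega
      -- the next position may lie beyond the table, but it fits into a word
      have hpos : lo i + s * y < 3 * d.n := by
        have := S.hi_le i
        have := S.lo_le i
        rcases hy with rfl | hy
        · have := S.n_pos
          omega
        · rcases y with _ | y
          · simp at hy ⊢; omega
          · rw [Nat.mul_succ]
            simp at hy
            omega
      have hE' : Env d g' := hE.congr fun r _ h => hrr r (by omega) (by omega)
      have q14 : g' 14 = s := by rw [hrr 14 (by omega) (by omega), h14]
      have q15 : g' 15 = ptr := by rw [hrr 15 (by omega) (by omega), h15]
      set cur := A ++ full.take y with hcur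
      -- an iteration that ends the loop
      have hexit : (A ++ full).take d.cap = cur.take d.cap →
          ∀ g'' : ℕ → ℕ, g'' 24 = 0 → g'' 18 = g' 18 → g'' 38 = i → g'' 33 = i * d.n + 8 →
          (∀ r < 24, r ≠ 18 → g'' r = g r) → I 1 g'' M'' := by
        intro he g'' h1 h2 h3 h4 h5
        refine (hI _ _ _).2 ⟨hD, hlow, h3, h4, h5, le_rfl, Or.inl ⟨h1, ?_, ?_⟩⟩
        · rw [h2, hh18, he]
        · rw [he]; exact hH
      by_cases hc : lo i + s * y < d.n ∧ (cur.take d.cap).length < d.cap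
      · have hcl : cur.length < d.cap := by
          rw [List.length_take] at hc
          omega
        have hct : cur.take d.cap = cur := List.take_of_length_le hcl.le
        rw [hct] at hc hh18 hH ⊢
        have hme := d.entry_add_lt_size hi' hc.1.le
        have e5 : (i * d.n + 8 + (lo i + s * y)) % 2 ^ w = i * d.n + 8 + (lo i + s * y) :=
          Nat.mod_eq_of_lt (by omega)
        by_cases hin2 : lo i + s * y < hi i
        · have hsucc : A ++ full.take (y + 1) = cur ++ [i * d.n + (lo i + s * y)] := by
            rw [hfull, tableSlots_take_succ hs hin2, ← List.append_assoc]
          have hct' : (A ++ full.take (y + 1)).take d.cap =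
              cur ++ [i * d.n + (lo i + s * y)] := by
            rw [hsucc, List.take_of_length_le]
            simpa using hcl
          have hL := hlen (y + 1)
          rw [hct', List.length_append, List.length_singleton] at hL
          refine ⟨50 * (d.k + 1) - 1, 50 * (d.k + 1) * (((A ++ full).take d.cap).length -
            (cur.length + 1)) + 50 * (d.k + 1) + 1, ?_, ?_⟩
          · obtain ⟨e, he⟩ := Nat.exists_eq_add_of_le hL
            rw [he, show cur.length + 1 + e - cur.length = e + 1 by omega,
              Nat.mul_succ (50 * (d.k + 1)) e,
              Nat.add_sub_cancel_left]
            omega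
          simp only [Exec, wp, BinOp.eval]
          simp [-List.getD_eq_getElem?_getD, -List.length_take, hh30, hh33, hE'.r2, hE'.r6, hc.1,
            hh18, hcl, e1, e5, S.getD_table hD hi' hc.1]
          refine (compareProg_spec (k := d.k) (i := i) (p := tab i (lo i + s * y))
            (by simp [hE'.r3]) (by simp [hE'.r11]) (by simp [hh38]) (by simp) hi' S.word_hash).wp ?_
          rintro g'' N ⟨rfl, h40, hr'⟩ u hu
          rw [S.lexVal_eq i hi' _ hc.1, if_neg (by omega), if_pos hin2] at h40
          have hE'' : Env d g'' := hE'.congr fun r _ h => by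
            rw [hr' r (by omega)]
            simp (disch := omega) only [Function.update_of_ne]
          have q28 : g'' 28 = i * d.n + 8 + (lo i + s * y) := by rw [hr' 28 (by omega)]; simp
          have q30 : g'' 30 = lo i + s * y := by rw [hr' 30 (by omega)]; simp [hh30]
          have q33 : g'' 33 = i * d.n + 8 := by rw [hr' 33 (by omega)]; simp [hh33]
          have q38 : g'' 38 = i := by rw [hr' 38 (by omega)]; simp [hh38]
          have q18 : g'' 18 = cur.length := by rw [hr' 18 (by omega)]; simp [hh18]
          have q14' : g'' 14 = s := by rw [hr' 14 (by omega)]; simp [q14]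
          have q15' : g'' 15 = ptr := by rw [hr' 15 (by omega)]; simp [q15]
          have f2 : (d.slots + ptr + cur.length) % 2 ^ w = d.slots + ptr + cur.length :=
            Nat.mod_eq_of_lt (by omega)
          have f3 : (cur.length + 1) % 2 ^ w = cur.length + 1 := Nat.mod_eq_of_lt (by omega)
          have f4 : (lo i + s * y + s) % 2 ^ w = lo i + s * (y + 1) := by
            rw [Nat.mod_eq_of_lt (by omega), Nat.mul_succ, add_assoc]
          have f5 : i * d.n + 8 + (lo i + s * y) - 8 = i * d.n + (lo i + s * y) := by omega
          simp [-List.getD_eq_getElem?_getD, -List.length_take, h40, hE''.r11, hE''.r10, q28, q30,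
            q18, q14', q15', hE''.r8, f2, f3, f4, f5]
          refine ⟨by omega, (hI _ _ _).2 ⟨hD.set (by omega), ?_, by simp [q38], by simp [q33], ?_,
            by omega, Or.inr ⟨y + 1, by simp, Or.inr (by simpa using hin2), ?_, by simp, ?_, ?_⟩⟩⟩
          · intro a ha
            rw [List.getD_set_of_ne (by omega), hlow a ha]
          · intro r h1 h2
            simp (disch := omega) only [Function.update_of_ne]
            rw [hr' r (by omega)]
            simp (disch := omega) only [Function.update_of_ne]
            exact hrr r h1 h2
          · rw [hct']
            simp
          · rw [hct']
            simp
          · rw [hct']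
            apply hH.snoc
            rw [hD.1, S.length_eq]
            omega
        -- the position lies beyond the interval of the points that agree with the query
        · have he : (A ++ full).take d.cap = cur := by
            have : full.take y = full := tableSlots_take_of_le hs (by omega)
            rw [hcur, this] at hcl ⊢
            exact List.take_of_length_le hcl.le
          refine ⟨50 * (d.k + 1) - 1, 1, by omega, ?_⟩
          simp only [Exec, wp, BinOp.eval]
          simp [-List.getD_eq_getElem?_getD, -List.length_take, hh30, hh33, hE'.r2, hE'.r6, hc.1,
            hh18, hcl, e1, e5, S.getD_table hD hi' hc.1]
          refine (compareProg_spec (k := d.k) (i := i) (p := tab i (lo i + s * y))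
            (by simp [hE'.r3]) (by simp [hE'.r11]) (by simp [hh38]) (by simp) hi' S.word_hash).wp ?_
          rintro g'' N ⟨rfl, h40, hr'⟩ u hu
          rw [S.lexVal_eq i hi' _ hc.1, if_neg (by omega), if_neg hin2] at h40
          have q11 : g'' 11 = 1 := by rw [hr' 11 (by omega)]; simp [hE'.r11]
          simp [h40, q11]
          refine ⟨by omega, hexit (by rw [he, hct]) _ ?_ ?_ ?_ ?_ ?_⟩
          · simp [hr' 24]
          · simp [hr' 18, hh18]
          · simp [hr' 38, hh38]
          · simp [hr' 33, hh33]
          · intro r h1 h2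
            simp (disch := omega) only [Function.update_of_ne]
            rw [hr' r (by omega)]
            simp (disch := omega) only [Function.update_of_ne]
            exact hrr r h1 h2
      -- the end of the table has been reached, or there is no room for another slot
      · have he : (A ++ full).take d.cap = cur.take d.cap := by
          rcases not_and_or.mp hc with h | h
          · rw [hcur, hfull, tableSlots_take_of_le hs ((S.hi_le i).trans (by omega))]
          · have hcl : d.cap ≤ cur.length := by
              rw [List.length_take] at h
              omega
            have : A ++ full = cur ++ full.drop y := by
              rw [hcur, List.append_assoc, List.take_append_drop]
            rw [this, List.take_append_of_le_length hcl]
        refine ⟨50 * (d.k + 1) - 1, 1, by omega, ?_⟩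
        simp only [Exec, wp, BinOp.eval]
        have hz : ((if lo i + s * y < d.n then 1 else 0) *
            if (cur.take d.cap).length < d.cap then 1 else 0) % 2 ^ w = 0 := by
          rcases not_and_or.mp hc with h | h <;> simp only [if_neg h, zero_mul, mul_zero, Nat.zero_mod]
        simp [-List.length_take, -mul_ite, -ite_mul, hh30, hh18, hE'.r2, hE'.r6, hz]
        refine ⟨by omega, hexit he _ ?_ ?_ ?_ ?_ ?_⟩
        · simp
        · simp [-List.length_take, hh18]
        · simp [hh38]
        · simp [hh33]
        · intro r h1 h2
          simp (disch := omega) only [Function.update_of_ne]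
          exact hrr r h1 h2
    · refine ⟨hM, fun _ _ => rfl, by simp [h38'], by simp [h33], ?_, by omega,
        Or.inr ⟨0, by simp [h30], Or.inl rfl, by simp, by simp, ?_, by simpa using hA⟩⟩
      · intro r h1 h2
        simp (disch := omega) only [Function.update_of_ne]
        exact hr r (by omega)
      · simp [hr 18, h18]
  · rintro g' M' h u hu
    refine ⟨?_, h⟩
    have : 37 * (d.k + 1) * d.n.size + 54 * (d.k + 1) ≤ 100 * (d.k + 1) * d.n.size := by nlinarith
    omega

end Fill

section FillGroups

variable {w : ℕ} {H : ℕ → ℕ → ℕ} {D : ℕ → ℕ} {d : Layout} {tab : ℕ → ℕ → ℕ} {lo hi : ℕ → ℕ}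
  {M₀ M : List ℕ} {g : ℕ → ℕ} {s : ℕ}

theorem partSlots_succ (s j t : ℕ) :
    partSlots d lo hi s j (t + 1) =
      partSlots d lo hi s j t ++ tableSlots d.n lo hi s (j * d.T + t) := by
  simp [partSlots, List.range_succ]

theorem keptSlots_succ (s t : ℕ) :
    keptSlots d lo hi s (t + 1) =
      keptSlots d lo hi s t ++ if Kept d lo hi s t then groupSlots d lo hi s t else [] := by
  simp [keptSlots, List.range_succ]

theorem length_keptSlots_le (s t : ℕ) : (keptSlots d lo hi s t).length ≤ t * d.cap := by
  induction t with
  | zero => simp [keptSlots]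
  | succ t ih =>
    rw [keptSlots_succ, List.length_append, Nat.succ_mul]
    refine Nat.add_le_add ih ?_
    split_ifs with h
    · exact h.le
    · simp

theorem keptCount_succ (s t : ℕ) :
    keptCount d lo hi s (t + 1) =
      keptCount d lo hi s t + if Kept d lo hi s t then 1 else 0 := by
  rw [keptCount, Finset.range_add_one, Finset.filter_insert]
  split_ifs with h
  · rw [Finset.card_insert_of_notMem (by simp), keptCount]
  · rfl

theorem keptCount_le (s t : ℕ) : keptCount d lo hi s t ≤ t :=
  (Finset.card_filter_le _ _).trans (by simp)

theorem Layout.group_lt (d : Layout) {j t : ℕ} (hj : j < d.G) (ht : t < d.T) :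
    j * d.T + t < d.tables := by
  rw [Layout.tables]
  nlinarith

theorem Setup.tables_le (S : Setup w H d tab lo hi M₀) : d.tables ≤ d.size := by
  have : d.tables * 1 ≤ d.tables * d.n := Nat.mul_le_mul_left _ S.n_pos
  simp only [Layout.size, Layout.slots, Layout.flags]
  omega

/-- Record the slots of the group in register `17`, at most `cap` of them, from slot number `g 15`
on; register `18 :=` their number. -/
def fillGroupProg : Stmt :=
  block [.const 18 0, .arith .mul 38 17 4, .arith .add 20 38 4, .arith .lt 21 38 20,
    .loop 21 (block [fillTableProg, .arith .add 38 38 11, .arith .lt 21 38 20])]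

/-- The time does not depend on the number of points in the intervals, as at most `cap` slots are
recorded and `T < cap`. -/
theorem fillGroupProg_spec (S : Setup w H d tab lo hi M₀) (hE : Env d g) (hM : SameData d M₀ M)
    {j ptr : ℕ} (h17 : g 17 = j) (hj : j < d.G) (h14 : g 14 = s)
    (hs : 0 < s) (hsn : s < 2 * d.n) (h15 : g 15 = ptr) (hptr : ptr + d.cap ≤ d.G * d.cap) :
    Exec w H D fillGroupProg g M (200 * ((d.k + 1) * d.n.size) * d.cap)
      (fun g' M' => SameData d M₀ M' ∧ (∀ a < d.slots + ptr, M'.getD a 0 = M.getD a 0) ∧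
        g' 18 = ((groupSlots d lo hi s j).take d.cap).length ∧
        Holds M' (d.slots + ptr) ((groupSlots d lo hi s j).take d.cap) ∧
        ∀ r < 20, r ≠ 18 → g' r = g r) := by
  have hw := S.word_mem
  have hsz : 0 < d.n.size := Nat.size_pos.mpr S.n_pos
  have htab := S.tables_le
  have hjT : j * d.T + d.T ≤ d.tables := by rw [Layout.tables]; nlinarith
  have e1 : (j * d.T) % 2 ^ w = j * d.T := Nat.mod_eq_of_lt (by omega)
  have e2 : (j * d.T + d.T) % 2 ^ w = j * d.T + d.T := Nat.mod_eq_of_lt (by omega)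
  simp only [Exec, fillGroupProg, block, wp, BinOp.eval]
  simp [-List.getD_eq_getElem?_getD, -List.length_take, h17, hE.r4, e1, e2]
  set len := fun t => ((partSlots d lo hi s j t).take d.cap).length with hlen
  have hlencap : ∀ t, len t ≤ d.cap := fun t => by
    simp only [hlen, List.length_take]
    omega
  have hlenmono : ∀ t, len t ≤ len (t + 1) := fun t => by
    simp only [hlen, partSlots_succ, List.length_take, List.length_append]
    omega
  obtain ⟨c, hc⟩ : ∃ c, c = 100 * (d.k + 1) * d.n.size := ⟨_, rfl⟩
  obtain ⟨e, he⟩ : ∃ e, e = 50 * (d.k + 1) := ⟨_, rfl⟩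
  refine Exec.loopWp (P := fun g' M' => SameData d M₀ M' ∧
        (∀ a < d.slots + ptr, M'.getD a 0 = M.getD a 0) ∧
        g' 18 = ((groupSlots d lo hi s j).take d.cap).length ∧
        Holds M' (d.slots + ptr) ((groupSlots d lo hi s j).take d.cap) ∧
        ∀ r < 20, r ≠ 18 → g' r = g r) (B := d.T * (c + 6) + e * d.cap + 1) ?_ ?_
  -- invariant: the slots of the first `t` tables of the group have been recorded, up to `cap` of them
  · obtain ⟨I, hI⟩ : ∃ I : ℕ → (ℕ → ℕ) → List ℕ → Prop, ∀ B g' M', I B g' M' ↔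
        SameData d M₀ M' ∧ (∀ a < d.slots + ptr, M'.getD a 0 = M.getD a 0) ∧
        (∀ r < 20, r ≠ 18 → g' r = g r) ∧ ∃ t ≤ d.T,
          B = (d.T - t) * (c + 6) + e * (d.cap - len t) + 1 ∧ g' 38 = j * d.T + t ∧
          g' 20 = j * d.T + d.T ∧ (g' 21 = if t < d.T then 1 else 0) ∧ g' 18 = len t ∧
          Holds M' (d.slots + ptr) ((partSlots d lo hi s j t).take d.cap) :=
      ⟨_, fun _ _ _ => Iff.rfl⟩
    refine Exec.loop I ?_ ?_ ((hI _ _ _).2 ?_)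
    · intro B g' M' h h0
      obtain ⟨hD, hlow, hr, t, ht, rfl, -, -, h21, h18, hH⟩ := (hI _ _ _).1 h
      have : t = d.T := by
        by_contra hne
        rw [h21, if_pos (by omega)] at h0
        omega
      subst this
      exact ⟨by omega, hD, hlow, h18, hH, hr⟩
    · intro B g' M' h h0
      obtain ⟨hD, hlow, hr, t, ht, rfl, h38, h20, h21, h18, hH⟩ := (hI _ _ _).1 h
      have htT : t < d.T := by
        by_contra hne
        rw [h21, if_neg hne] at h0
        omega
      refine ⟨c + e * (len (t + 1) - len t) + 4 + 1,
        (d.T - (t + 1)) * (c + 6) + e * (d.cap - len (t + 1)) + 1, ?_, ?_⟩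
      · rw [show d.T - t = d.T - (t + 1) + 1 by omega, Nat.succ_mul,
          show d.cap - len t = d.cap - len (t + 1) + (len (t + 1) - len t) by
            have := hlencap (t + 1)
            have := hlenmono t
            omega, Nat.mul_add e]
        omega
      simp only [Exec, wp, BinOp.eval]
      have hE' : Env d g' := hE.congr fun r _ h => hr r (by omega) (by omega)
      refine (fillTableProg_spec S hE' hD h38 (d.group_lt hj htT)
        (by rw [hr 14 (by omega) (by omega), h14]) hs hsn
        (by rw [hr 15 (by omega) (by omega), h15]) hptr h18 hH).wp ?_
      rintro g'' N ⟨hD', hlow', h18', hH', h38', hr'⟩ u hu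
      have q11 : g'' 11 = 1 := by rw [hr' 11 (by omega) (by omega), hE'.r11]
      have q20 : g'' 20 = j * d.T + d.T := by rw [hr' 20 (by omega) (by omega), h20]
      have e3 : (j * d.T + t + 1) % 2 ^ w = j * d.T + t + 1 := Nat.mod_eq_of_lt (by omega)
      rw [← partSlots_succ] at h18' hH' hu
      simp [-List.getD_eq_getElem?_getD, -List.length_take, q11, q20, h38', e3]
      refine ⟨?_, (hI _ _ _).2 ⟨hD', fun a ha => by rw [hlow' a ha, hlow a ha], ?_, t + 1, by omega,
        rfl, by simp [add_assoc], by simp [q20], ?_, ?_, hH'⟩⟩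
      · rw [← hc, ← he] at hu
        change u ≤ c + e * (len (t + 1) - len t) at hu
        omega
      · intro r h1 h2
        simp (disch := omega) only [Function.update_of_ne]
        rw [hr' r (by omega) h2, hr r h1 h2]
      · simp [add_assoc]
      · simpa [-List.length_take] using h18'
    · refine ⟨hM, fun _ _ => rfl, ?_, 0, by omega, ?_, by simp, by simp, by simp, ?_, ?_⟩
      · intro r h1 h2
        simp (disch := omega) only [Function.update_of_ne]
      · simp [hlen, partSlots]
      · simp [hlen, partSlots]
      · intro z hz
        simp [partSlots] at hz
  · rintro g' M' h u hu
    refine ⟨?_, h⟩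
    obtain ⟨Y, hY⟩ : ∃ Y, Y = (d.k + 1) * d.n.size * d.cap := ⟨_, rfl⟩
    have hT := S.T_lt
    have h1 : d.T * (c + 6) ≤ 106 * Y := by
      have : 100 * (d.k + 1) * d.n.size + 6 ≤ 106 * ((d.k + 1) * d.n.size) := by nlinarith
      calc d.T * (c + 6) ≤ d.cap * (106 * ((d.k + 1) * d.n.size)) := by
            rw [hc]
            exact Nat.mul_le_mul hT.le this
        _ = _ := by rw [hY]; ring
    have h2 : e * d.cap ≤ 50 * Y := by
      rw [he, hY, ← mul_assoc]
      refine Nat.mul_le_mul_right _ ?_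
      nlinarith
    have h3 : 1 ≤ Y := by
      rw [hY]
      exact Nat.mul_pos (Nat.mul_pos (by omega) hsz) (by omega)
    have h4 : 200 * ((d.k + 1) * d.n.size) * d.cap = 200 * Y := by rw [hY]; ring
    omega

/-- Record the slots of all groups with less than `cap` slots, one group after the other, and set
the flags of these groups. Register `15 :=` the number of slots and register `16 :=` the number of
groups kept. -/
def fillProg : Stmt :=
  block [.const 15 0, .const 16 0, .const 17 0, .const 19 1,
    .loop 19 (block [fillGroupProg, .arith .lt 22 18 6, .arith .add 23 7 17, .store 23 22,
      .arith .add 16 16 22, .arith .mul 22 22 18, .arith .add 15 15 22, .arith .add 17 17 11,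
      .arith .lt 19 17 5])]

theorem fillProg_spec (S : Setup w H d tab lo hi M₀) (hE : Env d g) (hM : SameData d M₀ M)
    (h14 : g 14 = s) (hs : 0 < s) (hsn : s < 2 * d.n) :
    Exec w H D fillProg g M (250 * ((d.k + 1) * d.n.size) * (d.G * d.cap))
      (fun g' M' => SameData d M₀ M' ∧ g' 15 = (keptSlots d lo hi s d.G).length ∧
        g' 16 = keptCount d lo hi s d.G ∧ Holds M' d.slots (keptSlots d lo hi s d.G) ∧
        (∀ j < d.G, M'.getD (d.flags + j) 0 = if Kept d lo hi s j then 1 else 0) ∧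
        ∀ r < 15, g' r = g r) := by
  have hw := S.word_mem
  have hsz : 0 < d.n.size := Nat.size_pos.mpr S.n_pos
  have hcap : 0 < d.cap := lt_of_le_of_lt (Nat.zero_le _) S.T_lt
  have hG := S.G_pos
  have hsize : d.size = d.flags + d.G + d.G * d.cap := by rw [Layout.size, Layout.slots]
  have hslots : d.slots = d.flags + d.G := rfl
  have e0 : 1 % 2 ^ w = 1 := Nat.mod_eq_of_lt (by omega)
  simp only [Exec, fillProg, block, wp]
  obtain ⟨c, hc⟩ : ∃ c, c = 200 * ((d.k + 1) * d.n.size) * d.cap := ⟨_, rfl⟩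
  refine Exec.loopWp (P := fun g' M' => SameData d M₀ M' ∧
        g' 15 = (keptSlots d lo hi s d.G).length ∧
        g' 16 = keptCount d lo hi s d.G ∧ Holds M' d.slots (keptSlots d lo hi s d.G) ∧
        (∀ j < d.G, M'.getD (d.flags + j) 0 = if Kept d lo hi s j then 1 else 0) ∧
        ∀ r < 15, g' r = g r) (B := d.G * (c + 18) + 1) ?_ ?_
  -- invariant: the first `t` groups have been processed; the slots of groups that are not kept get
  -- overwritten by those of the next group
  · obtain ⟨I, hI⟩ : ∃ I : ℕ → (ℕ → ℕ) → List ℕ → Prop, ∀ B g' M', I B g' M' ↔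
        SameData d M₀ M' ∧ (∀ r < 15, g' r = g r) ∧ ∃ t ≤ d.G,
          B = (d.G - t) * (c + 18) + 1 ∧ g' 17 = t ∧ (g' 19 = if t < d.G then 1 else 0) ∧
          g' 15 = (keptSlots d lo hi s t).length ∧ g' 16 = keptCount d lo hi s t ∧
          Holds M' d.slots (keptSlots d lo hi s t) ∧
          ∀ j < t, M'.getD (d.flags + j) 0 = if Kept d lo hi s j then 1 else 0 :=
      ⟨_, fun _ _ _ => Iff.rfl⟩
    refine Exec.loop I ?_ ?_ ((hI _ _ _).2 ?_)
    · intro B g' M' h h0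
      obtain ⟨hD, hr, t, ht, rfl, -, h19, h15, h16, hH, hF⟩ := (hI _ _ _).1 h
      have : t = d.G := by
        by_contra hne
        rw [h19, if_pos (by omega)] at h0
        omega
      subst this
      exact ⟨by omega, hD, h15, h16, hH, hF, hr⟩
    · intro B g' M' h h0
      obtain ⟨hD, hr, t, ht, rfl, h17, h19, h15, h16, hH, hF⟩ := (hI _ _ _).1 h
      have htG : t < d.G := by
        by_contra hne
        rw [h19, if_neg hne] at h0
        omega
      refine ⟨c + 17, (d.G - (t + 1)) * (c + 18) + 1, ?_, ?_⟩
      · rw [show d.G - t = d.G - (t + 1) + 1 by omega, Nat.succ_mul]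
        omega
      simp only [Exec, wp, BinOp.eval]
      have hE' : Env d g' := hE.congr fun r _ h => hr r (by omega)
      have hl := length_keptSlots_le (d := d) (lo := lo) (hi := hi) s t
      have hk := keptCount_le (d := d) (lo := lo) (hi := hi) s t
      have htcap : t * d.cap + d.cap ≤ d.G * d.cap := by nlinarith
      refine (fillGroupProg_spec S hE' hD h17 htG (by rw [hr 14 (by omega), h14]) hs hsn
        h15 (by omega)).wp ?_
      rintro g'' N ⟨hD', hlow', h18', hH', hr'⟩ u hu
      have hE'' : Env d g'' := hE'.congr fun r _ h => hr' r (by omega) (by omega)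
      have q15 : g'' 15 = (keptSlots d lo hi s t).length := by
        rw [hr' 15 (by omega) (by omega), h15]
      have q16 : g'' 16 = keptCount d lo hi s t := by rw [hr' 16 (by omega) (by omega), h16]
      have q17 : g'' 17 = t := by rw [hr' 17 (by omega) (by omega), h17]
      have hlt : (((groupSlots d lo hi s t).take d.cap).length < d.cap) ↔ Kept d lo hi s t := by
        rw [Kept, List.length_take]
        omega
      have f1 : (d.flags + t) % 2 ^ w = d.flags + t := Nat.mod_eq_of_lt (by omega)
      have f2 : (t + 1) % 2 ^ w = t + 1 := Nat.mod_eq_of_lt (by omega)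
      have f3 : (keptCount d lo hi s t + if Kept d lo hi s t then 1 else 0) % 2 ^ w =
          keptCount d lo hi s (t + 1) := by
        rw [Nat.mod_eq_of_lt (by split_ifs <;> omega), keptCount_succ]
      have f4 : (((if Kept d lo hi s t then 1 else 0) * g'' 18) % 2 ^ w) =
          (if Kept d lo hi s t then groupSlots d lo hi s t else []).length := by
        split_ifs with hK
        · rw [h18', List.take_of_length_le (Nat.le_of_lt hK), one_mul, Nat.mod_eq_of_lt]
          have : (groupSlots d lo hi s t).length < d.cap := hK
          omega
        · simp
      have hl' := length_keptSlots_le (d := d) (lo := lo) (hi := hi) s (t + 1)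
      have f5 : ((keptSlots d lo hi s t).length +
          (if Kept d lo hi s t then groupSlots d lo hi s t else []).length) % 2 ^ w =
          (keptSlots d lo hi s (t + 1)).length := by
        rw [← List.length_append, ← keptSlots_succ, Nat.mod_eq_of_lt]
        have : (t + 1) * d.cap ≤ d.G * d.cap := Nat.mul_le_mul_right _ htG
        omega
      simp only [ne_eq, Function.update_self, not_false_eq_true, Function.update_of_ne,
        Nat.reduceEqDiff, hE''.r6, hE''.r7, hE''.r11, hE''.r5, q15, q16, q17, f1, f2]
      rw [h18'] at f4 ⊢
      simp only [hlt, f3, f4, f5]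
      have hslot : ∀ z, (N.set (d.flags + t) (if Kept d lo hi s t then 1 else 0)).getD
          (d.slots + z) 0 = N.getD (d.slots + z) 0 := fun z =>
        List.getD_set_of_ne (by omega)
      refine ⟨by omega, (hI _ _ _).2 ⟨hD'.set (by omega), ?_, t + 1, by omega,
        rfl, by simp, by simp, by simp, by simp, ?_, ?_⟩⟩
      · intro r h1
        simp (disch := omega) only [Function.update_of_ne]
        rw [hr' r (by omega) (by omega), hr r h1]
      · rw [keptSlots_succ]
        refine Holds.append (hH.congr fun b h1 h2 => ?_) ?_
        · rw [List.getD_set_of_ne (by omega), hlow' b h2]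
        · split_ifs with hK
          · rw [List.take_of_length_le (Nat.le_of_lt hK)] at hH'
            refine hH'.congr fun b h1 h2 => ?_
            rw [List.getD_set_of_ne (by omega)]
          · intro z hz
            simp at hz
      · intro j hj
        rcases eq_or_ne j t with rfl | hne
        · rw [List.getD_set_self]
          rw [hD'.1, S.length_eq]
          omega
        · rw [List.getD_set_of_ne (by omega), hlow' _ (by omega), hF j (by omega)]
    · refine ⟨hM, ?_, 0, by omega, by simp, by simp, by simp [hG, e0], by simp [keptSlots],
        by simp [keptCount], ?_, by omega⟩
      · intro r h1
        simp (disch := omega) only [Function.update_of_ne]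
      · intro z hz
        simp [keptSlots] at hz
  · rintro g' M' h u hu
    refine ⟨?_, h⟩
    have h1 : 1 ≤ (d.k + 1) * d.n.size * d.cap :=
      Nat.mul_pos (Nat.mul_pos (by omega) hsz) (by omega)
    have h2 : d.G * (c + 18) ≤ d.G * (218 * ((d.k + 1) * d.n.size * d.cap)) := by
      refine Nat.mul_le_mul_left _ ?_
      rw [hc]
      nlinarith
    have h3 : 1 ≤ d.G * ((d.k + 1) * d.n.size * d.cap) := Nat.mul_pos hG h1
    have h4 : 250 * ((d.k + 1) * d.n.size) * (d.G * d.cap) =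
      250 * (d.G * ((d.k + 1) * d.n.size * d.cap)) := by ring
    rw [h4]
    have h5 : d.G * (218 * ((d.k + 1) * d.n.size * d.cap)) =
      218 * (d.G * ((d.k + 1) * d.n.size * d.cap)) := by ring
    omega

/-- Try the slot lengths `1, 2, 4, …` until more than half of the groups are kept. The slot length
is in register `14`. -/
def searchProg : Stmt :=
  block [.const 14 1, .const 1 1, .loop 1 (block [fillProg, .arith .add 19 16 16,
    .arith .lt 19 5 19, .ite 19 (.const 1 0) (.arith .mul 14 14 12)])]

/-- If more than half of the groups are kept with each slot length from `s₀` on, the search ends with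
a slot length below `2 * s₀`. -/
theorem searchProg_spec (S : Setup w H d tab lo hi M₀) (hE : Env d g) (hM : SameData d M₀ M)
    {s₀ : ℕ} (hs₀ : 0 < s₀) (hs₀n : s₀ ≤ d.n)
    (hgood : ∀ s, s₀ ≤ s → d.G < 2 * keptCount d lo hi s d.G) :
    Exec w H D searchProg g M (600 * ((d.k + 1) * d.n.size ^ 2) * (d.G * d.cap))
      (fun g' M' => SameData d M₀ M' ∧ ∃ s, 0 < s ∧ s < 2 * s₀ ∧ g' 14 = s ∧
        d.G < 2 * keptCount d lo hi s d.G ∧ g' 15 = (keptSlots d lo hi s d.G).length ∧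
        Holds M' d.slots (keptSlots d lo hi s d.G) ∧
        (∀ j < d.G, M'.getD (d.flags + j) 0 = if Kept d lo hi s j then 1 else 0) ∧
        ∀ r < 14, r ≠ 1 → g' r = g r) := by
  have hw := S.word_mem
  have hsz : 0 < d.n.size := Nat.size_pos.mpr S.n_pos
  have hcap : 0 < d.cap := lt_of_le_of_lt (Nat.zero_le _) S.T_lt
  have hG := S.G_pos
  have hsize : d.size = d.flags + d.G + d.G * d.cap := by rw [Layout.size, Layout.slots]
  have e0 : 1 % 2 ^ w = 1 := Nat.mod_eq_of_lt (by omega)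
  obtain ⟨c, hc⟩ : ∃ c, c = 250 * ((d.k + 1) * d.n.size) * (d.G * d.cap) := ⟨_, rfl⟩
  simp only [Exec, searchProg, block, wp]
  refine Exec.loopWp (P := fun g' M' => SameData d M₀ M' ∧ ∃ s, 0 < s ∧ s < 2 * s₀ ∧ g' 14 = s ∧
        d.G < 2 * keptCount d lo hi s d.G ∧ g' 15 = (keptSlots d lo hi s d.G).length ∧
        Holds M' d.slots (keptSlots d lo hi s d.G) ∧
        (∀ j < d.G, M'.getD (d.flags + j) 0 = if Kept d lo hi s j then 1 else 0) ∧
        ∀ r < 14, r ≠ 1 → g' r = g r) (B := (d.n.size + 1) * (c + 9) + 1) ?_ ?_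
  -- invariant: after `e` unsuccessful attempts the slot length `s` is at least `2 ^ e`, while it stays
  -- below `2 * s₀` because every length from `s₀` on is successful
  · obtain ⟨I, hI⟩ : ∃ I : ℕ → (ℕ → ℕ) → List ℕ → Prop, ∀ B g' M', I B g' M' ↔
        SameData d M₀ M' ∧ (∀ r < 14, r ≠ 1 → g' r = g r) ∧ 1 ≤ B ∧ ∃ s,
          0 < s ∧ s < 2 * s₀ ∧ g' 14 = s ∧
          (g' 1 = 1 ∧ (∃ e, 2 ^ e ≤ s ∧ B = (d.n.size + 1 - e) * (c + 9) + 1) ∨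
            g' 1 = 0 ∧ d.G < 2 * keptCount d lo hi s d.G ∧
            g' 15 = (keptSlots d lo hi s d.G).length ∧
            Holds M' d.slots (keptSlots d lo hi s d.G) ∧
            ∀ j < d.G, M'.getD (d.flags + j) 0 = if Kept d lo hi s j then 1 else 0) :=
      ⟨_, fun _ _ _ => Iff.rfl⟩
    refine Exec.loop I ?_ ?_ ((hI _ _ _).2 ?_)
    · intro B g' M' h h0
      obtain ⟨hD, hr, hB, s, h1, h2, h14, ⟨h, -⟩ | ⟨-, h3, h4, h5, h6⟩⟩ := (hI _ _ _).1 h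
      · omega
      · exact ⟨hB, hD, s, h1, h2, h14, h3, h4, h5, h6, hr⟩
    · intro B g' M' h h0
      obtain ⟨hD, hr, hB, s, h1, h2, h14, ⟨hflag, e, he, rfl⟩ | ⟨hflag, -⟩⟩ := (hI _ _ _).1 h
      swap
      · omega
      have hE' : Env d g' := hE.congr fun r _ h => hr r (by omega) (by omega)
      -- the search stops before the slot length exceeds twice the number of points
      have hes : e ≤ d.n.size := by
        have h3 : 2 ^ e < 2 ^ (d.n.size + 1) := by
          have := Nat.lt_size_self d.n
          rw [pow_succ]
          omega
        have := (Nat.pow_lt_pow_iff_right (by norm_num)).1 h3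
        omega
      refine ⟨c + 8, (d.n.size + 1 - (e + 1)) * (c + 9) + 1, ?_, ?_⟩
      · rw [show d.n.size + 1 - e = d.n.size + 1 - (e + 1) + 1 by omega, Nat.succ_mul]
        omega
      simp only [Exec, wp, BinOp.eval]
      refine (fillProg_spec S hE' hD h14 h1 (by omega)).wp ?_
      rintro g'' N ⟨hD', h15', h16', hH', hF', hr'⟩ u hu
      rw [← hc] at hu
      have hE'' : Env d g'' := hE'.congr fun r _ h => hr' r (by omega)
      have hk := keptCount_le (d := d) (lo := lo) (hi := hi) s d.G
      have q14 : g'' 14 = s := by rw [hr' 14 (by omega), h14]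
      have f1 : (keptCount d lo hi s d.G + keptCount d lo hi s d.G) % 2 ^ w =
          2 * keptCount d lo hi s d.G := by
        rw [← two_mul, Nat.mod_eq_of_lt]
        have : d.G * 1 ≤ d.G * d.cap := Nat.mul_le_mul_left _ hcap
        omega
      have f2 : (s * 2) % 2 ^ w = s * 2 := Nat.mod_eq_of_lt (by omega)
      by_cases hgt : d.G < 2 * keptCount d lo hi s d.G
      · simp [-List.getD_eq_getElem?_getD, h16', f1, hE''.r5, hgt]
        refine ⟨by omega, (hI _ _ _).2 ⟨hD', ?_, by omega, s, h1, h2,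
          by simp [q14], Or.inr ⟨by simp, hgt, by simp [h15'], hH', hF'⟩⟩⟩
        · intro r h3 h4
          simp (disch := omega) only [Function.update_of_ne]
          rw [hr' r (by omega), hr r h3 h4]
      · simp [-List.getD_eq_getElem?_getD, h16', f1, hE''.r5, hgt, hE''.r12, q14, f2]
        have hlt : s < s₀ := by
          by_contra h3
          exact hgt (hgood s (by omega))
        refine ⟨by omega, (hI _ _ _).2 ⟨hD', ?_, by omega, s * 2, by omega, by omega,
          by simp, Or.inl ⟨?_, e + 1, ?_, by rw [Nat.add_sub_add_right]⟩⟩⟩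
        · intro r h3 h4
          simp (disch := omega) only [Function.update_of_ne]
          rw [hr' r (by omega), hr r h3 h4]
        · simp [hr' 1, hflag]
        · rw [pow_succ]
          omega
    · refine ⟨hM, ?_, by omega, 1, by omega, by omega, by simp [e0],
        Or.inl ⟨by simp [e0], 0, by simp, by simp⟩⟩
      intro r h1 h2
      simp (disch := omega) only [Function.update_of_ne]
  · rintro g' M' h u hu
    refine ⟨?_, h⟩
    have h1 : 1 ≤ (d.k + 1) * d.n.size * (d.G * d.cap) :=
      Nat.mul_pos (Nat.mul_pos (by omega) hsz) (Nat.mul_pos hG hcap)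
    obtain ⟨Y, hY⟩ : ∃ Y, Y = (d.k + 1) * d.n.size * (d.G * d.cap) := ⟨_, rfl⟩
    have h2 : 600 * ((d.k + 1) * d.n.size ^ 2) * (d.G * d.cap) = 600 * (d.n.size * Y) := by
      rw [hY]; ring
    have h3 : c = 250 * Y := by rw [hc, hY]; ring
    rw [h2]
    rw [h3] at hu
    rw [← hY] at h1
    have h4 : (d.n.size + 1) * (250 * Y + 9) + 1 + 4 ≤ 600 * (d.n.size * Y) := by
      nlinarith [Nat.mul_le_mul hsz h1, Nat.mul_le_mul_right Y hsz, Nat.mul_le_mul_left d.n.size h1]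
    omega

end FillGroups

/-! ### One round of rejection sampling -/

section Round

variable {w : ℕ} {H : ℕ → ℕ → ℕ} {D : ℕ → ℕ} {d : Layout} {tab : ℕ → ℕ → ℕ} {lo hi : ℕ → ℕ}
  {M₀ M : List ℕ} {g : ℕ → ℕ} {s : ℕ}

/-- Table `j` belongs to a kept group, and point `p` agrees with the query under all hash functions
of table `j`. -/
def Covers (H : ℕ → ℕ → ℕ) (d : Layout) (lo hi : ℕ → ℕ) (s p j : ℕ) : Prop :=
  Kept d lo hi s (j / d.T) ∧ lexVal H d.k j p = 1

instance (H : ℕ → ℕ → ℕ) (d : Layout) (lo hi : ℕ → ℕ) (s p j : ℕ) :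
    Decidable (Covers H d lo hi s p j) :=
  inferInstanceAs (Decidable (_ ∧ _))

/-- The length of the scan `i - 1, i - 2, …` that stops at the first element of `c`, or at `0`. -/
def scanLength (c : ℕ → Prop) [DecidablePred c] : ℕ → ℕ
  | 0 => 0
  | i + 1 => if c i then 1 else scanLength c i + 1

/-- The memory after the search for the slot length `s`: slots and flags have been filled in. -/
structure Filled (d : Layout) (lo hi : ℕ → ℕ) (s : ℕ) (M₀ M : List ℕ) : Prop where
  same : SameData d M₀ M
  holds : Holds M d.slots (keptSlots d lo hi s d.G)
  flag : ∀ j < d.G, M.getD (d.flags + j) 0 = if Kept d lo hi s j then 1 else 0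

/-- Scan the tables below the one in register `38` downwards. If a table of a kept group in which
the point in register `39` agrees with the query is met, stop; if there is none, report the point
and set register `1` to `0`. -/
def scanProg : Stmt :=
  block [.const 27 1, .loop 27 (.ite 38 (block [.arith .sub 38 38 11, .arith .div 28 38 4,
    .arith .add 28 7 28, .load 28 28,
    .ite 28 (block [compareProg, .arith .eq 28 40 11, .ite 28 (.const 27 0) (.const 99 0)])
      (.const 99 0)]) (block [.const 27 0, .const 1 0, .arith .add 0 39 13]))]

/-- The scan reports the point `p` if and only if no table of a kept group below table `i` covers it. -/
theorem scanProg_spec (S : Setup w H d tab lo hi M₀) (hE : Env d g) (hF : Filled d lo hi s M₀ M)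
    {i p : ℕ} (h38 : g 38 = i) (hi' : i < d.tables) (h39 : g 39 = p) (hp : p < 2 ^ w)
    (h1 : g 1 = 1) :
    Exec w H D scanProg g M (40 * (d.k + 1) * (scanLength (Covers H d lo hi s p) i + 1))
      (fun g' M' => M' = M ∧ (∀ r, 2 ≤ r → r < 20 → g' r = g r) ∧
        ((∀ j < i, ¬ Covers H d lo hi s p j) → g' 1 = 0 ∧ g' 0 = p) ∧
        ((∃ j < i, Covers H d lo hi s p j) → g' 1 = 1)) := by
  have hw := S.word_mem
  have htab := S.tables_le
  have hsize : d.size = d.flags + d.G + d.G * d.cap := by rw [Layout.size, Layout.slots]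
  have e0 : 1 % 2 ^ w = 1 := Nat.mod_eq_of_lt (by omega)
  have ep : p % 2 ^ w = p := Nat.mod_eq_of_lt hp
  simp only [Exec, scanProg, block, wp, e0]
  set c := Covers H d lo hi s p with hc
  obtain ⟨K, hK⟩ : ∃ K, K = 10 * (d.k + 1) + 18 := ⟨_, rfl⟩
  refine Exec.loopWp (P := fun g' M' => M' = M ∧ (∀ r, 2 ≤ r → r < 20 → g' r = g r) ∧
        ((∀ j < i, ¬ c j) → g' 1 = 0 ∧ g' 0 = p) ∧
        ((∃ j < i, c j) → g' 1 = 1)) (B := K * scanLength c i + 9) ?_ ?_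
  -- invariant: either the outcome is known, or no table from `j` on covers the point
  · obtain ⟨I, hI⟩ : ∃ I : ℕ → (ℕ → ℕ) → List ℕ → Prop, ∀ B g' M', I B g' M' ↔
        M' = M ∧ (∀ r, 2 ≤ r → r < 20 → g' r = g r) ∧ 1 ≤ B ∧
        (g' 27 = 1 ∧ (∃ j ≤ i, B = K * scanLength c j + 9 ∧ (∀ j' < i, j ≤ j' → ¬ c j') ∧
            g' 38 = j ∧ g' 39 = p ∧ g' 1 = 1) ∨
          g' 27 = 0 ∧ (((∀ j < i, ¬ c j) → g' 1 = 0 ∧ g' 0 = p) ∧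
            ((∃ j < i, c j) → g' 1 = 1))) := ⟨_, fun _ _ _ => Iff.rfl⟩
    refine Exec.loop I ?_ ?_ ((hI _ _ _).2 ?_)
    · intro B g' M' h h0
      obtain ⟨hM, hr, hB, ⟨h27, -⟩ | ⟨-, hQ⟩⟩ := (hI _ _ _).1 h
      · omega
      · exact ⟨hB, hM, hr, hQ⟩
    · intro B g' M' h h0
      obtain ⟨rfl, hr, hB, ⟨h27, j, hji, rfl, hno, hh38, hh39, hh1⟩ | ⟨h27, -⟩⟩ := (hI _ _ _).1 h
      swap
      · omega
      have hE' : Env d g' := hE.congr fun r h1 h2 => hr r h1 (by omega)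
      rcases j with _ | j
      · refine ⟨7, 1, by simp [scanLength], ?_⟩
        simp only [Exec, wp, BinOp.eval]
        simp [hh38, hh39, hE'.r13, ep]
        refine (hI _ _ _).2 ⟨rfl, ?_, by omega, Or.inr ⟨by simp, ?_, ?_⟩⟩
        · intro r h1 h2
          simp (disch := omega) only [Function.update_of_ne]
          exact hr r h1 h2
        · simp
        · rintro ⟨j', hj', hcj⟩
          exact absurd hcj (hno j' hj' (by omega))
      · have hjT : j / d.T < d.G := by
          rw [Nat.div_lt_iff_lt_mul S.T_pos]
          have : d.tables = d.G * d.T := rfl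
          omega
        have f1 : (d.flags + j / d.T) % 2 ^ w = d.flags + j / d.T := Nat.mod_eq_of_lt (by omega)
        refine ⟨K - 1, if c j then 1 else K * scanLength c j + 9, ?_, ?_⟩
        · rw [scanLength]
          split_ifs
          · omega
          · rw [Nat.mul_succ]; omega
        simp only [Exec, wp, BinOp.eval]
        simp [-List.getD_eq_getElem?_getD, hh38, hE'.r4, hE'.r7, hE'.r11, f1, hF.flag _ hjT]
        by_cases hk : Kept d lo hi s (j / d.T)
        · simp [hk]
          refine (compareProg_spec (k := d.k) (i := j) (p := p)
            (by simp [hE'.r3]) (by simp [hE'.r11]) (by simp) (by simp [hh39])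
            (show j < d.tables by omega) S.word_hash).wp ?_
          rintro g'' N ⟨rfl, h40, hr'⟩ u hu
          have q11 : g'' 11 = 1 := by rw [hr' 11 (by omega)]; simp [hE'.r11]
          have q27 : g'' 27 = 1 := by rw [hr' 27 (by omega)]; simp [h27]
          have q38 : g'' 38 = j := by rw [hr' 38 (by omega)]; simp
          have q39 : g'' 39 = p := by rw [hr' 39 (by omega)]; simp [hh39]
          have q1 : g'' 1 = 1 := by rw [hr' 1 (by omega)]; simp [hh1]
          have qr : ∀ r, 2 ≤ r → r < 20 → g'' r = g r := by
            intro r h1 h2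
            rw [hr' r (by omega)]
            simp (disch := omega) only [Function.update_of_ne]
            exact hr r h1 h2
          by_cases hl : lexVal H d.k j p = 1
          · have hcj : c j := ⟨hk, hl⟩
            simp [h40, hl, q11, hcj]
            refine ⟨by omega, (hI _ _ _).2 ⟨rfl, ?_, by omega, Or.inr ⟨by simp, ?_, ?_⟩⟩⟩
            · intro r h1 h2
              simp (disch := omega) only [Function.update_of_ne]
              exact qr r h1 h2
            · intro hall
              exact absurd hcj (hall j (by omega))
            · simp [q1]
          · have hcj : ¬ c j := fun h => hl h.2
            simp [h40, hl, q11, hcj]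
            refine ⟨by omega, (hI _ _ _).2 ⟨rfl, ?_, by omega, Or.inl ⟨by simp [q27], j, by omega,
              rfl, ?_, by simp [q38], by simp [q39], by simp [q1]⟩⟩⟩
            · intro r h1 h2
              simp (disch := omega) only [Function.update_of_ne]
              exact qr r h1 h2
            · intro j' h1 h2
              rcases eq_or_lt_of_le h2 with rfl | h2
              · exact hcj
              · exact hno j' h1 h2
        · have hcj : ¬ c j := fun h => hk h.1
          simp [hk, hcj]
          refine ⟨by omega, (hI _ _ _).2 ⟨rfl, ?_, by omega, Or.inl ⟨by simp [h27], j, by omega,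
            rfl, ?_, by simp, by simp [hh39], by simp [hh1]⟩⟩⟩
          · intro r h1 h2
            simp (disch := omega) only [Function.update_of_ne]
            exact hr r h1 h2
          · intro j' h1 h2
            rcases eq_or_lt_of_le h2 with rfl | h2
            · exact hcj
            · exact hno j' h1 h2
    · refine ⟨rfl, ?_, by omega, Or.inl ⟨by simp, i, le_rfl, rfl, by omega, by simp [h38],
        by simp [h39], by simp [h1]⟩⟩
      intro r h1 h2
      simp (disch := omega) only [Function.update_of_ne]
  · rintro g' M' h u hu
    refine ⟨?_, h⟩
    have : K * scanLength c i + 9 + 2 ≤ 40 * (d.k + 1) * (scanLength c i + 1) := by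
      rw [hK]
      nlinarith [Nat.zero_le (scanLength c i), Nat.zero_le (d.k * scanLength c i)]
    change _ ≤ 40 * (d.k + 1) * (scanLength c i + 1)
    omega

/-- The table that the slot of the number `u` belongs to. -/
def drawTable (d : Layout) (lo hi : ℕ → ℕ) (s u : ℕ) : ℕ :=
  (keptSlots d lo hi s d.G).getD (u / s) 0 / d.n

/-- The position in its table that the number `u` stands for. -/
def drawPos (d : Layout) (lo hi : ℕ → ℕ) (s u : ℕ) : ℕ :=
  (keptSlots d lo hi s d.G).getD (u / s) 0 % d.n + u % s

/-- Position `x` of table `i` contains a near point that agrees with the query in table `i`. -/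
def Candidate (H : ℕ → ℕ → ℕ) (D : ℕ → ℕ) (d : Layout) (tab : ℕ → ℕ → ℕ) (i x : ℕ) : Prop :=
  x < d.n ∧ D (tab i x) = 0 ∧ lexVal H d.k i (tab i x) = 1

instance (H : ℕ → ℕ → ℕ) (D : ℕ → ℕ) (d : Layout) (tab : ℕ → ℕ → ℕ) (i x : ℕ) :
    Decidable (Candidate H D d tab i x) :=
  inferInstanceAs (Decidable (_ ∧ _ ∧ _))

/-- Position `x` of table `i` is accepted: it contains a candidate, and no earlier table of a kept
group covers the same point. -/
def Accepted (H : ℕ → ℕ → ℕ) (D : ℕ → ℕ) (d : Layout) (tab : ℕ → ℕ → ℕ) (lo hi : ℕ → ℕ)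
    (s i x : ℕ) : Prop :=
  Candidate H D d tab i x ∧ ∀ j < i, ¬ Covers H d lo hi s (tab i x) j

instance (H : ℕ → ℕ → ℕ) (D : ℕ → ℕ) (d : Layout) (tab : ℕ → ℕ → ℕ) (lo hi : ℕ → ℕ) (s i x : ℕ) :
    Decidable (Accepted H D d tab lo hi s i x) :=
  inferInstanceAs (Decidable (_ ∧ _))

/-- The number of comparisons made at position `x` of table `i`, plus one. -/
def roundWork (H : ℕ → ℕ → ℕ) (D : ℕ → ℕ) (d : Layout) (tab : ℕ → ℕ → ℕ) (lo hi : ℕ → ℕ)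
    (s i x : ℕ) : ℕ :=
  1 + if Candidate H D d tab i x then scanLength (Covers H d lo hi s (tab i x)) i else 0

theorem mem_keptSlots {v : ℕ} (S : Setup w H d tab lo hi M₀) (hs : 0 < s)
    (hv : v ∈ keptSlots d lo hi s d.G) : ∃ i < d.tables, ∃ x < d.n, v = i * d.n + x := by
  simp only [keptSlots, List.mem_flatMap, List.mem_range] at hv
  obtain ⟨j, hj, hv⟩ := hv
  split_ifs at hv
  · simp only [groupSlots, partSlots, List.mem_flatMap, List.mem_range, tableSlots,
      List.mem_map] at hv
    obtain ⟨t, ht, y, hy, rfl⟩ := hv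
    refine ⟨j * d.T + t, d.group_lt hj ht, _, ?_, rfl⟩
    rw [Nat.lt_div_iff_mul_lt hs, mul_comm y s] at hy
    have := S.hi_le (j * d.T + t)
    omega
  · simp at hv

/-- Test the number in register `20`: find its table, its position, and the point there, and report
the point if it is accepted. -/
def testProg : Stmt :=
  block [.arith .div 21 20 14, .arith .mod 22 20 14, .arith .add 21 8 21, .load 21 21,
    .arith .div 38 21 2, .arith .mod 23 21 2, .arith .add 23 23 22, .arith .lt 24 23 2,
    .ite 24 (block [.arith .mul 25 38 2, .arith .add 25 25 10, .arith .add 25 25 23, .load 39 25,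
      .near 26 39, .ite 26 (.const 99 0) (block [compareProg, .arith .eq 27 40 11,
        .ite 27 scanProg (.const 99 0)])]) (.const 99 0)]

set_option maxHeartbeats 800000 in
/-- A rejected number leaves the constants, the slots and register `1` as they are, so that another
round can follow; an accepted one ends the loop of the rounds by setting register `1` to `0`. -/
theorem testProg_spec (S : Setup w H d tab lo hi M₀) (hE : Env d g) (hF : Filled d lo hi s M₀ M)
    (htab : ∀ i x, D (tab i x) = 0 → tab i x < 2 ^ w)
    (h14 : g 14 = s) (hs : 0 < s) (hsn : s < 2 * d.n) {u : ℕ} (h20 : g 20 = u)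
    (hu : u < (keptSlots d lo hi s d.G).length * s) (h1 : g 1 = 1) :
    Exec w H D testProg g M (90 * (d.k + 1) *
        roundWork H D d tab lo hi s (drawTable d lo hi s u) (drawPos d lo hi s u))
      (fun g' M' => M' = M ∧ (∀ r, 2 ≤ r → r < 20 → g' r = g r) ∧
        if Accepted H D d tab lo hi s (drawTable d lo hi s u) (drawPos d lo hi s u) then
          g' 1 = 0 ∧ g' 0 = tab (drawTable d lo hi s u) (drawPos d lo hi s u)
        else g' 1 = 1) := by
  have hw := S.word_mem
  have hn := S.n_pos
  have hz : u / s < (keptSlots d lo hi s d.G).length := by rwa [Nat.div_lt_iff_lt_mul hs]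
  have hlen := length_keptSlots_le (d := d) (lo := lo) (hi := hi) s d.G
  have hsize : d.size = d.slots + d.G * d.cap := by rw [Layout.size]
  obtain ⟨i, hi', x₀, hx₀, hv⟩ := mem_keptSlots S hs
    (v := (keptSlots d lo hi s d.G).getD (u / s) 0) (by
      rw [List.getD_eq_getElem _ _ hz]
      exact List.getElem_mem _)
  have hdiv : (i * d.n + x₀) / d.n = i := by
    rw [mul_comm, Nat.mul_add_div hn, Nat.div_eq_of_lt hx₀, add_zero]
  have hmod : (i * d.n + x₀) % d.n = x₀ := by
    rw [mul_comm, Nat.mul_add_mod, Nat.mod_eq_of_lt hx₀]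
  have hT : drawTable d lo hi s u = i := by rw [drawTable, hv, hdiv]
  have hP : drawPos d lo hi s u = x₀ + u % s := by rw [drawPos, hv, hmod]
  rw [hT, hP]
  have hus : u % s < s := Nat.mod_lt _ hs
  set x := x₀ + u % s with hx
  have hin := d.entry_add_lt_size hi' le_rfl
  have e1 : (d.slots + u / s) % 2 ^ w = d.slots + u / s := Nat.mod_eq_of_lt (by omega)
  have e2 : (x₀ + u % s) % 2 ^ w = x := Nat.mod_eq_of_lt (by omega)
  have hload : M.getD (d.slots + u / s) 0 = i * d.n + x₀ := by rw [hF.holds _ hz, hv]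
  obtain ⟨W, hW⟩ : ∃ W, W = roundWork H D d tab lo hi s i x := ⟨_, rfl⟩
  have hW1 : 1 ≤ W := by rw [hW, roundWork]; omega
  have hbase : 90 * (d.k + 1) ≤ 90 * (d.k + 1) * W := Nat.le_mul_of_pos_right _ hW1
  rw [← hW]
  obtain ⟨Q, hQ⟩ : ∃ Q : (ℕ → ℕ) → List ℕ → Prop, ∀ g' M', Q g' M' ↔ M' = M ∧
      (∀ r, 2 ≤ r → r < 20 → g' r = g r) ∧ if Accepted H D d tab lo hi s i x then
        g' 1 = 0 ∧ g' 0 = tab i x else g' 1 = 1 := ⟨_, fun _ _ => Iff.rfl⟩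
  refine Exec.mono (Q := Q) ?_ le_rfl fun g' M' h => (hQ _ _).1 h
  simp only [Exec, testProg, block, wp, BinOp.eval]
  simp [-List.getD_eq_getElem?_getD, h20, h14, hE.r8, hE.r2, e1, hload, hdiv, hmod, e2]
  -- the last slot of an interval may stick out of the table
  by_cases hxn : x < d.n
  swap
  · have hna : ¬ Accepted H D d tab lo hi s i x := fun h => hxn h.1.1
    simp [hxn]
    refine ⟨by omega, (hQ _ _).2 ⟨rfl, ?_, ?_⟩⟩
    · intro r h1 h2
      simp (disch := omega) only [Function.update_of_ne]
    · simp [hna, h1]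
  have e5 : (i * d.n + 8 + x) % 2 ^ w = i * d.n + 8 + x := Nat.mod_eq_of_lt (by omega)
  simp [-List.getD_eq_getElem?_getD, hxn, hE.r10, e5, S.getD_table hF.same hi' hxn]
  by_cases hD : D (tab i x) = 0
  swap
  · have hna : ¬ Accepted H D d tab lo hi s i x := fun h => hD h.1.2.1
    simp [hD]
    refine ⟨by omega, (hQ _ _).2 ⟨rfl, ?_, ?_⟩⟩
    · intro r h1 h2
      simp (disch := omega) only [Function.update_of_ne]
    · simp [hna, h1]
  simp [hD]
  refine (compareProg_spec (k := d.k) (i := i) (p := tab i x)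
    (by simp [hE.r3]) (by simp [hE.r11]) (by simp) (by simp) hi' S.word_hash).wp ?_
  rintro g' M' ⟨rfl, h40, hr⟩ t ht
  have q11 : g' 11 = 1 := by rw [hr 11 (by omega)]; simp [hE.r11]
  have q1 : g' 1 = 1 := by rw [hr 1 (by omega)]; simp [h1]
  have q38 : g' 38 = i := by rw [hr 38 (by omega)]; simp
  have q39 : g' 39 = tab i x := by rw [hr 39 (by omega)]; simp
  have qr : ∀ r, 2 ≤ r → r < 20 → g' r = g r := by
    intro r h1 h2
    rw [hr r (by omega)]
    simp (disch := omega) only [Function.update_of_ne]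
  by_cases hl : lexVal H d.k i (tab i x) = 1
  · have hcand : Candidate H D d tab i x := ⟨hxn, hD, hl⟩
    simp [h40, hl, q11]
    have hE' : Env d (Function.update g' 27 1) := hE.congr fun r h1 h2 => by
      simp (disch := omega) only [Function.update_of_ne]
      exact qr r h1 (by omega)
    refine (scanProg_spec S hE' hF (i := i) (p := tab i x) (by simp [q38]) hi' (by simp [q39])
      (htab i x hD) (by simp [q1])).wp ?_
    rintro g'' N ⟨rfl, hr', hacc, hrej⟩ t' ht'
    refine ⟨?_, (hQ _ _).2 ⟨rfl, ?_, ?_⟩⟩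
    · have : W = 1 + scanLength (Covers H d lo hi s (tab i x)) i := by
        rw [hW, roundWork, if_pos hcand]
      rw [show scanLength (Covers H d lo hi s (tab i x)) i + 1 = W by omega] at ht'
      have h50 : 50 * (d.k + 1) ≤ 50 * (d.k + 1) * W := Nat.le_mul_of_pos_right _ hW1
      have h90 : 90 * (d.k + 1) * W = 40 * (d.k + 1) * W + 50 * (d.k + 1) * W := by ring
      omega
    · intro r h1 h2
      rw [hr' r h1 h2]
      simp (disch := omega) only [Function.update_of_ne]
      exact qr r h1 h2
    · split_ifs with ha
      · exact hacc ha.2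
      · refine hrej ?_
        by_contra hne
        push Not at hne
        exact ha ⟨hcand, hne⟩
  · have hna : ¬ Accepted H D d tab lo hi s i x := fun h => hl h.1.2.2
    simp [h40, hl, q11]
    refine ⟨by omega, (hQ _ _).2 ⟨rfl, ?_, ?_⟩⟩
    · intro r h1 h2
      simp (disch := omega) only [Function.update_of_ne]
      exact qr r h1 h2
    · simp [hna, q1]

end Round

/-! ### Rejection sampling: distribution and running time -/

section Sampling

variable {w : ℕ} {H : ℕ → ℕ → ℕ} {D : ℕ → ℕ} {M₀ : List ℕ}

/-- The configurations that have halted, report `i`, and have restored the memory `M₀`. -/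
def finals (M₀ : List ℕ) (i : ℕ) : Set Config := {C | C.code = [] ∧ C.reg 0 = i ∧ C.mem = M₀}

/-- The probability that the machine, started from `C`, has reported `i` within `T` steps. -/
noncomputable def hit (w : ℕ) (H : ℕ → ℕ → ℕ) (D : ℕ → ℕ) (M₀ : List ℕ) (T : ℕ) (C : Config)
    (i : ℕ) : ℝ≥0∞ :=
  (run w H D T C).toOuterMeasure (finals M₀ i)

theorem run_of_mem_finals {C : Config} {i : ℕ} (h : C ∈ finals M₀ i) (T : ℕ) :
    run w H D T C = PMF.pure C := by
  obtain ⟨code, reg, mem⟩ := C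
  obtain ⟨rfl, -, -⟩ : code = [] ∧ reg 0 = i ∧ mem = M₀ := h
  induction T with
  | zero => rfl
  | succ T ih =>
    rw [run_succ, step, PMF.pure_bind, ih]

theorem hit_of_mem_finals {C : Config} {i : ℕ} (h : C ∈ finals M₀ i) (T : ℕ) :
    hit w H D M₀ T C i = 1 := by
  rw [hit, run_of_mem_finals h, PMF.toOuterMeasure_pure_apply, if_pos h]

theorem hit_add_of_pure {S T : ℕ} {C C' : Config} (h : run w H D S C = PMF.pure C') (i : ℕ) :
    hit w H D M₀ (S + T) C i = hit w H D M₀ T C' i := by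
  rw [hit, run_add_of_pure h, hit]

theorem hit_mono {T T' : ℕ} (h : T ≤ T') (C : Config) (i : ℕ) :
    hit w H D M₀ T C i ≤ hit w H D M₀ T' C i := by
  obtain ⟨S, rfl⟩ := Nat.exists_eq_add_of_le h
  rw [hit, hit, run_add, PMF.toOuterMeasure_bind_apply, PMF.toOuterMeasure_apply]
  refine ENNReal.tsum_le_tsum fun C' => ?_
  by_cases hC : C' ∈ finals M₀ i
  · have := hit_of_mem_finals (w := w) (H := H) (D := D) hC S
    rw [hit] at this
    rw [Set.indicator_of_mem hC, this, mul_one]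
  · rw [Set.indicator_of_notMem hC]
    exact zero_le

theorem sum_hit_le_one (T : ℕ) (C : Config) (N : Finset ℕ) :
    ∑ i ∈ N, hit w H D M₀ T C i ≤ 1 := by
  simp only [hit, PMF.toOuterMeasure_apply]
  rw [← Summable.tsum_finsetSum fun _ _ => ENNReal.summable, ← (run w H D T C).tsum_coe]
  refine ENNReal.tsum_le_tsum fun C' => ?_
  classical
  by_cases hC : C'.reg 0 ∈ N
  · rw [Finset.sum_eq_single_of_mem _ hC fun i _ hi => Set.indicator_of_notMem
      (fun h => hi h.2.1.symm) _]
    exact Set.indicator_le_self _ _ _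
  · rw [Finset.sum_eq_zero fun i hi => Set.indicator_of_notMem
      (fun h => hC (by rw [h.2.1]; exact hi)) _]
    exact zero_le

theorem hit_le_one (T : ℕ) (C : Config) (i : ℕ) : hit w H D M₀ T C i ≤ 1 := by
  simpa using sum_hit_le_one (w := w) (H := H) (D := D) (M₀ := M₀) T C {i}

theorem hit_ne_top (T : ℕ) (C : Config) (i : ℕ) : hit w H D M₀ T C i ≠ ⊤ :=
  ne_top_of_le_ne_top ENNReal.one_ne_top (hit_le_one T C i)

/-- A random choice averages the probabilities of its outcomes. -/
theorem hit_rand (T x y : ℕ) (K : List Stmt) (g : ℕ → ℕ) (M : List ℕ) (hy : 0 < g y) (i : ℕ) :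
    (hit w H D M₀ (1 + T) ⟨.rand x y :: K, g, M⟩ i).toReal =
      ∑ u ∈ Finset.range (g y), ((g y : ℕ) : ℝ)⁻¹ *
        (hit w H D M₀ T ⟨K, Function.update g x u, M⟩ i).toReal := by
  have h : hit w H D M₀ (1 + T) ⟨.rand x y :: K, g, M⟩ i =
      ∑ u ∈ Finset.range (g y), ((g y : ℕ) : ℝ≥0∞)⁻¹ *
        hit w H D M₀ T ⟨K, Function.update g x u, M⟩ i := by
    rw [hit, run_add, run_one, step, unif, dif_neg hy.ne', PMF.bind_map,
      PMF.toOuterMeasure_bind_apply]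
    rw [tsum_eq_sum (s := Finset.range (g y))]
    · refine Finset.sum_congr rfl fun u hu => ?_
      rw [PMF.uniformOfFinset_apply_of_mem _ hu, Finset.card_range]
      rfl
    · intro u hu
      rw [PMF.uniformOfFinset_apply_of_notMem _ hu, zero_mul]
  rw [h, ENNReal.toReal_sum]
  · simp [ENNReal.toReal_mul]
  · intro u _
    refine ENNReal.mul_ne_top ?_ (hit_ne_top _ _ _)
    simp [hy.ne']

/-- Rounds of rejection sampling. From each configuration in `heads` the machine draws a uniform
number `u < Y`; if `u` is accepted it reports `pt u`, otherwise it returns to `heads`, in both cases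
within `cost u ≤ c` steps in all. Each element of `N` is reported for exactly one `u`. -/
structure Rounds (w : ℕ) (H : ℕ → ℕ → ℕ) (D : ℕ → ℕ) (M₀ : List ℕ) (heads : Set Config)
    (N : Finset ℕ) (Y c : ℕ) (acc : ℕ → Prop) (pt cost : ℕ → ℕ) : Prop where
  nonempty : N.Nonempty
  round : ∀ C ∈ heads, ∃ C' : ℕ → Config,
    (∀ T i, (hit w H D M₀ (3 + T) C i).toReal =
      ∑ u ∈ Finset.range Y, ((Y : ℕ) : ℝ)⁻¹ * (hit w H D M₀ T (C' u) i).toReal) ∧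
    ∀ u < Y, ∃ t, 3 + t ≤ cost u ∧ ∃ C'', run w H D t (C' u) = PMF.pure C'' ∧
      (acc u → C'' ∈ finals M₀ (pt u)) ∧ (¬ acc u → C'' ∈ heads)
  cost_le : ∀ u < Y, cost u ≤ c
  mem : ∀ u < Y, acc u → pt u ∈ N
  existsUnique : ∀ i ∈ N, ∃! u, u < Y ∧ acc u ∧ pt u = i

variable {heads : Set Config} {N : Finset ℕ} {Y c : ℕ} {acc : ℕ → Prop} {pt cost : ℕ → ℕ}

theorem Rounds.sum_pt (R : Rounds w H D M₀ heads N Y c acc pt cost) [DecidablePred acc] {i : ℕ}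
    (hi : i ∈ N) (y : ℝ) :
    ∑ u ∈ Finset.range Y, (if acc u then if pt u = i then y else 0 else 0) = y := by
  obtain ⟨u, ⟨hu, ha, hp⟩, huniq⟩ := R.existsUnique i hi
  rw [Finset.sum_eq_single u]
  · rw [if_pos ha, if_pos hp]
  · intro u' hu' hne
    split_ifs with h1 h2
    · exact absurd (huniq u' ⟨Finset.mem_range.1 hu', h1, h2⟩) hne
    · rfl
    · rfl
  · exact fun h => absurd (Finset.mem_range.2 hu) h

theorem Rounds.sum_acc (R : Rounds w H D M₀ heads N Y c acc pt cost) [DecidablePred acc] :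
    ∑ u ∈ Finset.range Y, (if acc u then (1 : ℝ) else 0) = N.card := by
  have h : ∀ u ∈ Finset.range Y, (if acc u then (1 : ℝ) else 0) =
      ∑ i ∈ N, if acc u then if pt u = i then (1 : ℝ) else 0 else 0 := by
    intro u hu
    split_ifs with ha
    · rw [Finset.sum_ite_eq, if_pos (R.mem u (Finset.mem_range.1 hu) ha)]
    · simp
  rw [Finset.sum_congr rfl h, Finset.sum_comm, Finset.sum_congr rfl fun i hi => R.sum_pt hi 1]
  simp

theorem Rounds.sum_not_acc (R : Rounds w H D M₀ heads N Y c acc pt cost) [DecidablePred acc] :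
    ∑ u ∈ Finset.range Y, (if acc u then (0 : ℝ) else 1) = Y - N.card := by
  rw [← R.sum_acc, eq_sub_iff_add_eq, ← Finset.sum_add_distrib]
  rw [Finset.sum_congr rfl (g := fun _ => (1 : ℝ)) fun u _ => by split_ifs <;> simp]
  simp

theorem Rounds.pos (R : Rounds w H D M₀ heads N Y c acc pt cost) : 0 < Y := by
  obtain ⟨i, hi⟩ := R.nonempty
  obtain ⟨u, ⟨hu, -⟩, -⟩ := R.existsUnique i hi
  omega

theorem Rounds.card_le (R : Rounds w H D M₀ heads N Y c acc pt cost) : (N.card : ℝ) ≤ Y := by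
  classical
  have h := R.sum_not_acc
  have : (0 : ℝ) ≤ ∑ u ∈ Finset.range Y, (if acc u then (0 : ℝ) else 1) :=
    Finset.sum_nonneg fun u _ => by split_ifs <;> norm_num
  linarith

/-- After `m` rounds, a point of `N` has been reported with at least the probability that `m` rounds
of ideal rejection sampling give it. -/
theorem Rounds.le_hit (R : Rounds w H D M₀ heads N Y c acc pt cost) {i : ℕ} (hi : i ∈ N) (m : ℕ) :
    ∀ C ∈ heads, (1 - (1 - (N.card : ℝ) / Y) ^ m) / N.card ≤
      (hit w H D M₀ (m * c) C i).toReal := by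
  classical
  have hY : (0 : ℝ) < Y := Nat.cast_pos.2 R.pos
  have ha : (0 : ℝ) < N.card := Nat.cast_pos.2 (Finset.card_pos.2 R.nonempty)
  induction m with
  | zero =>
    intro C _
    simp
  | succ m ih =>
    intro C hC
    obtain ⟨C', hsum, hround⟩ := R.round C hC
    have h3 : 3 ≤ c := by
      obtain ⟨t, ht, -⟩ := hround 0 R.pos
      have := R.cost_le 0 R.pos
      omega
    set x : ℝ := (1 - (1 - (N.card : ℝ) / Y) ^ m) / N.card with hx
    rw [show (m + 1) * c = 3 + ((m + 1) * c - 3) by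
      have : (m + 1) * c = m * c + c := Nat.succ_mul m c
      omega, hsum]
    calc (1 - (1 - (N.card : ℝ) / Y) ^ (m + 1)) / N.card
        = (Y : ℝ)⁻¹ * (1 + (Y - N.card) * x) := by
          rw [hx, pow_succ]
          field_simp
          ring
      _ = ∑ u ∈ Finset.range Y, (Y : ℝ)⁻¹ * ((if acc u then if pt u = i then 1 else 0 else 0) +
            (if acc u then 0 else 1) * x) := by
          rw [← Finset.mul_sum, Finset.sum_add_distrib, R.sum_pt hi, ← Finset.sum_mul,
            R.sum_not_acc]
      _ ≤ _ := by
          refine Finset.sum_le_sum fun u hu => ?_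
          refine mul_le_mul_of_nonneg_left ?_ (inv_nonneg.2 hY.le)
          rw [Finset.mem_range] at hu
          obtain ⟨t, ht, C'', hrun, hacc, hrej⟩ := hround u hu
          have hc := R.cost_le u hu
          have hmc : (m + 1) * c = m * c + c := Nat.succ_mul m c
          have hle : t + m * c ≤ (m + 1) * c - 3 := by omega
          have hmono := ENNReal.toReal_mono (hit_ne_top _ _ _)
            (hit_mono (w := w) (H := H) (D := D) (M₀ := M₀) hle (C' u) i)
          rw [hit_add_of_pure hrun] at hmono
          refine le_trans ?_ hmono
          split_ifs with h1 h2
          · rw [hit_of_mem_finals (h2 ▸ hacc h1)]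
            simp
          · simp
          · simpa using ih C'' (hrej h1)

theorem exp_le_one_add_two_mul {y : ℝ} (h0 : 0 ≤ y) (h1 : y ≤ 1) : Real.exp y ≤ 1 + 2 * y := by
  have h := Real.abs_exp_sub_one_le (x := y) (by rwa [abs_of_nonneg h0])
  rw [abs_of_nonneg h0] at h
  linarith [le_abs_self (Real.exp y - 1)]

/-- The running time has an exponential tail: for a rate this small, the growth of
`exp (rate * time)` during the rejected rounds is outweighed by the chance of acceptance. -/
theorem Rounds.one_sub_sum_hit_le (R : Rounds w H D M₀ heads N Y c acc pt cost)
    [DecidablePred acc] {rate : ℝ} (hr : 0 ≤ rate) (hrc : rate * c ≤ 1)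
    (hrW : 2 * rate * ∑ u ∈ Finset.range Y, (if acc u then (0 : ℝ) else cost u) ≤ N.card) (T : ℕ) :
    ∀ C ∈ heads, 1 - ∑ i ∈ N, (hit w H D M₀ T C i).toReal ≤ Real.exp (-(rate * (T - c))) := by
  have hY : (0 : ℝ) < Y := Nat.cast_pos.2 R.pos
  induction T using Nat.strong_induction_on with
  | _ T ih =>
    intro C hC
    -- the bound is trivial before the first round must have ended
    by_cases hTc : T < c
    · have h1 : (0 : ℝ) ≤ ∑ i ∈ N, (hit w H D M₀ T C i).toReal :=
        Finset.sum_nonneg fun _ _ => ENNReal.toReal_nonneg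
      have h2 : 1 ≤ Real.exp (-(rate * (T - c))) := by
        rw [Real.one_le_exp_iff]
        have : (T : ℝ) ≤ c := by exact_mod_cast hTc.le
        nlinarith
      linarith
    push Not at hTc
    obtain ⟨C', hsum, hround⟩ := R.round C hC
    have h3 : 3 ≤ c := by
      obtain ⟨t, ht, -⟩ := hround 0 R.pos
      have := R.cost_le 0 R.pos
      omega
    set E := Real.exp (-(rate * (T - c))) with hE
    have hE0 : 0 ≤ E := (Real.exp_pos _).le
    -- if `u` is rejected, the remaining time is `T - cost u`, and `exp y ≤ 1 + 2 * y` for `y ≤ 1`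
    have key : ∀ u ∈ Finset.range Y, 1 - ∑ i ∈ N, (hit w H D M₀ (T - 3) (C' u) i).toReal ≤
        E * ((if acc u then 0 else 1) + 2 * rate * (if acc u then 0 else (cost u : ℝ))) := by
      intro u hu
      rw [Finset.mem_range] at hu
      obtain ⟨t, ht, C'', hrun, hacc, hrej⟩ := hround u hu
      have hc := R.cost_le u hu
      have hmono : ∀ i, (hit w H D M₀ (T - cost u) C'' i).toReal ≤
          (hit w H D M₀ (T - 3) (C' u) i).toReal := by
        intro i
        rw [← hit_add_of_pure hrun]
        exact ENNReal.toReal_mono (hit_ne_top _ _ _) (hit_mono (by omega) _ _)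
      have hs := Finset.sum_le_sum fun i (_ : i ∈ N) => hmono i
      split_ifs with h1
      · have h2 : (1 : ℝ) ≤ ∑ i ∈ N, (hit w H D M₀ (T - cost u) C'' i).toReal := by
          refine le_trans ?_ (Finset.single_le_sum (fun _ _ => ENNReal.toReal_nonneg)
            (R.mem u hu h1))
          rw [hit_of_mem_finals (hacc h1)]
          simp
        simp only [mul_zero, add_zero]
        linarith
      · have h2 := ih (T - cost u) (by omega) C'' (hrej h1)
        have h4 : Real.exp (-(rate * ((T - cost u : ℕ) - c))) = E * Real.exp (rate * cost u) := by
          rw [hE, ← Real.exp_add, Nat.cast_sub (by omega)]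
          congr 1
          ring
        have h5 : Real.exp (rate * cost u) ≤ 1 + 2 * (rate * cost u) := by
          have : (cost u : ℝ) ≤ c := by exact_mod_cast hc
          exact exp_le_one_add_two_mul (by positivity)
            ((mul_le_mul_of_nonneg_left this hr).trans hrc)
        rw [h4] at h2
        have h6 := mul_le_mul_of_nonneg_left h5 hE0
        linarith
    have h7 : 1 - ∑ i ∈ N, (hit w H D M₀ T C i).toReal =
        ∑ u ∈ Finset.range Y, (Y : ℝ)⁻¹ *
          (1 - ∑ i ∈ N, (hit w H D M₀ (T - 3) (C' u) i).toReal) := by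
      have h8 : ∀ i, (hit w H D M₀ T C i).toReal = ∑ u ∈ Finset.range Y,
          (Y : ℝ)⁻¹ * (hit w H D M₀ (T - 3) (C' u) i).toReal := fun i => by
        rw [← hsum, Nat.add_sub_cancel' (h3.trans hTc)]
      simp only [h8]
      rw [Finset.sum_comm]
      simp only [mul_sub, Finset.sum_sub_distrib, mul_one, Finset.sum_const, Finset.card_range,
        nsmul_eq_mul, mul_inv_cancel₀ hY.ne', Finset.mul_sum]
    rw [h7, ← Finset.mul_sum]
    have h9 := Finset.sum_le_sum key
    rw [← Finset.mul_sum, Finset.sum_add_distrib, R.sum_not_acc, ← Finset.mul_sum] at h9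
    calc (Y : ℝ)⁻¹ * _ ≤ (Y : ℝ)⁻¹ * (E * (Y - N.card + N.card)) := by
          refine mul_le_mul_of_nonneg_left (h9.trans ?_) (inv_nonneg.2 hY.le)
          refine mul_le_mul_of_nonneg_left ?_ hE0
          linarith
      _ = E := by field_simp; ring

/-- The reported point is exactly uniform on `N`. -/
theorem Rounds.iSup_hit (R : Rounds w H D M₀ heads N Y c acc pt cost) {C₀ C : Config} {t₀ : ℕ}
    (h₀ : run w H D t₀ C₀ = PMF.pure C) (hC : C ∈ heads) :
    (∑ i ∈ N, ⨆ T, hit w H D M₀ T C₀ i = 1) ∧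
      ∀ i ∈ N, (⨆ T, hit w H D M₀ T C₀ i).toReal = 1 / N.card := by
  have hY : (0 : ℝ) < Y := Nat.cast_pos.2 R.pos
  have ha : (0 : ℝ) < N.card := Nat.cast_pos.2 (Finset.card_pos.2 R.nonempty)
  set f : ℕ → ℝ≥0∞ := fun i => ⨆ T, hit w H D M₀ T C₀ i with hf
  have hmono : ∀ i, Monotone fun T => hit w H D M₀ T C₀ i := fun i T T' h => hit_mono h _ _
  have hsum : ∑ i ∈ N, f i ≤ 1 := by
    rw [hf, ENNReal.finsetSum_iSup_of_monotone hmono]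
    exact iSup_le fun T => sum_hit_le_one T C₀ N
  have hle1 : ∀ i, f i ≤ 1 := fun i => iSup_le fun T => hit_le_one T C₀ i
  have htop : ∀ i, f i ≠ ⊤ := fun i => ne_top_of_le_ne_top ENNReal.one_ne_top (hle1 i)
  -- each point is reported with probability at least `1 / |N|`, and these probabilities sum to at
  -- most `1`, so there is equality
  have hlow : ∀ i ∈ N, 1 / (N.card : ℝ) ≤ (f i).toReal := by
    intro i hi
    have hθ : Filter.Tendsto (fun m : ℕ => (1 - (1 - (N.card : ℝ) / Y) ^ m) / N.card)
        Filter.atTop (nhds ((1 - 0) / N.card)) := by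
      refine (tendsto_const_nhds.sub (tendsto_pow_atTop_nhds_zero_of_lt_one ?_ ?_)).div_const _
      · rw [sub_nonneg, div_le_one hY]
        exact R.card_le
      · rw [sub_lt_self_iff]
        positivity
    rw [sub_zero] at hθ
    refine le_of_tendsto' hθ fun m => (R.le_hit hi m C hC).trans ?_
    rw [← hit_add_of_pure h₀]
    exact ENNReal.toReal_mono (htop i) (le_iSup (fun T => hit w H D M₀ T C₀ i) _)
  have hsum' : ∑ i ∈ N, (f i).toReal ≤ 1 := by
    rw [← ENNReal.toReal_sum fun i _ => htop i]
    exact ENNReal.toReal_le_of_le_ofReal zero_le_one (by simpa using hsum)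
  have hconst : ∑ _i ∈ N, 1 / (N.card : ℝ) = 1 := by
    rw [Finset.sum_const, nsmul_eq_mul, mul_one_div_cancel ha.ne']
  have heq : ∑ i ∈ N, 1 / (N.card : ℝ) = ∑ i ∈ N, (f i).toReal :=
    le_antisymm (Finset.sum_le_sum hlow) (hsum'.trans hconst.ge)
  refine ⟨?_, fun i hi => (((Finset.sum_eq_sum_iff_of_le hlow).1 heq) i hi).symm⟩
  have h1 : (∑ i ∈ N, f i).toReal = 1 := by
    rw [ENNReal.toReal_sum fun i _ => htop i, ← heq, hconst]
  rwa [ENNReal.toReal_eq_one_iff] at h1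

/-- The time after which a point has been reported with probability at least `1 - δ`. -/
theorem Rounds.le_sum_hit (R : Rounds w H D M₀ heads N Y c acc pt cost) [DecidablePred acc]
    {C₀ C : Config} {t₀ : ℕ} (h₀ : run w H D t₀ C₀ = PMF.pure C) (hC : C ∈ heads) {δ W : ℝ}
    (hδ : 0 < δ) (hW : ∑ u ∈ Finset.range Y, (if acc u then (0 : ℝ) else cost u) ≤ W) {T : ℕ}
    (hT : t₀ + c + (c + 2 * (W / N.card)) * Real.log (1 / δ) ≤ T) (hδ1 : δ ≤ 1) :
    ENNReal.ofReal (1 - δ) ≤ ∑ i ∈ N, hit w H D M₀ T C₀ i := by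
  have ha : (0 : ℝ) < N.card := Nat.cast_pos.2 (Finset.card_pos.2 R.nonempty)
  have hW0 : 0 ≤ W := (Finset.sum_nonneg fun u _ => by split_ifs <;> positivity).trans hW
  have hc : (0 : ℝ) < c := by
    obtain ⟨C', -, h⟩ := R.round C hC
    obtain ⟨t, ht, -⟩ := h 0 R.pos
    have := R.cost_le 0 R.pos
    exact Nat.cast_pos.2 (by omega)
  set L := (c : ℝ) + 2 * (W / N.card) with hL
  have hL0 : 0 < L := by positivity
  have hlog : 0 ≤ Real.log (1 / δ) := Real.log_nonneg (by rwa [le_div_iff₀ hδ, one_mul])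
  have hT0 : t₀ ≤ T := by
    have : (t₀ : ℝ) ≤ T := by nlinarith
    exact_mod_cast this
  obtain ⟨S, rfl⟩ := Nat.exists_eq_add_of_le hT0
  have h := R.one_sub_sum_hit_le (rate := 1 / L) (by positivity)
    (by rw [one_div_mul_eq_div, div_le_one hL0, hL]; have : 0 ≤ W / N.card := by positivity
        linarith)
    (by
      rw [mul_one_div, div_mul_eq_mul_div, div_le_iff₀ hL0, hL, mul_add]
      have h1 : (N.card : ℝ) * (2 * (W / N.card)) = 2 * W := by field_simp
      rw [h1]
      nlinarith) S C hC
  have h2 : Real.exp (-(1 / L * (S - c))) ≤ δ := by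
    rw [← Real.le_log_iff_exp_le hδ, neg_le, ← Real.log_inv, ← one_div, one_div_mul_eq_div,
      le_div_iff₀ hL0]
    push_cast at hT
    linarith
  simp only [hit_add_of_pure h₀]
  rw [← ENNReal.ofReal_toReal (a := ∑ i ∈ N, hit w H D M₀ S C i)
    (ne_top_of_le_ne_top ENNReal.one_ne_top (sum_hit_le_one S C N))]
  refine ENNReal.ofReal_le_ofReal ?_
  rw [ENNReal.toReal_sum fun i _ => hit_ne_top _ _ _]
  linarith

end Sampling

/-! ### Counting the accepted numbers and the work of a round -/

theorem sum_range_mul_div_mod {β : Type*} [AddCommMonoid β] (f : ℕ → ℕ → β) (m s : ℕ) :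
    ∑ u ∈ Finset.range (m * s), f (u / s) (u % s) =
      ∑ z ∈ Finset.range m, ∑ e ∈ Finset.range s, f z e := by
  induction m with
  | zero => simp
  | succ m ih =>
    rw [Nat.succ_mul, Finset.sum_range_add, ih, Finset.sum_range_succ]
    congr 1
    refine Finset.sum_congr rfl fun e he => ?_
    rw [Finset.mem_range] at he
    rw [mul_comm m s, Nat.mul_add_div (by omega), Nat.div_eq_of_lt he, Nat.mul_add_mod,
      Nat.mod_eq_of_lt he, add_zero]

theorem sum_range_getD (l : List ℕ) (f : ℕ → ℕ) :
    ∑ z ∈ Finset.range l.length, f (l.getD z 0) = (l.map f).sum := by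
  induction l using List.reverseRecOn with
  | nil => simp
  | append_singleton l a ih =>
    rw [List.length_append, List.length_singleton, Finset.sum_range_succ, List.map_append,
      List.sum_append, ← ih]
    congr 1
    · refine Finset.sum_congr rfl fun z hz => ?_
      rw [List.getD_append _ _ _ _ (Finset.mem_range.1 hz)]
    · rw [List.getD_append_right _ _ _ _ le_rfl]
      simp

theorem sum_map_range (f : ℕ → ℕ) (m : ℕ) :
    ((List.range m).map f).sum = ∑ y ∈ Finset.range m, f y := by
  induction m with
  | zero => simp
  | succ m ih => simp [List.range_succ, Finset.sum_range_succ, ih]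

section Counting

variable {w : ℕ} {H : ℕ → ℕ → ℕ} {D : ℕ → ℕ} {d : Layout} {tab : ℕ → ℕ → ℕ} {lo hi : ℕ → ℕ}
  {M₀ M : List ℕ} {g : ℕ → ℕ} {s : ℕ}

theorem sum_partSlots (f : ℕ → ℕ) (j t : ℕ) :
    ((partSlots d lo hi s j t).map f).sum =
      ∑ i ∈ Finset.range t, ((tableSlots d.n lo hi s (j * d.T + i)).map f).sum := by
  induction t with
  | zero => simp [partSlots]
  | succ t ih => rw [partSlots_succ, List.map_append, List.sum_append, ih, Finset.sum_range_succ]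

theorem sum_keptSlots (f : ℕ → ℕ) (t : ℕ) :
    ((keptSlots d lo hi s t).map f).sum = ∑ j ∈ Finset.range t,
      if Kept d lo hi s j then ((groupSlots d lo hi s j).map f).sum else 0 := by
  induction t with
  | zero => simp [keptSlots]
  | succ t ih =>
    rw [keptSlots_succ, List.map_append, List.sum_append, ih, Finset.sum_range_succ]
    congr 1
    split_ifs <;> simp

/-- The slots of a table cut its interval into pieces of length `s`, so that the numbers drawn run
once through the positions of that interval, and otherwise only through positions where `F`
vanishes. -/
theorem sum_tableSlots (S : Setup w H d tab lo hi M₀) (hs : 0 < s) (F : ℕ → ℕ → ℕ) (i : ℕ)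
    (hF : ∀ x, F i x ≠ 0 → lo i ≤ x ∧ x < hi i) :
    ((tableSlots d.n lo hi s i).map fun v =>
      ∑ e ∈ Finset.range s, F (v / d.n) (v % d.n + e)).sum = ∑ x ∈ Finset.range d.n, F i x := by
  have hn := S.n_pos
  have hlo := S.lo_le i
  have hhi := S.hi_le i
  set c := (hi i - lo i + (s - 1)) / s with hc
  have hcs : hi i - lo i ≤ c * s := by
    have h := Nat.lt_div_mul_add (a := hi i - lo i + (s - 1)) hs
    rw [← hc] at h
    omega
  rw [tableSlots, List.map_map, sum_map_range]
  have h1 : ∀ y ∈ Finset.range c,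
      ((fun v => ∑ e ∈ Finset.range s, F (v / d.n) (v % d.n + e)) ∘
        fun y => i * d.n + (lo i + s * y)) y =
      ∑ e ∈ Finset.range s, F i (lo i + (s * y + e)) := by
    intro y hy
    rw [Finset.mem_range, hc, Nat.lt_div_iff_mul_lt hs, mul_comm y s] at hy
    have hlt : lo i + s * y < d.n := by omega
    have hdiv : (i * d.n + (lo i + s * y)) / d.n = i := by
      rw [mul_comm, Nat.mul_add_div hn, Nat.div_eq_of_lt hlt, add_zero]
    have hmod : (i * d.n + (lo i + s * y)) % d.n = lo i + s * y := by
      rw [mul_comm, Nat.mul_add_mod, Nat.mod_eq_of_lt hlt]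
    simp only [Function.comp, hdiv, hmod, add_assoc]
  rw [Finset.sum_congr rfl h1, ← sum_range_mul_div_mod (fun y e => F i (lo i + (s * y + e))) c s]
  simp only [Nat.div_add_mod]
  have h2 : ∑ u ∈ Finset.range (c * s), F i (lo i + u) =
      ∑ u ∈ Finset.range (hi i - lo i), F i (lo i + u) := by
    symm
    refine Finset.sum_subset (Finset.range_mono hcs) fun u _ hu => ?_
    by_contra hne
    have := hF _ hne
    rw [Finset.mem_range] at hu
    omega
  rw [h2, ← Finset.sum_Ico_eq_sum_range]
  refine Finset.sum_subset (fun x hx => ?_) fun x _ hx => ?_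
  · rw [Finset.mem_Ico] at hx
    exact Finset.mem_range.2 (by omega)
  · by_contra hne
    exact hx (Finset.mem_Ico.2 (hF x hne))

/-- The draws run once through the colliding positions of all tables of kept groups. -/
theorem sum_draws (S : Setup w H d tab lo hi M₀) (hs : 0 < s) (F : ℕ → ℕ → ℕ)
    (hF : ∀ i < d.tables, ∀ x, F i x ≠ 0 → lo i ≤ x ∧ x < hi i) :
    ∑ u ∈ Finset.range ((keptSlots d lo hi s d.G).length * s),
      F (drawTable d lo hi s u) (drawPos d lo hi s u) =
    ∑ i ∈ Finset.range d.tables,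
      if Kept d lo hi s (i / d.T) then ∑ x ∈ Finset.range d.n, F i x else 0 := by
  simp only [drawTable, drawPos]
  rw [sum_range_mul_div_mod (fun z e => F ((keptSlots d lo hi s d.G).getD z 0 / d.n)
    ((keptSlots d lo hi s d.G).getD z 0 % d.n + e)),
    sum_range_getD _ (fun v => ∑ e ∈ Finset.range s, F (v / d.n) (v % d.n + e)), sum_keptSlots]
  have h := sum_range_mul_div_mod (fun j t => if Kept d lo hi s j then
    ∑ x ∈ Finset.range d.n, F (j * d.T + t) x else 0) d.G d.T
  simp only [mul_comm _ d.T, Nat.div_add_mod] at h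
  rw [Layout.tables, mul_comm d.G, h]
  refine Finset.sum_congr rfl fun j hj => ?_
  rw [Finset.mem_range] at hj
  split_ifs with hK
  · rw [groupSlots, sum_partSlots]
    refine Finset.sum_congr rfl fun t ht => ?_
    rw [Finset.mem_range] at ht
    rw [mul_comm j, sum_tableSlots S hs]
    have := d.group_lt hj ht
    rw [mul_comm j] at this
    exact hF _ this
  · simp

theorem scanLength_le (c : ℕ → Prop) [DecidablePred c] (i : ℕ) : scanLength c i ≤ i := by
  induction i with
  | zero => rfl
  | succ i ih =>
    rw [scanLength]
    split_ifs <;> omega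

/-- The scans from the different elements of `c` do not overlap. -/
theorem sum_scanLength (c : ℕ → Prop) [DecidablePred c] (m : ℕ) :
    (∑ i ∈ Finset.range m, if c i then scanLength c i else 0) + scanLength c m = m := by
  induction m with
  | zero => simp [scanLength]
  | succ m ih =>
    rw [Finset.sum_range_succ, scanLength]
    split_ifs <;> omega

/-- There is exactly one first element. -/
theorem sum_first (c : ℕ → Prop) [DecidablePred c] {m i₀ : ℕ} (hi₀ : i₀ < m) (hc : c i₀) :
    (∑ i ∈ Finset.range m, if c i ∧ ∀ j < i, ¬ c j then 1 else 0) = 1 := by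
  have hex : ∃ i, c i := ⟨i₀, hc⟩
  rw [Finset.sum_eq_single (Nat.find hex)]
  · rw [if_pos ⟨Nat.find_spec hex, fun j hj => Nat.find_min hex hj⟩]
  · intro i _ hne
    refine if_neg fun h => ?_
    rcases lt_or_gt_of_ne hne with hlt | hlt
    · exact Nat.find_min hex hlt h.1
    · exact h.2 _ hlt (Nat.find_spec hex)
  · exact fun h => absurd (Finset.mem_range.2 ((Nat.find_min' hex hc).trans_lt hi₀)) h

theorem Candidate.interval (S : Setup w H d tab lo hi M₀) {i x : ℕ} (hi' : i < d.tables)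
    (h : Candidate H D d tab i x) : lo i ≤ x ∧ x < hi i := by
  have h1 := h.2.2
  rw [S.lexVal_eq i hi' x h.1] at h1
  split_ifs at h1 <;> omega

/-- Each near point that is covered by some kept table is accepted for exactly one number. -/
theorem existsUnique_accepted (S : Setup w H d tab lo hi M₀) (hs : 0 < s)
    (htab : ∀ i < d.tables, ∀ f : ℕ → ℕ,
      ∑ x ∈ Finset.range d.n, f (tab i x) = ∑ p ∈ Finset.range d.n, f p)
    {p : ℕ} (hp : p < d.n) (hD : D p = 0) (hcov : ∃ i < d.tables, Covers H d lo hi s p i) :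
    ∃! u, u < (keptSlots d lo hi s d.G).length * s ∧
      Accepted H D d tab lo hi s (drawTable d lo hi s u) (drawPos d lo hi s u) ∧
      tab (drawTable d lo hi s u) (drawPos d lo hi s u) = p := by
  have h := sum_draws S hs (fun i x =>
    if Accepted H D d tab lo hi s i x ∧ tab i x = p then 1 else 0) (by
      intro i hi' x hne
      have h1 : Accepted H D d tab lo hi s i x ∧ tab i x = p := by
        by_contra hc
        exact hne (if_neg hc)
      exact h1.1.1.interval S hi')
  have h2 : ∀ i ∈ Finset.range d.tables, (if Kept d lo hi s (i / d.T) then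
      ∑ x ∈ Finset.range d.n, (if Accepted H D d tab lo hi s i x ∧ tab i x = p then 1 else 0)
      else 0) = if Covers H d lo hi s p i ∧ ∀ j < i, ¬ Covers H d lo hi s p j then 1 else 0 := by
    intro i hi'
    rw [Finset.mem_range] at hi'
    by_cases hK : Kept d lo hi s (i / d.T)
    swap
    · rw [if_neg hK, if_neg fun h => hK h.1.1]
    rw [if_pos hK]
    have h3 : ∀ x ∈ Finset.range d.n,
        (if Accepted H D d tab lo hi s i x ∧ tab i x = p then 1 else 0) =
        (fun p' => if p' = p then if Covers H d lo hi s p i ∧ ∀ j < i, ¬ Covers H d lo hi s p j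
          then 1 else 0 else 0) (tab i x) := by
      intro x hx
      rw [Finset.mem_range] at hx
      by_cases hxp : tab i x = p
      · simp only [hxp, if_true, and_true, Accepted, Candidate, Covers, hx, hD, hK, true_and]
      · simp only [hxp, if_false, and_false]
    refine (Finset.sum_congr rfl h3).trans ((htab i hi' fun p' => if p' = p then
      if Covers H d lo hi s p i ∧ ∀ j < i, ¬ Covers H d lo hi s p j then 1 else 0 else 0).trans ?_)
    rw [Finset.sum_ite_eq', if_pos (Finset.mem_range.2 hp)]
  obtain ⟨i₀, hi₀, hc₀⟩ := hcov
  rw [Finset.sum_congr rfl h2, sum_first _ hi₀ hc₀, Finset.sum_boole, Nat.cast_id,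
    Finset.card_eq_one] at h
  obtain ⟨u, hu⟩ := h
  have hmem : ∀ u', u' ∈ ({u} : Finset ℕ) ↔ _ := fun u' => by rw [← hu, Finset.mem_filter,
    Finset.mem_range]
  refine ⟨u, (hmem u).1 (Finset.mem_singleton_self u), fun u' h' => ?_⟩
  exact Finset.mem_singleton.1 ((hmem u').2 h')

/-- The near points. -/
def nearSet (D : ℕ → ℕ) (n : ℕ) : Finset ℕ := (Finset.range n).filter fun p => D p = 0

/-- For each near point, the scans begun in the tables that cover it take at most as many steps in
total as there are tables. -/
theorem sum_roundWork_le (S : Setup w H d tab lo hi M₀) (hs : 0 < s)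
    (htab : ∀ i < d.tables, ∀ f : ℕ → ℕ,
      ∑ x ∈ Finset.range d.n, f (tab i x) = ∑ p ∈ Finset.range d.n, f p) :
    ∑ u ∈ Finset.range ((keptSlots d lo hi s d.G).length * s),
      roundWork H D d tab lo hi s (drawTable d lo hi s u) (drawPos d lo hi s u) ≤
    (keptSlots d lo hi s d.G).length * s + (nearSet D d.n).card * d.tables := by
  simp only [roundWork]
  rw [Finset.sum_add_distrib, Finset.sum_const, Finset.card_range, smul_eq_mul, mul_one]
  refine Nat.add_le_add_left ?_ _
  rw [sum_draws S hs (fun i x => if Candidate H D d tab i x then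
    scanLength (Covers H d lo hi s (tab i x)) i else 0) (by
      intro i hi' x hne
      have h1 : Candidate H D d tab i x := by
        by_contra hc
        exact hne (if_neg hc)
      exact h1.interval S hi')]
  have h2 : ∀ i ∈ Finset.range d.tables, (if Kept d lo hi s (i / d.T) then
      ∑ x ∈ Finset.range d.n, (if Candidate H D d tab i x then
        scanLength (Covers H d lo hi s (tab i x)) i else 0) else 0) =
      ∑ p ∈ nearSet D d.n, if Covers H d lo hi s p i then
        scanLength (Covers H d lo hi s p) i else 0 := by
    intro i hi'
    rw [Finset.mem_range] at hi'
    by_cases hK : Kept d lo hi s (i / d.T)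
    swap
    · rw [if_neg hK, Finset.sum_eq_zero fun p _ => if_neg fun h => hK h.1]
    rw [if_pos hK, nearSet, Finset.sum_filter, ← htab i hi' (fun p => if D p = 0 then
      if Covers H d lo hi s p i then scanLength (Covers H d lo hi s p) i else 0 else 0)]
    refine Finset.sum_congr rfl fun x hx => ?_
    rw [Finset.mem_range] at hx
    by_cases hD : D (tab i x) = 0 <;> simp [Candidate, Covers, hx, hK, hD]
  rw [Finset.sum_congr rfl h2, Finset.sum_comm, ← smul_eq_mul, ← Finset.sum_const]
  refine Finset.sum_le_sum fun p _ => ?_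
  have := sum_scanLength (Covers H d lo hi s p) d.tables
  omega

theorem roundWork_le (S : Setup w H d tab lo hi M₀) (hs : 0 < s) {u : ℕ}
    (hu : u < (keptSlots d lo hi s d.G).length * s) :
    roundWork H D d tab lo hi s (drawTable d lo hi s u) (drawPos d lo hi s u) ≤ d.tables + 1 := by
  have hz : u / s < (keptSlots d lo hi s d.G).length := by rwa [Nat.div_lt_iff_lt_mul hs]
  obtain ⟨i, hi', x₀, hx₀, hv⟩ := mem_keptSlots S hs
    (v := (keptSlots d lo hi s d.G).getD (u / s) 0) (by
      rw [List.getD_eq_getElem _ _ hz]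
      exact List.getElem_mem _)
  have hT : drawTable d lo hi s u = i := by
    rw [drawTable, hv, mul_comm, Nat.mul_add_div S.n_pos, Nat.div_eq_of_lt hx₀, add_zero]
  rw [hT, roundWork]
  have := scanLength_le (Covers H d lo hi s (tab i (drawPos d lo hi s u))) i
  split_ifs <;> omega

end Counting

/-! ### The query program -/

section Query

variable {w : ℕ} {H : ℕ → ℕ → ℕ} {D : ℕ → ℕ} {d : Layout} {tab : ℕ → ℕ → ℕ} {lo hi : ℕ → ℕ}
  {M₀ M : List ℕ} {g : ℕ → ℕ} {s : ℕ}

/-- Load the header of the memory and the constants into the registers. -/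
def initProg : Stmt :=
  block [.const 2 0, .load 2 2, .const 3 1, .load 3 3, .const 4 2, .load 4 4, .const 5 3,
    .load 5 5, .const 6 4, .load 6 6, .const 7 5, .load 7 7, .const 8 6, .load 8 8, .const 9 7,
    .load 9 9, .const 10 8, .const 11 1, .const 12 2, .const 13 0]

theorem initProg_spec (S : Setup w H d tab lo hi M₀) :
    Exec w H D initProg g M₀ 40 (fun g' M' => M' = M₀ ∧ Env d g') := by
  have hw := S.word_mem
  have h : ∀ v, v < 100 → v % 2 ^ w = v := fun v hv => Nat.mod_eq_of_lt (by omega)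
  obtain ⟨Q, hQ⟩ : ∃ Q : (ℕ → ℕ) → List ℕ → Prop, ∀ g' M', Q g' M' ↔ M' = M₀ ∧ Env d g' :=
    ⟨_, fun _ _ => Iff.rfl⟩
  refine Exec.mono (Q := Q) ?_ le_rfl fun g' M' h => (hQ _ _).1 h
  simp only [Exec, initProg, block, wp, Function.update_self, h 1 (by norm_num),
    h 2 (by norm_num), h 3 (by norm_num), h 4 (by norm_num), h 5 (by norm_num), h 6 (by norm_num),
    h 7 (by norm_num), h 8 (by norm_num), Nat.zero_mod, S.head_n, S.head_k, S.head_T, S.head_G,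
    S.head_cap, S.head_flags, S.head_slots, S.head_size]
  exact ⟨by norm_num, (hQ _ _).2 ⟨rfl, by constructor <;> simp⟩⟩

/-- Set the working memory to `0`. -/
def cleanProg : Stmt :=
  block [.arith .add 20 7 13, .arith .lt 21 20 9,
    .loop 21 (block [.store 20 13, .arith .add 20 20 11, .arith .lt 21 20 9])]

/-- Clearing the working memory restores the whole memory, as it contained zeros at the beginning. -/
theorem cleanProg_spec (S : Setup w H d tab lo hi M₀) (hE : Env d g) (hM : SameData d M₀ M) :
    Exec w H D cleanProg g M (6 * (d.size - d.flags) + 5)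
      (fun g' M' => M' = M₀ ∧ g' 0 = g 0) := by
  have hw := S.word_mem
  have hfl : d.flags ≤ d.size := by simp only [Layout.size, Layout.slots]; omega
  have e1 : (d.flags + 0) % 2 ^ w = d.flags := Nat.mod_eq_of_lt (by omega)
  simp only [Exec, cleanProg, block, wp, BinOp.eval, hE.r7, hE.r13, e1]
  refine Exec.loopWp (P := fun g' M' => M' = M₀ ∧ g' 0 = g 0)
    (B := 6 * (d.size - d.flags) + 1) ?_ ?_
  · obtain ⟨I, hI⟩ : ∃ I : ℕ → (ℕ → ℕ) → List ℕ → Prop, ∀ B g' M', I B g' M' ↔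
        (∀ r < 20, g' r = g r) ∧ ∃ a ≤ d.size, B = 6 * (d.size - a) + 1 ∧ g' 20 = a ∧
          (g' 21 = if a < d.size then 1 else 0) ∧ M'.length = M₀.length ∧ d.flags ≤ a ∧
          ∀ b < a, M'.getD b 0 = M₀.getD b 0 := ⟨_, fun _ _ _ => Iff.rfl⟩
    refine Exec.loop I ?_ ?_ ((hI _ _ _).2 ?_)
    · intro B g' M' h h0
      obtain ⟨hr, a, ha, rfl, h20, h21, hlen, -, hget⟩ := (hI _ _ _).1 h
      have : a = d.size := by
        by_contra hne
        rw [h21, if_pos (by omega)] at h0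
        omega
      subst this
      refine ⟨by omega, ?_, hr 0 (by omega)⟩
      refine List.ext_getElem hlen fun b h1 h2 => ?_
      have := hget b (by rw [← S.length_eq]; exact h2)
      rwa [List.getD_eq_getElem _ _ h1, List.getD_eq_getElem _ _ h2] at this
    · intro B g' M' h h0
      obtain ⟨hr, a, ha, rfl, h20, h21, hlen, hfa, hget⟩ := (hI _ _ _).1 h
      have ha' : a < d.size := by
        by_contra hne
        rw [h21, if_neg hne] at h0
        omega
      have hE' : Env d g' := hE.congr fun r _ h => hr r (by omega)
      have e2 : (a + 1) % 2 ^ w = a + 1 := Nat.mod_eq_of_lt (by omega)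
      refine ⟨5, 6 * (d.size - (a + 1)) + 1, by omega, ?_⟩
      simp only [Exec, wp, BinOp.eval, h20, hE'.r13, hE'.r11]
      simp [hE'.r9, e2]
      refine (hI _ _ _).2 ⟨?_, a + 1, by omega, rfl, by simp, by simp, by simpa using hlen,
        by omega, ?_⟩
      · intro r h1
        simp (disch := omega) only [Function.update_of_ne]
        exact hr r h1
      · intro b hb
        rcases eq_or_ne b a with rfl | hne
        · rw [List.getD_set_self (by rw [hlen, S.length_eq]; exact ha'), S.zero b hfa]
        · rw [List.getD_set_of_ne hne, hget b (by omega)]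
    · refine ⟨?_, d.flags, hfl, rfl, by simp, by simp [hE.r9], hM.1, le_rfl, hM.2⟩
      intro r h1
      simp (disch := omega) only [Function.update_of_ne]
  · rintro g' M' h u hu
    exact ⟨by omega, h⟩

/-- The part of the query before the rounds. Register `16 :=` the range of the random numbers. -/
def prepareProg : Stmt := block [initProg, searchProg, .arith .mul 16 15 14, .const 1 1]

/-- The body of the rounds. -/
def roundProg : Stmt := .seq (.rand 20 16) testProg

/-- The query: prepare the slots, repeat rounds until a point is accepted, restore the memory. -/
def queryProg : Stmt := .seq prepareProg (.seq (.loop 1 roundProg) cleanProg)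

theorem prepareProg_spec (S : Setup w H d tab lo hi M₀) {s₀ : ℕ} (hs₀ : 0 < s₀) (hs₀n : s₀ ≤ d.n)
    (hgood : ∀ s, s₀ ≤ s → d.G < 2 * keptCount d lo hi s d.G) :
    Exec w H D prepareProg g M₀ (600 * ((d.k + 1) * d.n.size ^ 2) * (d.G * d.cap) + 45)
      (fun g' M' => ∃ s, 0 < s ∧ s < 2 * s₀ ∧ d.G < 2 * keptCount d lo hi s d.G ∧
        Filled d lo hi s M₀ M' ∧ Env d g' ∧ g' 14 = s ∧
        g' 16 = (keptSlots d lo hi s d.G).length * s ∧ g' 1 = 1) := by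
  have hw := S.word_mem
  have e0 : 1 % 2 ^ w = 1 := Nat.mod_eq_of_lt (by omega)
  obtain ⟨Q, hQ⟩ : ∃ Q : (ℕ → ℕ) → List ℕ → Prop, ∀ g' M', Q g' M' ↔
      ∃ s, 0 < s ∧ s < 2 * s₀ ∧ d.G < 2 * keptCount d lo hi s d.G ∧
        Filled d lo hi s M₀ M' ∧ Env d g' ∧ g' 14 = s ∧
        g' 16 = (keptSlots d lo hi s d.G).length * s ∧ g' 1 = 1 := ⟨_, fun _ _ => Iff.rfl⟩
  refine Exec.mono (Q := Q) ?_ le_rfl fun g' M' h => (hQ _ _).1 h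
  simp only [Exec, prepareProg, block, wp, BinOp.eval]
  refine (initProg_spec S).wp ?_
  rintro g' M' ⟨rfl, hE⟩ t ht
  refine (searchProg_spec S hE ⟨rfl, fun _ _ => rfl⟩ hs₀ hs₀n hgood).wp ?_
  rintro g'' N ⟨hD, s, h1, h2, h14, hkept, h15, hH, hF, hr⟩ t' ht'
  have hE' : Env d g'' := hE.congr fun r h3 h4 => hr r h4 (by omega)
  have hlen := length_keptSlots_le (d := d) (lo := lo) (hi := hi) s d.G
  have e1 : (keptSlots d lo hi s d.G).length * s % 2 ^ w =
      (keptSlots d lo hi s d.G).length * s :=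
    Nat.mod_eq_of_lt ((Nat.mul_le_mul hlen (by omega)).trans_lt S.word_rand)
  refine ⟨by omega, (hQ _ _).2 ⟨s, h1, h2, hkept, ⟨hD, hH, hF⟩, ?_, by simp [h14],
    by simp [h14, h15, e1], by simp [e0]⟩⟩
  refine hE'.congr fun r h3 h4 => ?_
  simp (disch := omega) only [Function.update_of_ne]

/-- The configurations at the head of the loop of the rounds. -/
def loopHeads (d : Layout) (s Y : ℕ) (M : List ℕ) : Set Config :=
  {C | C.code = [.loop 1 roundProg, cleanProg] ∧ C.mem = M ∧ Env d C.reg ∧ C.reg 14 = s ∧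
    C.reg 16 = Y ∧ C.reg 1 = 1}

/-- A bound for the number of steps of the round with the number `u`. -/
def roundCost (H : ℕ → ℕ → ℕ) (D : ℕ → ℕ) (d : Layout) (tab : ℕ → ℕ → ℕ) (lo hi : ℕ → ℕ)
    (s u : ℕ) : ℕ :=
  90 * (d.k + 1) * roundWork H D d tab lo hi s (drawTable d lo hi s u) (drawPos d lo hi s u) + 3 +
    if Accepted H D d tab lo hi s (drawTable d lo hi s u) (drawPos d lo hi s u) then
      6 * (d.size - d.flags) + 6 else 0

/-- The rounds of the query are rounds of rejection sampling in the sense of `Rounds`. Clearing the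
working memory is charged to the accepted round. -/
theorem rounds_loopHeads (S : Setup w H d tab lo hi M₀) (hF : Filled d lo hi s M₀ M)
    (htab : ∀ i < d.tables, ∀ f : ℕ → ℕ,
      ∑ x ∈ Finset.range d.n, f (tab i x) = ∑ p ∈ Finset.range d.n, f p)
    (hD : ∀ p, D p = 0 → p < d.n)
    (hs : 0 < s) (hsn : s < 2 * d.n)
    (hcov : ∀ p ∈ nearSet D d.n, ∃ i < d.tables, Covers H d lo hi s p i)
    (hne : (nearSet D d.n).Nonempty) :
    Rounds w H D M₀ (loopHeads d s ((keptSlots d lo hi s d.G).length * s) M) (nearSet D d.n)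
      ((keptSlots d lo hi s d.G).length * s)
      (90 * (d.k + 1) * (d.tables + 1) + 3 + (6 * (d.size - d.flags) + 6))
      (fun u => Accepted H D d tab lo hi s (drawTable d lo hi s u) (drawPos d lo hi s u))
      (fun u => tab (drawTable d lo hi s u) (drawPos d lo hi s u))
      (roundCost H D d tab lo hi s) where
  nonempty := hne
  cost_le u hu := by
    have h := Nat.mul_le_mul_left (90 * (d.k + 1)) (roundWork_le (H := H) (D := D) S hs hu)
    rw [roundCost]
    split_ifs <;> omega
  mem u hu ha := Finset.mem_filter.2 ⟨Finset.mem_range.2 (hD _ ha.1.2.1), ha.1.2.1⟩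
  existsUnique p hp := by
    have h := Finset.mem_filter.1 hp
    exact existsUnique_accepted S hs htab (Finset.mem_range.1 h.1) h.2 (hcov p hp)
  round := by
    rintro ⟨code, reg, mem⟩ ⟨h1, h2, hE, h14, h16, hr1⟩
    simp only at h1 h2 hE h14 h16 hr1
    subst h1 h2
    set Y := (keptSlots d lo hi s d.G).length * s with hY
    have hw := S.word_mem
    have hYpos : 0 < reg 16 := by
      rw [h16]
      obtain ⟨p, hp⟩ := hne
      have h := Finset.mem_filter.1 hp
      obtain ⟨u, ⟨hu, -⟩, -⟩ :=
        existsUnique_accepted S hs htab (Finset.mem_range.1 h.1) h.2 (hcov p hp)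
      omega
    have hstep1 : run w H D 1 ⟨[.loop 1 roundProg, cleanProg], reg, mem⟩ =
        PMF.pure ⟨[roundProg, .loop 1 roundProg, cleanProg], reg, mem⟩ := by
      rw [run_one, step]
      simp [hr1]
    have hstep2 : run w H D 1 ⟨[roundProg, .loop 1 roundProg, cleanProg], reg, mem⟩ =
        PMF.pure ⟨[.rand 20 16, testProg, .loop 1 roundProg, cleanProg], reg, mem⟩ := by
      rw [run_one]
      rfl
    refine ⟨fun u => ⟨[testProg, .loop 1 roundProg, cleanProg], Function.update reg 20 u, mem⟩,
      fun T i => ?_, fun u hu => ?_⟩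
    · rw [show 3 + T = 1 + (1 + (1 + T)) by omega, hit_add_of_pure hstep1, hit_add_of_pure hstep2,
        hit_rand _ _ _ _ _ _ hYpos, h16]
    · have hE' : Env d (Function.update reg 20 u) := hE.congr fun r h3 h4 => by
        simp (disch := omega) only [Function.update_of_ne]
      have hn := S.n_pos
      have hsz : d.n ≤ d.size + 4 * d.n + 100 := by omega
      obtain ⟨t, ht, g', M', hexec, rfl, hr, hif⟩ := (testProg_spec S hE' hF
        (fun i x h => (hD _ h).trans_le (hsz.trans hw.le)) (by simp [h14]) hs hsn (u := u) (by simp)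
        hu (by simp [hr1])).sound
      have hg' : ∀ r, 2 ≤ r → r < 20 → g' r = reg r := fun r h3 h4 => by
        rw [hr r h3 h4]
        simp (disch := omega) only [Function.update_of_ne]
      have hE'' : Env d g' := hE.congr fun r h3 h4 => hg' r h3 (by omega)
      by_cases ha : Accepted H D d tab lo hi s (drawTable d lo hi s u) (drawPos d lo hi s u)
      · rw [if_pos ha] at hif
        obtain ⟨t', ht', g'', M'', hexec', rfl, h0⟩ := (cleanProg_spec S hE'' hF.same).sound
        refine ⟨t + (1 + t'), ?_, ⟨[], g'', M''⟩, ?_, fun _ => ⟨rfl, ?_, rfl⟩, fun h => absurd ha h⟩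
        · rw [roundCost, if_pos ha]
          omega
        · rw [run_add_of_pure (hexec _), run_add_of_pure (ExecIn.loop_exit hif.1 _), hexec']
        · rw [← hif.2, ← h0]
      · rw [if_neg ha] at hif
        refine ⟨t, ?_, ⟨[.loop 1 roundProg, cleanProg], g', M'⟩, hexec _, fun h => absurd h ha,
          fun _ => ⟨rfl, rfl, hE'', ?_, ?_, hif⟩⟩
        · rw [roundCost, if_neg ha]
          omega
        · rw [← h14]
          exact hg' 14 (by omega) (by omega)
        · rw [← h16]
          exact hg' 16 (by omega) (by omega)

/-- The query reports a uniformly random near point. Here `s₀` is a slot length with which more than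
half of the groups are kept. -/
theorem queryProg_spec (S : Setup w H d tab lo hi M₀)
    (htab : ∀ i < d.tables, ∀ f : ℕ → ℕ,
      ∑ x ∈ Finset.range d.n, f (tab i x) = ∑ p ∈ Finset.range d.n, f p)
    (hD : ∀ p, D p = 0 → p < d.n) {s₀ : ℕ} (hs₀ : 0 < s₀) (hs₀n : s₀ ≤ d.n)
    (hgood : ∀ s, s₀ ≤ s → d.G < 2 * keptCount d lo hi s d.G)
    (hcov : ∀ p ∈ nearSet D d.n, d.G < 2 * ((Finset.range d.G).filter fun j =>
      ∃ t < d.T, lexVal H d.k (j * d.T + t) p = 1).card)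
    (hne : (nearSet D d.n).Nonempty) (hcard : (nearSet D d.n).card ≤ s₀) (C₀ : Config)
    (hC₀ : C₀.code = [queryProg]) (hC₀M : C₀.mem = M₀) :
    (∑ i ∈ nearSet D d.n, ⨆ T, hit w H D M₀ T C₀ i = 1) ∧
    (∀ i ∈ nearSet D d.n,
      (⨆ T, hit w H D M₀ T C₀ i).toReal = 1 / (nearSet D d.n).card) ∧
    ∀ δ : ℝ, 0 < δ → δ ≤ 1 → ∀ T : ℕ,
      ((d.k + 1 : ℕ) : ℝ) * (d.G * d.cap : ℕ) * ((s₀ : ℝ) / (nearSet D d.n).card) *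
        (1000 * (d.n.size : ℝ) ^ 2 + 1000 * Real.log (1 / δ)) ≤ T →
      ENNReal.ofReal (1 - δ) ≤ ∑ i ∈ nearSet D d.n, hit w H D M₀ T C₀ i := by
  obtain ⟨code, reg, mem⟩ := C₀
  simp only at hC₀ hC₀M
  subst hC₀ hC₀M
  obtain ⟨t, ht, g, M, hexec, s, hs, hs2, hkept, hF, hE, h14, h16, h1⟩ :=
    (prepareProg_spec (D := D) (g := reg) S hs₀ hs₀n hgood).sound
  set Y := (keptSlots d lo hi s d.G).length * s with hY
  set N := nearSet D d.n with hN
  have hrun : run w H D (1 + (t + 1)) ⟨[queryProg], reg, mem⟩ =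
      PMF.pure ⟨[.loop 1 roundProg, cleanProg], g, M⟩ := by
    have h2 : run w H D 1 ⟨[queryProg], reg, mem⟩ =
        PMF.pure ⟨[prepareProg, .seq (.loop 1 roundProg) cleanProg], reg, mem⟩ := by
      rw [run_one]
      rfl
    rw [run_add_of_pure h2, run_add_of_pure (hexec _), run_one]
    rfl
  have hcov' : ∀ p ∈ N, ∃ i < d.tables, Covers H d lo hi s p i := by
    intro p hp
    -- two majorities of groups intersect
    have h2 := hcov p hp
    have h3 : ¬ Disjoint ((Finset.range d.G).filter fun j => Kept d lo hi s j)
        ((Finset.range d.G).filter fun j => ∃ t < d.T, lexVal H d.k (j * d.T + t) p = 1) := by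
      intro hdis
      have h4 := Finset.card_union_of_disjoint hdis
      have h5 := Finset.card_le_card (Finset.union_subset
        (Finset.filter_subset (fun j => Kept d lo hi s j) (Finset.range d.G))
        (Finset.filter_subset (fun j => ∃ t < d.T, lexVal H d.k (j * d.T + t) p = 1)
          (Finset.range d.G)))
      rw [Finset.card_range] at h5
      rw [keptCount] at hkept
      omega
    obtain ⟨j, hj1, hj2⟩ := Finset.not_disjoint_iff.1 h3
    obtain ⟨hj, hK⟩ := Finset.mem_filter.1 hj1
    obtain ⟨-, t, htT, hl⟩ := Finset.mem_filter.1 hj2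
    rw [Finset.mem_range] at hj
    refine ⟨j * d.T + t, d.group_lt hj htT, ?_, hl⟩
    rwa [mul_comm, Nat.mul_add_div S.T_pos, Nat.div_eq_of_lt htT, add_zero]
  have R := rounds_loopHeads S hF htab hD hs (by omega) hcov' hne
  have hhead : (⟨[.loop 1 roundProg, cleanProg], g, M⟩ : Config) ∈ loopHeads d s Y M :=
    ⟨rfl, rfl, hE, h14, h16, h1⟩
  obtain ⟨hu1, hu2⟩ := R.iSup_hit hrun hhead
  refine ⟨hu1, hu2, fun δ hδ hδ1 T hT => ?_⟩
  obtain ⟨V, hV⟩ : ∃ V, V = d.G * d.cap := ⟨_, rfl⟩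
  have hcap := S.T_lt
  have hG := S.G_pos
  have hV1 : 1 ≤ V := by rw [hV]; exact Nat.mul_pos hG (by omega)
  have htabV : d.tables ≤ V := by rw [hV]; exact Nat.mul_le_mul_left _ hcap.le
  have hGV : d.G ≤ V := by rw [hV]; exact Nat.le_mul_of_pos_right _ (by omega)
  have hYV : Y ≤ V * (2 * s₀) := by
    rw [hV]
    exact Nat.mul_le_mul (length_keptSlots_le s d.G) hs2.le
  have hsf : d.size - d.flags = d.G + V := by
    rw [hV, Layout.size, Layout.slots]
    omega
  have hkV : 1 ≤ (d.k + 1) * V := Nat.mul_pos (by omega) hV1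
  -- the work of the rejected rounds
  have hW : ∑ u ∈ Finset.range Y,
      (if Accepted H D d tab lo hi s (drawTable d lo hi s u) (drawPos d lo hi s u) then (0 : ℝ)
        else roundCost H D d tab lo hi s u) ≤ ((d.k + 1) * (186 * (V * s₀) + 90 * (N.card * V)) : ℕ) := by
    have h2 : ∀ u ∈ Finset.range Y,
        (if Accepted H D d tab lo hi s (drawTable d lo hi s u) (drawPos d lo hi s u) then (0 : ℝ)
        else roundCost H D d tab lo hi s u) ≤ ((90 * (d.k + 1) * roundWork H D d tab lo hi s
          (drawTable d lo hi s u) (drawPos d lo hi s u) + 3 : ℕ) : ℝ) := by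
      intro u _
      split_ifs with ha
      · positivity
      · rw [roundCost, if_neg ha, add_zero]
    refine (Finset.sum_le_sum h2).trans ?_
    rw [← Nat.cast_sum, Nat.cast_le, Finset.sum_add_distrib, ← Finset.mul_sum, Finset.sum_const,
      Finset.card_range, smul_eq_mul]
    have h3 := Nat.mul_le_mul_left (90 * (d.k + 1)) (sum_roundWork_le (H := H) (D := D) S hs htab)
    have h4 : N.card * d.tables ≤ N.card * V := Nat.mul_le_mul_left _ htabV
    calc _ ≤ 90 * (d.k + 1) * (Y + N.card * d.tables) + Y * 3 := Nat.add_le_add_right h3 _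
      _ ≤ 90 * (d.k + 1) * (V * (2 * s₀) + N.card * V) + (d.k + 1) * (V * (2 * s₀)) * 3 := by
          have h5 : Y ≤ (d.k + 1) * (V * (2 * s₀)) :=
            hYV.trans (Nat.le_mul_of_pos_left _ (by omega))
          gcongr
      _ = _ := by ring
  refine R.le_sum_hit hrun hhead hδ hW (le_trans ?_ hT) hδ1
  have ha : (0 : ℝ) < N.card := Nat.cast_pos.2 (Finset.card_pos.2 hne)
  have hq : 1 ≤ (s₀ : ℝ) / N.card := by
    rw [le_div_iff₀ ha, one_mul]
    exact_mod_cast hcard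
  have hlog : 0 ≤ Real.log (1 / δ) := Real.log_nonneg (by rwa [le_div_iff₀ hδ, one_mul])
  have hsize : 1 ≤ d.n.size := Nat.size_pos.mpr S.n_pos
  obtain ⟨K, hK⟩ : ∃ K, K = (d.k + 1) * V := ⟨_, rfl⟩
  rw [← hV, ← Nat.cast_mul, ← hK]
  rw [← hK] at hkV
  have hKr : (1 : ℝ) ≤ K := by exact_mod_cast hkV
  have hsr : (1 : ℝ) ≤ (d.n.size : ℝ) ^ 2 := by
    have : (1 : ℝ) ≤ d.n.size := by exact_mod_cast hsize
    nlinarith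
  have c1 : ((1 + (t + 1) : ℕ) : ℝ) ≤ 647 * (K * (d.n.size : ℝ) ^ 2) := by
    have h2 : 1 + (t + 1) ≤ 600 * (K * d.n.size ^ 2) + 47 := by
      have : 600 * ((d.k + 1) * d.n.size ^ 2) * (d.G * d.cap) = 600 * (K * d.n.size ^ 2) := by
        rw [hK, hV]; ring
      omega
    have h3 : ((1 + (t + 1) : ℕ) : ℝ) ≤ ((600 * (K * d.n.size ^ 2) + 47 : ℕ) : ℝ) := by
      exact_mod_cast h2
    push_cast at h3 ⊢
    nlinarith
  have c2 : ((90 * (d.k + 1) * (d.tables + 1) + 3 + (6 * (d.size - d.flags) + 6) : ℕ) : ℝ) ≤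
      201 * K := by
    rw [hsf]
    have h2 : 90 * (d.k + 1) * (d.tables + 1) ≤ 180 * K := by
      rw [hK]
      calc 90 * (d.k + 1) * (d.tables + 1) ≤ 90 * (d.k + 1) * (V + V) := by gcongr
        _ = _ := by ring
    have h3 : V ≤ K := by rw [hK]; exact Nat.le_mul_of_pos_left _ (by omega)
    have : 90 * (d.k + 1) * (d.tables + 1) + 3 + (6 * (d.G + V) + 6) ≤ 201 * K := by omega
    exact_mod_cast this
  have c3 : (((d.k + 1) * (186 * (V * s₀) + 90 * (N.card * V)) : ℕ) : ℝ) / N.card =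
      K * (186 * (s₀ / N.card) + 90) := by
    rw [hK]
    push_cast
    field_simp
  set c : ℝ := ((90 * (d.k + 1) * (d.tables + 1) + 3 + (6 * (d.size - d.flags) + 6) : ℕ) : ℝ)
  rw [c3]
  set q := (s₀ : ℝ) / N.card with hqdef
  have hKq : (K : ℝ) ≤ K * q := le_mul_of_one_le_right (by positivity) hq
  calc ((1 + (t + 1) : ℕ) : ℝ) + c + (c + 2 * (K * (186 * q + 90))) * Real.log (1 / δ)
      ≤ 647 * (K * (d.n.size : ℝ) ^ 2) + 201 * K +
        (201 * K + 2 * (K * (186 * q + 90))) * Real.log (1 / δ) := by gcongr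
    _ ≤ 647 * (K * q * (d.n.size : ℝ) ^ 2) + 201 * (K * q * (d.n.size : ℝ) ^ 2) +
        (753 * (K * q)) * Real.log (1 / δ) := by
      have h5 : K * (d.n.size : ℝ) ^ 2 ≤ K * q * (d.n.size : ℝ) ^ 2 := by gcongr
      have h6 : (K : ℝ) ≤ K * q * (d.n.size : ℝ) ^ 2 :=
        hKq.trans (le_mul_of_one_le_right (by positivity) hsr)
      have h7 : 201 * K + 2 * (K * (186 * q + 90)) ≤ 753 * (K * q) := by nlinarith
      gcongr
    _ ≤ K * q * (1000 * (d.n.size : ℝ) ^ 2 + 1000 * Real.log (1 / δ)) := by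
      have h8 : 0 ≤ K * q * (d.n.size : ℝ) ^ 2 := by positivity
      have h9 : 0 ≤ K * q * Real.log (1 / δ) := by positivity
      nlinarith

end Query

/-! ### The random choice of the hash functions -/

section Probability

/-- The hash functions are numbered group by group, table by table. -/
def hashIndex (G T k : ℕ) : (Fin G × Fin T) × Fin k ≃ Fin (G * T * k) :=
  (finProdFinEquiv.prodCongr (Equiv.refl _)).trans finProdFinEquiv

theorem hashIndex_val {G T k : ℕ} (j : Fin G) (t : Fin T) (l : Fin k) :
    (hashIndex G T k ((j, t), l) : ℕ) = (j * T + t) * k + l := by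
  simp only [hashIndex, Equiv.trans_apply, Equiv.prodCongr_apply, Prod.map, Equiv.refl_apply,
    finProdFinEquiv_apply_val]
  ring

variable {Ω : Type*} [MeasurableSpace Ω]

/-- Families of samples, arranged by groups and tables, as families indexed by all hash functions. -/
def flatten (Ω : Type*) [MeasurableSpace Ω] (G T k : ℕ) :
    (Fin G → Fin T → Fin k → Ω) ≃ᵐ (Fin (G * T * k) → Ω) where
  toFun ω i := ω ((hashIndex G T k).symm i).1.1 ((hashIndex G T k).symm i).1.2
    ((hashIndex G T k).symm i).2
  invFun ω j t l := ω (hashIndex G T k ((j, t), l))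
  left_inv ω := by simp
  right_inv ω := by simp
  measurable_toFun := by
    refine measurable_pi_lambda _ fun i => ?_
    change Measurable fun ω : Fin G → Fin T → Fin k → Ω => ω ((hashIndex G T k).symm i).1.1
      ((hashIndex G T k).symm i).1.2 ((hashIndex G T k).symm i).2
    fun_prop
  measurable_invFun := by
    refine measurable_pi_lambda _ fun j => measurable_pi_lambda _ fun t =>
      measurable_pi_lambda _ fun l => measurable_pi_apply _

/-- Drawing all hash functions independently amounts to drawing them group by group and table by
table. -/
theorem pi_eq_map_flatten (ν : Measure Ω) [IsProbabilityMeasure ν] (G T k : ℕ) :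
    Measure.pi (fun _ : Fin (G * T * k) => ν) =
      (Measure.pi fun _ : Fin G => Measure.pi fun _ : Fin T => Measure.pi fun _ : Fin k => ν).map
        (flatten Ω G T k) := by
  refine Measure.pi_eq fun s _ => ?_
  have h : (flatten Ω G T k) ⁻¹' (Set.univ.pi s) = Set.univ.pi fun j => Set.univ.pi fun t =>
      Set.univ.pi fun l => s (hashIndex G T k ((j, t), l)) := by
    ext ω
    simp only [Set.mem_preimage, Set.mem_univ_pi]
    constructor
    · intro h j t l
      simpa [flatten] using h (hashIndex G T k ((j, t), l))
    · intro h i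
      have := h ((hashIndex G T k).symm i).1.1 ((hashIndex G T k).symm i).1.2
        ((hashIndex G T k).symm i).2
      simpa [flatten] using this
  rw [MeasurableEquiv.map_apply, h, Measure.pi_pi]
  simp only [Measure.pi_pi]
  rw [← (hashIndex G T k).prod_comp, Fintype.prod_prod_type, Fintype.prod_prod_type]

theorem pi_le_of_flatten (ν : Measure Ω) [IsProbabilityMeasure ν] (G T k : ℕ)
    {A : Set (Fin (G * T * k) → Ω)} {B : Set (Fin G → Fin T → Fin k → Ω)}
    (h : ∀ ω, flatten Ω G T k ω ∈ A → ω ∈ B) :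
    Measure.pi (fun _ : Fin (G * T * k) => ν) A ≤
      (Measure.pi fun _ : Fin G => Measure.pi fun _ : Fin T => Measure.pi fun _ : Fin k => ν) B := by
  rw [pi_eq_map_flatten, MeasurableEquiv.map_apply]
  exact measure_mono h

/-- If independent events have probability at most `1 / 16`, then it is exponentially unlikely that
at least half of them occur. -/
theorem pi_majority_le (μ : Measure Ω) [IsProbabilityMeasure μ] {A : Set Ω}
    (hA : μ A ≤ (4⁻¹ : ℝ≥0∞) ^ 2) (G : ℕ) [DecidablePred (· ∈ A)] :
    Measure.pi (fun _ : Fin G => μ)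
      {ω | G ≤ 2 * (Finset.univ.filter fun j => ω j ∈ A).card} ≤ (2⁻¹ : ℝ≥0∞) ^ G := by
  classical
  -- union bound over the at most `2 ^ G` sets of at least `G / 2` indices, for each of which the
  -- probability is at most `(1 / 16) ^ (G / 2) = 4⁻¹ ^ G`
  set F : Finset (Finset (Fin G)) := Finset.univ.filter fun s => G ≤ 2 * s.card with hF
  have hsub : {ω : Fin G → Ω | G ≤ 2 * (Finset.univ.filter fun j => ω j ∈ A).card} ⊆
      ⋃ s ∈ F, Set.univ.pi fun j => if j ∈ s then A else Set.univ := by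
    intro ω hω
    refine Set.mem_biUnion (x := Finset.univ.filter fun j => ω j ∈ A)
      (Finset.mem_filter.2 ⟨Finset.mem_univ _, hω⟩) ?_
    intro j _
    by_cases hj : ω j ∈ A <;> simp [hj]
  have hone : ∀ s ∈ F, Measure.pi (fun _ : Fin G => μ)
      (Set.univ.pi fun j => if j ∈ s then A else Set.univ) ≤ (4⁻¹ : ℝ≥0∞) ^ G := by
    intro s hs
    rw [Measure.pi_pi]
    have h1 : ∀ j, μ (if j ∈ s then A else Set.univ) = if j ∈ s then μ A else 1 := by
      intro j
      split_ifs <;> simp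
    rw [Finset.prod_congr rfl fun j _ => h1 j, Finset.prod_ite_mem, Finset.univ_inter,
      Finset.prod_const]
    calc μ A ^ s.card ≤ ((4⁻¹ : ℝ≥0∞) ^ 2) ^ s.card := by gcongr
      _ = (4⁻¹ : ℝ≥0∞) ^ (2 * s.card) := by rw [pow_mul]
      _ ≤ (4⁻¹ : ℝ≥0∞) ^ G := pow_le_pow_of_le_one zero_le (by simp)
          (Finset.mem_filter.1 hs).2
  calc _ ≤ _ := measure_mono hsub
    _ ≤ ∑ s ∈ F, Measure.pi (fun _ : Fin G => μ)
          (Set.univ.pi fun j => if j ∈ s then A else Set.univ) := measure_biUnion_finset_le _ _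
    _ ≤ ∑ _s ∈ F, (4⁻¹ : ℝ≥0∞) ^ G := Finset.sum_le_sum hone
    _ = (F.card : ℝ≥0∞) * (4⁻¹ : ℝ≥0∞) ^ G := by rw [Finset.sum_const, nsmul_eq_mul]
    _ ≤ (2 : ℝ≥0∞) ^ G * (4⁻¹ : ℝ≥0∞) ^ G := by
        gcongr
        have : F.card ≤ 2 ^ G := by
          refine (Finset.card_filter_le _ _).trans ?_
          simp
        exact_mod_cast this
    _ = (2⁻¹ : ℝ≥0∞) ^ G := by
        rw [← mul_pow, show (4 : ℝ≥0∞) = 2 * 2 by norm_num,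
          ENNReal.mul_inv (by simp) (by simp), ← mul_assoc,
          ENNReal.mul_inv_cancel (by simp) (by simp), one_mul]

/-- If a point is found in a table with probability at least `x`, where `L * x ≥ 1`, then it is
missed by `3 * L` independent tables with probability at most `1 / 16`. -/
theorem pi_uncovered_le (μ : Measure Ω) [IsProbabilityMeasure μ] {C : Set Ω}
    (hC : MeasurableSet C) {x : ℝ} (hx0 : 0 ≤ x) (hx1 : x ≤ 1) (hx : ENNReal.ofReal x ≤ μ C) {L : ℕ}
    (hL : 1 ≤ L * x) :
    Measure.pi (fun _ : Fin (3 * L) => μ) {ω | ∀ t, ω t ∉ C} ≤ (4⁻¹ : ℝ≥0∞) ^ 2 := by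
  have h : {ω : Fin (3 * L) → Ω | ∀ t, ω t ∉ C} = Set.univ.pi fun _ => Cᶜ := by
    ext ω
    simp
  rw [h, Measure.pi_pi, Finset.prod_const, Finset.card_univ, Fintype.card_fin,
    prob_compl_eq_one_sub hC]
  have h1 : 1 - μ C ≤ ENNReal.ofReal (1 - x) := by
    rw [ENNReal.ofReal_sub _ hx0, ENNReal.ofReal_one]
    exact tsub_le_tsub_left hx _
  -- `(1 - x) ^ (3 * L) ≤ exp (-3 * L * x) ≤ exp (-3) ≤ 1 / 16`
  have h2 : (1 - x) ^ (3 * L) ≤ (1 / 4) ^ 2 := by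
    have h3 : 1 - x ≤ Real.exp (-x) := Real.one_sub_le_exp_neg x
    have h4 : (1 - x) ^ (3 * L) ≤ Real.exp (-x) ^ (3 * L) :=
      pow_le_pow_left₀ (by linarith) h3 _
    have h5 : Real.exp (-x) ^ (3 * L) ≤ Real.exp (-3) := by
      rw [← Real.exp_nat_mul, Real.exp_le_exp]
      push_cast
      nlinarith
    have h6 : Real.exp (-3) ≤ (1 / 4) ^ 2 := by
      have h7 : (2.7 : ℝ) < Real.exp 1 := lt_trans (by norm_num) Real.exp_one_gt_d9
      have h8 : Real.exp 3 = Real.exp 1 ^ 3 := by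
        rw [← Real.exp_nat_mul]
        norm_num
      rw [Real.exp_neg, h8]
      have h9 : (2.7 : ℝ) ^ 3 ≤ Real.exp 1 ^ 3 := pow_le_pow_left₀ (by norm_num) h7.le 3
      rw [inv_le_comm₀ (by positivity) (by norm_num)]
      refine le_trans (by norm_num) h9
    linarith
  calc (1 - μ C) ^ (3 * L) ≤ ENNReal.ofReal (1 - x) ^ (3 * L) := by gcongr
    _ = ENNReal.ofReal ((1 - x) ^ (3 * L)) := (ENNReal.ofReal_pow (by linarith) _).symm
    _ ≤ ENNReal.ofReal ((1 / 4) ^ 2) := ENNReal.ofReal_le_ofReal h2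
    _ = (4⁻¹ : ℝ≥0∞) ^ 2 := by
        rw [ENNReal.ofReal_pow (by norm_num), one_div, ENNReal.ofReal_inv_of_pos (by norm_num)]
        norm_num

/-- If the expected number of far points in a table is at most `1`, then the probability that there
are more than `16 * T` in `T` tables is at most `1 / 16`, by Markov's inequality. -/
theorem pi_far_le {ι : Type*} (μ : Measure Ω) [IsProbabilityMeasure μ] (F : Finset ι)
    (C : ι → Set Ω) (hC : ∀ p, MeasurableSet (C p)) (hF : ∑ p ∈ F, μ (C p) ≤ 1) {T : ℕ} (hT : 0 < T)
    [∀ p, DecidablePred (· ∈ C p)] :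
    Measure.pi (fun _ : Fin T => μ)
      {ω | 16 * T < ∑ t, (F.filter fun p => ω t ∈ C p).card} ≤ (4⁻¹ : ℝ≥0∞) ^ 2 := by
  set f : (Fin T → Ω) → ℝ≥0∞ := fun ω => ∑ t, ∑ p ∈ F, (C p).indicator 1 (ω t) with hf
  have hmeas : ∀ t : Fin T, ∀ p, Measurable fun ω : Fin T → Ω => (C p).indicator (1 : Ω → ℝ≥0∞) (ω t) :=
    fun t p => (measurable_one.indicator (hC p)).comp (measurable_pi_apply t)
  have hfm : Measurable f := Finset.measurable_sum _ fun t _ =>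
    Finset.measurable_sum _ fun p _ => hmeas t p
  have hsub : {ω : Fin T → Ω | 16 * T < ∑ t, (F.filter fun p => ω t ∈ C p).card} ⊆
      {ω | (16 * T : ℝ≥0∞) ≤ f ω} := by
    intro ω hω
    have h1 : f ω = ((∑ t, (F.filter fun p => ω t ∈ C p).card : ℕ) : ℝ≥0∞) := by
      rw [hf, Nat.cast_sum]
      refine Finset.sum_congr rfl fun t _ => ?_
      rw [Finset.card_filter, Nat.cast_sum]
      refine Finset.sum_congr rfl fun p _ => ?_
      by_cases h : ω t ∈ C p <;> simp [h]
    rw [Set.mem_ofPred_eq, h1]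
    have : 16 * T ≤ ∑ t, (F.filter fun p => ω t ∈ C p).card := le_of_lt hω
    exact_mod_cast this
  have hint : ∫⁻ ω, f ω ∂(Measure.pi fun _ : Fin T => μ) ≤ T := by
    rw [hf, lintegral_finsetSum _ fun t _ => Finset.measurable_sum _ fun p _ => hmeas t p]
    have h2 : ∀ t ∈ (Finset.univ : Finset (Fin T)),
        ∫⁻ ω, ∑ p ∈ F, (C p).indicator (1 : Ω → ℝ≥0∞) (ω t) ∂(Measure.pi fun _ : Fin T => μ) ≤ 1 := by
      intro t _
      rw [lintegral_finsetSum _ fun p _ => hmeas t p]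
      refine le_trans (Finset.sum_le_sum fun p _ => ?_) hF
      rw [(measurePreserving_eval (fun _ : Fin T => μ) t).lintegral_comp
        (f := (C p).indicator (1 : Ω → ℝ≥0∞)) (measurable_one.indicator (hC p))]
      rw [lintegral_indicator_one (hC p)]
    refine (Finset.sum_le_sum h2).trans ?_
    simp
  have hT0 : (T : ℝ≥0∞) ≠ 0 := by simpa using hT.ne'
  calc _ ≤ _ := measure_mono hsub
    _ ≤ (∫⁻ ω, f ω ∂(Measure.pi fun _ : Fin T => μ)) / (16 * T : ℝ≥0∞) :=
        meas_ge_le_lintegral_div hfm.aemeasurable (by simpa using hT.ne') (by finiteness)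
    _ ≤ T / (16 * T : ℝ≥0∞) := by gcongr
    _ = (4⁻¹ : ℝ≥0∞) ^ 2 := by
        rw [ENNReal.div_eq_inv_mul, ENNReal.mul_inv (by simp) (by simp), mul_assoc,
          ENNReal.inv_mul_cancel hT0 (by simp), mul_one, ← ENNReal.inv_pow]
        norm_num

end Probability

/-! ### Setting up the data structure -/

section Lexicographic

variable {H : ℕ → ℕ → ℕ} {k i p : ℕ}

theorem lexUpTo_eq_one {j : ℕ} (h : ∀ l < j, H (i * k + l) p = 1) : lexUpTo H k i p j = 1 := by
  induction j with
  | zero => rfl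
  | succ j ih => rw [lexUpTo, if_pos (ih fun l hl => h l (by omega)), h j (by omega)]

/-- The comparison is decided by the first hash function that tells the query and the point apart. -/
theorem lexVal_eq_of_first {j : ℕ} (hj : j < k) (h : ∀ l < j, H (i * k + l) p = 1)
    (hne : H (i * k + j) p ≠ 1) : lexVal H k i p = H (i * k + j) p := by
  have h1 : lexUpTo H k i p (j + 1) = H (i * k + j) p := by
    rw [lexUpTo, if_pos (lexUpTo_eq_one h)]
  rw [lexVal, lexUpTo_eq_of_ne_one (by rwa [h1]) (Nat.succ_le_of_lt hj), h1]

end Lexicographic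

section Build

/-- The values of `k` hash functions, ordered lexicographically. -/
def Key (U : Type*) (k : ℕ) : Type _ := Lex (Fin k → U)

noncomputable instance (U : Type*) [LinearOrder U] (k : ℕ) : LinearOrder (Key U k) :=
  inferInstanceAs (LinearOrder (Lex (Fin k → U)))

theorem Key.lt_iff {U : Type*} [LinearOrder U] {k : ℕ} {x y : Key U k} :
    x < y ↔ ∃ j : Fin k, (∀ l < j, ofLex x l = ofLex y l) ∧ ofLex x j < ofLex y j :=
  Iff.rfl

variable {X U : Type*} [LinearOrder U] (d : Layout)
  (f : Fin (d.tables * d.k) → X → U) (P : Fin d.n ↪ X) (q : X)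

/-- The values at `x` of the hash functions of table `i`. -/
def tableKey (i : Fin d.tables) (x : X) : Key U d.k :=
  toLex fun l => f ⟨i * d.k + l, by
    have := i.2
    have := l.2
    nlinarith⟩ x

/-- The machine compares a stored point with the query in the order of the keys. -/
theorem lexVal_hashOracle {i b : ℕ} (hi : i < d.tables) (hb : b < d.n) :
    lexVal (hashOracle f P q) d.k i b =
      if tableKey d f ⟨i, hi⟩ (P ⟨b, hb⟩) < tableKey d f ⟨i, hi⟩ q then 2
      else if tableKey d f ⟨i, hi⟩ (P ⟨b, hb⟩) = tableKey d f ⟨i, hi⟩ q then 1 else 0 := by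
  have hor : ∀ l (hl : l < d.k), hashOracle f P q (i * d.k + l) b =
      if ofLex (tableKey d f ⟨i, hi⟩ q) ⟨l, hl⟩ < ofLex (tableKey d f ⟨i, hi⟩ (P ⟨b, hb⟩)) ⟨l, hl⟩ then 0
      else if ofLex (tableKey d f ⟨i, hi⟩ q) ⟨l, hl⟩ = ofLex (tableKey d f ⟨i, hi⟩ (P ⟨b, hb⟩)) ⟨l, hl⟩ then 1
      else 2 := by
    intro l hl
    have h : i * d.k + l < d.tables * d.k := by nlinarith
    rw [hashOracle, dif_pos h, dif_pos hb]
    rfl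
  have hone : ∀ l (hl : l < d.k), ofLex (tableKey d f ⟨i, hi⟩ q) ⟨l, hl⟩ =
      ofLex (tableKey d f ⟨i, hi⟩ (P ⟨b, hb⟩)) ⟨l, hl⟩ → hashOracle f P q (i * d.k + l) b = 1 := by
    intro l hl h
    rw [hor l hl, if_neg h.not_lt, if_pos h]
  rcases lt_trichotomy (tableKey d f ⟨i, hi⟩ (P ⟨b, hb⟩)) (tableKey d f ⟨i, hi⟩ q) with h | h | h
  · rw [if_pos h]
    obtain ⟨⟨j, hj⟩, h1, h2⟩ := Key.lt_iff.1 h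
    have h3 : hashOracle f P q (i * d.k + j) b = 2 := by
      rw [hor j hj, if_neg (not_lt.2 h2.le), if_neg h2.ne']
    rw [lexVal_eq_of_first hj (fun l hl => hone l (hl.trans hj) (h1 ⟨l, hl.trans hj⟩ hl).symm)
      (by omega), h3]
  · rw [if_neg h.not_lt, if_pos h]
    exact lexUpTo_eq_one fun l hl => hone l hl (by rw [h])
  · rw [if_neg h.not_gt, if_neg h.ne']
    obtain ⟨⟨j, hj⟩, h1, h2⟩ := Key.lt_iff.1 h
    have h3 : hashOracle f P q (i * d.k + j) b = 0 := by
      rw [hor j hj]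
      exact if_pos h2
    rw [lexVal_eq_of_first hj (fun l hl => hone l (hl.trans hj) (h1 ⟨l, hl.trans hj⟩ hl))
      (by omega), h3]

/-- Entry `x` of table `i`: the points are sorted by their keys. -/
noncomputable def sortedTable (i x : ℕ) : ℕ :=
  if h : i < d.tables ∧ x < d.n then
    (Tuple.sort (fun b => tableKey d f ⟨i, h.1⟩ (P b)) ⟨x, h.2⟩ : ℕ)
  else x

theorem sortedTable_eq {i x : ℕ} (hi : i < d.tables) (hx : x < d.n) : sortedTable d f P i x =
    (Tuple.sort (fun b => tableKey d f ⟨i, hi⟩ (P b)) ⟨x, hx⟩ : ℕ) := dif_pos ⟨hi, hx⟩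

/-- The number of points with a smaller key in table `i` than the query. -/
noncomputable def lowPos (i : ℕ) : ℕ :=
  if h : i < d.tables then
    (Finset.univ.filter fun b => tableKey d f ⟨i, h⟩ (P b) < tableKey d f ⟨i, h⟩ q).card
  else 0

/-- The number of points whose key in table `i` is at most that of the query. -/
noncomputable def highPos (i : ℕ) : ℕ :=
  if h : i < d.tables then
    (Finset.univ.filter fun b => tableKey d f ⟨i, h⟩ (P b) ≤ tableKey d f ⟨i, h⟩ q).card
  else 0

/-- The contents of cell `a` of the memory. -/
noncomputable def memCell : ℕ → ℕ
  | 0 => d.n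
  | 1 => d.k
  | 2 => d.T
  | 3 => d.G
  | 4 => d.cap
  | 5 => d.flags
  | 6 => d.slots
  | 7 => d.size
  | a + 8 => if a < d.tables * d.n then sortedTable d f P (a / d.n) (a % d.n) else 0

/-- The memory of the data structure; it does not depend on the query. -/
noncomputable def memory : List ℕ := (List.range d.size).map (memCell d f P)

theorem length_memory : (memory d f P).length = d.size := by simp [memory]

theorem Layout.flags_le_size : d.flags ≤ d.size := by
  simp only [Layout.size, Layout.slots]
  omega

theorem memCell_eq_zero {a : ℕ} (ha : d.flags ≤ a) : memCell d f P a = 0 := by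
  rw [Layout.flags] at ha
  obtain ⟨e, rfl⟩ : ∃ e, a = e + 8 := ⟨a - 8, by omega⟩
  exact if_neg (by omega)

theorem getD_memory (a : ℕ) : (memory d f P).getD a 0 = memCell d f P a := by
  rw [List.getD_eq_getElem?_getD, memory, List.getElem?_map]
  by_cases ha : a < d.size
  · rw [List.getElem?_range ha]
    rfl
  · rw [List.getElem?_eq_none (by simpa using ha),
      memCell_eq_zero d f P (d.flags_le_size.trans (not_lt.1 ha))]
    rfl

theorem sortedTable_lt {i x : ℕ} (hx : x < d.n) : sortedTable d f P i x < d.n := by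
  rw [sortedTable]
  split_ifs
  · exact Fin.is_lt _
  · exact hx

theorem mem_memory_lt {w : ℕ} (hG : 0 < d.G) (hw : d.size + d.n + d.k + d.T < 2 ^ w) :
    ∀ v ∈ memory d f P, v < 2 ^ w := by
  intro v hv
  obtain ⟨a, -, rfl⟩ := List.mem_map.1 hv
  have h1 := d.flags_le_size
  have h2 : d.slots ≤ d.size := by simp only [Layout.size]; omega
  have h3 : d.flags + d.G ≤ d.size := h2
  have h4 : d.cap ≤ d.G * d.cap := Nat.le_mul_of_pos_left _ hG
  have h5 : d.size = d.slots + d.G * d.cap := rfl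
  match a with
  | 0 => simp only [memCell]; omega
  | 1 => simp only [memCell]; omega
  | 2 => simp only [memCell]; omega
  | 3 => simp only [memCell]; omega
  | 4 => simp only [memCell]; omega
  | 5 => simp only [memCell]; omega
  | 6 => simp only [memCell]; omega
  | 7 => simp only [memCell]; omega
  | a + 8 =>
    simp only [memCell]
    split_ifs with h
    · have h6 : 0 < d.n := Nat.pos_of_ne_zero fun h0 => by simp [h0] at h
      have := sortedTable_lt d f P (i := a / d.n) (Nat.mod_lt a h6)
      omega
    · omega

theorem sum_sortedTable {i : ℕ} (hi : i < d.tables) (g : ℕ → ℕ) :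
    ∑ x ∈ Finset.range d.n, g (sortedTable d f P i x) = ∑ p ∈ Finset.range d.n, g p := by
  rw [Finset.sum_range, Finset.sum_range,
    ← Equiv.sum_comp (Tuple.sort fun b => tableKey d f ⟨i, hi⟩ (P b)) fun p : Fin d.n => g p]
  exact Finset.sum_congr rfl fun x _ => by rw [sortedTable_eq d f P hi x.2]

/-- The interval of a table has one position for each point that agrees with the query. -/
theorem highPos_sub_lowPos {i : ℕ} (hi : i < d.tables) :
    highPos d f P q i - lowPos d f P q i =
      (Finset.univ.filter fun b => tableKey d f ⟨i, hi⟩ q = tableKey d f ⟨i, hi⟩ (P b)).card := by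
  rw [highPos, lowPos, dif_pos hi, dif_pos hi, ← Finset.card_sdiff_of_subset]
  · congr 1
    ext b
    simp only [Finset.mem_sdiff, Finset.mem_filter, Finset.mem_univ, true_and, not_lt]
    rw [← le_antisymm_iff, eq_comm]
  · exact Finset.monotone_filter_right _ fun b _ hb => le_of_lt hb

/-- The memory is set up as the query program expects. The positions in a sorted table of keys smaller
than, equal to, and greater than that of the query are determined by the numbers of such keys. -/
theorem setup_memory {w : ℕ} (hn : 0 < d.n) (hT : 0 < d.T) (hG : 0 < d.G) (hcap : d.T < d.cap)
    (word_hash : d.tables * d.k + 1 < 2 ^ w) (word_mem : d.size + 4 * d.n + 100 < 2 ^ w)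
    (word_rand : d.G * d.cap * (2 * d.n) < 2 ^ w) :
    Setup w (hashOracle f P q) d (sortedTable d f P) (lowPos d f P q) (highPos d f P q)
      (memory d f P) where
  n_pos := hn
  T_pos := hT
  G_pos := hG
  T_lt := hcap
  length_eq := length_memory d f P
  head_n := getD_memory d f P 0
  head_k := getD_memory d f P 1
  head_T := getD_memory d f P 2
  head_G := getD_memory d f P 3
  head_cap := getD_memory d f P 4
  head_flags := getD_memory d f P 5
  head_slots := getD_memory d f P 6
  head_size := getD_memory d f P 7
  table := by
    intro i hi x hx
    rw [getD_memory, add_comm 8, memCell, if_pos (d.entry_lt hi hx), mul_comm i,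
      Nat.mul_add_div hn, Nat.div_eq_of_lt hx, Nat.mul_add_mod, Nat.mod_eq_of_lt hx, add_zero]
  zero := fun a ha => by rw [getD_memory, memCell_eq_zero d f P ha]
  lo_le := by
    intro i
    rw [lowPos, highPos]
    split_ifs
    · exact Finset.card_le_card (Finset.monotone_filter_right _ fun b _ hb => le_of_lt hb)
    · exact le_rfl
  hi_le := by
    intro i
    rw [highPos]
    split_ifs
    · exact (Finset.card_filter_le _ _).trans (by simp)
    · exact Nat.zero_le _
  lexVal_eq := by
    intro i hi x hx
    set σ := Tuple.sort fun b => tableKey d f ⟨i, hi⟩ (P b) with hσ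
    have hmono : Monotone ((fun b => tableKey d f ⟨i, hi⟩ (P b)) ∘ σ) := Tuple.monotone_sort _
    have hperm : ∀ Q : Fin d.n → Prop, ∀ [DecidablePred Q],
        (Finset.univ.filter fun b => Q (σ b)).card = (Finset.univ.filter Q).card := by
      intro Q _
      refine Finset.card_bijective σ σ.bijective fun b => ?_
      simp
    have hlt := Tuple.lt_card_lt_iff_apply_lt_of_monotone (j := ⟨x, hx⟩)
      (a := tableKey d f ⟨i, hi⟩ q) hmono
    have hle := Tuple.lt_card_le_iff_apply_le_of_monotone (j := ⟨x, hx⟩)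
      (a := tableKey d f ⟨i, hi⟩ q) hmono
    simp only [Function.comp_apply] at hlt hle
    rw [hperm fun b => tableKey d f ⟨i, hi⟩ (P b) < tableKey d f ⟨i, hi⟩ q] at hlt
    rw [hperm fun b => tableKey d f ⟨i, hi⟩ (P b) ≤ tableKey d f ⟨i, hi⟩ q] at hle
    rw [sortedTable_eq d f P hi hx, lexVal_hashOracle d f P q hi (Fin.is_lt _), lowPos, highPos,
      dif_pos hi, dif_pos hi]
    simp only [Fin.eta]
    by_cases h1 : tableKey d f ⟨i, hi⟩ (P (σ ⟨x, hx⟩)) < tableKey d f ⟨i, hi⟩ q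
    · rw [if_pos h1, if_pos (hlt.2 h1)]
    · rw [if_neg h1, if_neg fun h => h1 (hlt.1 h)]
      by_cases h2 : tableKey d f ⟨i, hi⟩ (P (σ ⟨x, hx⟩)) = tableKey d f ⟨i, hi⟩ q
      · rw [if_pos h2, if_pos (hle.2 h2.le)]
      · rw [if_neg h2, if_neg fun h => h2 (le_antisymm (hle.1 h) (not_lt.1 h1))]
  word_hash := word_hash
  word_mem := word_mem
  word_rand := word_rand

theorem length_partSlots (lo hi : ℕ → ℕ) (s j t : ℕ) :
    (partSlots d lo hi s j t).length =
      ∑ i ∈ Finset.range t, (hi (j * d.T + i) - lo (j * d.T + i) + (s - 1)) / s := by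
  induction t with
  | zero => simp [partSlots]
  | succ t ih => rw [partSlots_succ, List.length_append, ih, Finset.sum_range_succ]; simp [tableSlots]

/-- Close points need only one slot per table if the slots are long enough for them; every other
point adds at most one slot in each table in which it is met. -/
theorem length_groupSlots_le {F : Finset (Fin d.n)} {s : ℕ} (hs : 0 < s)
    (hF : (Finset.univ \ F).card ≤ s) (j : Fin d.G) :
    (groupSlots d (lowPos d f P q) (highPos d f P q) s j).length ≤
      d.T + ∑ t : Fin d.T, (F.filter fun b => tableKey d f ⟨j * d.T + t, d.group_lt j.2 t.2⟩ q =
        tableKey d f ⟨j * d.T + t, d.group_lt j.2 t.2⟩ (P b)).card := by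
  rw [groupSlots, length_partSlots, Finset.sum_range]
  have h : ∀ t : Fin d.T, (highPos d f P q (j * d.T + t) - lowPos d f P q (j * d.T + t) + (s - 1)) / s
      ≤ 1 + (F.filter fun b => tableKey d f ⟨j * d.T + t, d.group_lt j.2 t.2⟩ q =
        tableKey d f ⟨j * d.T + t, d.group_lt j.2 t.2⟩ (P b)).card := by
    intro t
    have hi := d.group_lt j.2 t.2
    rw [highPos_sub_lowPos d f P q hi]
    set C := Finset.univ.filter fun b => tableKey d f ⟨j * d.T + t, hi⟩ q =
        tableKey d f ⟨j * d.T + t, hi⟩ (P b) with hC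
    have h1 : C ⊆ (Finset.univ \ F) ∪ F.filter fun b => tableKey d f ⟨j * d.T + t, hi⟩ q =
        tableKey d f ⟨j * d.T + t, hi⟩ (P b) := by
      intro b hb
      by_cases hbF : b ∈ F
      · exact Finset.mem_union_right _ (Finset.mem_filter.2 ⟨hbF, (Finset.mem_filter.1 hb).2⟩)
      · exact Finset.mem_union_left _ (Finset.mem_sdiff.2 ⟨Finset.mem_univ _, hbF⟩)
    have h2 := (Finset.card_le_card h1).trans (Finset.card_union_le _ _)
    set e := (F.filter fun b => tableKey d f ⟨j * d.T + t, hi⟩ q =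
        tableKey d f ⟨j * d.T + t, hi⟩ (P b)).card with he
    have h3 : e ≤ s * e := Nat.le_mul_of_pos_left _ hs
    refine Nat.le_of_lt_succ ((Nat.div_lt_iff_lt_mul hs).2 ?_)
    have h4 : (1 + e + 1) * s = s * e + 2 * s := by ring
    rw [Nat.succ_eq_add_one, h4]
    omega
  refine (Finset.sum_le_sum fun t _ => h t).trans (le_of_eq ?_)
  rw [Finset.sum_add_distrib]
  simp

end Build

/-! ### Fair answers for good hash functions -/

section Fair

variable {X U : Type*} [MetricSpace X] [LinearOrder U]

theorem card_filter_fin_le {G : ℕ} {Q : Fin G → Prop} [DecidablePred Q] {R : ℕ → Prop}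
    [DecidablePred R] (h : ∀ j, Q j → R j) :
    (Finset.univ.filter Q).card ≤ ((Finset.range G).filter R).card := by
  refine Finset.card_le_card_of_injOn (fun j => (j : ℕ)) (fun j hj => ?_)
    Fin.val_injective.injOn
  simp only [Finset.coe_filter, Finset.mem_univ, true_and, Set.mem_ofPred_eq] at hj
  simp only [Finset.coe_filter, Finset.mem_range, Set.mem_ofPred_eq]
  exact ⟨j.2, h j hj⟩

/-- The near points seen by the machine are the `r`-neighborhood of the query. -/
theorem nearSet_distOracle {n : ℕ} (P : Fin n ↪ X) (r c : ℝ) (q : X) :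
    nearSet (distOracle P r c q) n = (nbr P q r).map Fin.valEmbedding := by
  ext p
  simp only [nearSet, nbr, Finset.mem_filter, Finset.mem_range, Finset.mem_map, Finset.mem_univ,
    true_and, Fin.valEmbedding_apply]
  constructor
  · rintro ⟨hp, h⟩
    refine ⟨⟨p, hp⟩, ?_, rfl⟩
    rw [distOracle, dif_pos hp] at h
    by_contra hc
    rw [if_neg hc] at h
    split_ifs at h
  · rintro ⟨p, h, rfl⟩
    exact ⟨p.2, by rw [distOracle, dif_pos p.2, if_pos h]⟩

/-- The hash functions of table `t` of group `j` do not separate the query from point `b`. -/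
def Collide (d : Layout) (f : Fin (d.tables * d.k) → X → U) (P : Fin d.n ↪ X) (q : X) (j : Fin d.G)
    (t : Fin d.T) (b : Fin d.n) : Prop :=
  tableKey d f ⟨j * d.T + t, d.group_lt j.2 t.2⟩ q =
    tableKey d f ⟨j * d.T + t, d.group_lt j.2 t.2⟩ (P b)

/-- If in most groups the points of `F` collide rarely with the query, and every near point collides
with the query in most groups, then the query is answered fairly, and the time depends on the number
of points outside of `F`. -/
theorem answersFairly_memory {d : Layout} {w : ℕ} (f : Fin (d.tables * d.k) → X → U)
    (P : Fin d.n ↪ X) (q : X) {r c ε B δ : ℝ} (hn : 0 < d.n) (hT : 0 < d.T) (hG : 0 < d.G)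
    (hcap : d.T < d.cap) (word_hash : d.tables * d.k + 1 < 2 ^ w)
    (word_mem : d.size + 4 * d.n + 100 < 2 ^ w) (word_rand : d.G * d.cap * (2 * d.n) < 2 ^ w)
    [∀ j t b, Decidable (Collide d f P q j t b)]
    {F : Finset (Fin d.n)} {s₀ : ℕ} (hs₀ : 0 < s₀) (hs₀n : s₀ ≤ d.n)
    (hF : (Finset.univ \ F).card ≤ s₀)
    (hfar : d.G < 2 * (Finset.univ.filter fun j : Fin d.G =>
      d.T + ∑ t, (F.filter fun b => Collide d f P q j t b).card < d.cap).card)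
    (hcov : ∀ p ∈ nbr P q r, d.G < 2 * (Finset.univ.filter fun j : Fin d.G =>
      ∃ t, Collide d f P q j t p).card)
    (hne : (nbr P q r).Nonempty) (hcard : (nbr P q r).card ≤ s₀) (hε : 0 < ε)
    (hδ : 0 < δ) (hδ1 : δ ≤ 1) {τ : ℕ} (hτB : (τ : ℝ) ≤ B)
    (hτ : ((d.k + 1 : ℕ) : ℝ) * (d.G * d.cap : ℕ) * ((s₀ : ℝ) / (nbr P q r).card) *
        (1000 * (d.n.size : ℝ) ^ 2 + 1000 * Real.log (1 / δ)) ≤ τ) :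
    AnswersFairly queryProg w f P (memory d f P) r c q ε B δ := by
  have S := setup_memory d f P q hn hT hG hcap word_hash word_mem word_rand
  have hN := nearSet_distOracle P r c q
  have hNc : (nearSet (distOracle P r c q) d.n).card = (nbr P q r).card := by
    rw [hN, Finset.card_map]
  have hgood : ∀ s, s₀ ≤ s → d.G < 2 * keptCount d (lowPos d f P q) (highPos d f P q) s d.G := by
    intro s hs
    refine hfar.trans_le (Nat.mul_le_mul_left 2 (card_filter_fin_le fun j hj => ?_))
    refine lt_of_le_of_lt ((length_groupSlots_le d f P q (hs₀.trans_le hs) (hF.trans hs) j).trans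
      (Nat.add_le_add_left (Finset.sum_le_sum fun t _ => Finset.card_le_card fun b hb => ?_) _)) hj
    rw [Finset.mem_filter] at hb ⊢
    exact hb
  have hcov' : ∀ p ∈ nearSet (distOracle P r c q) d.n, d.G < 2 * ((Finset.range d.G).filter fun j =>
      ∃ t < d.T, lexVal (hashOracle f P q) d.k (j * d.T + t) p = 1).card := by
    intro p hp
    rw [hN, Finset.mem_map] at hp
    obtain ⟨p, hp, rfl⟩ := hp
    refine (hcov p hp).trans_le (Nat.mul_le_mul_left 2 (card_filter_fin_le fun j hj => ?_))
    obtain ⟨t, ht⟩ := hj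
    refine ⟨t, t.2, ?_⟩
    rw [Fin.valEmbedding_apply, lexVal_hashOracle d f P q (d.group_lt j.2 t.2) p.2]
    simp only [Fin.eta]
    rw [Collide] at ht
    rw [if_neg ht.not_gt, if_pos ht.symm]
  obtain ⟨h1, h2, h3⟩ := queryProg_spec S (fun i hi g => sum_sortedTable d f P hi g)
    (fun p hp => by
      by_contra hc
      rw [distOracle, dif_neg hc] at hp
      exact absurd hp (by norm_num)) hs₀ hs₀n hgood hcov' (by rw [hN]; exact hne.map)
    (hNc ▸ hcard) (start queryProg (accuracy ε) (memory d f P)) rfl rfl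
  rw [hN, Finset.sum_map] at h1
  have h3' := h3 δ hδ hδ1 τ (by rw [hNc]; exact hτ)
  rw [hN, Finset.sum_map] at h3'
  refine ⟨fun i hi => ?_, h1, τ, hτB, h3'⟩
  have h4 : (reportProb queryProg w (hashOracle f P q) (distOracle P r c q) (memory d f P)
      (accuracy ε) i).toReal = 1 / ((nbr P q r).card : ℝ) := by
    rw [← hNc]
    exact h2 i (by rw [hN]; exact Finset.mem_map_of_mem _ hi)
  have h5 : 0 ≤ 1 / ((nbr P q r).card : ℝ) := by positivity
  rw [h4]
  exact ⟨div_le_self h5 (by linarith), le_mul_of_one_le_right h5 (by linarith)⟩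

end Fair

/-! ### The probability of good hash functions -/

section Good

variable {X U Ω : Type*} [MeasurableSpace Ω]

/-- The choices of `k` hash functions none of which separates `x` and `y`. -/
def collisionSet (h : Ω → X → U) (k : ℕ) (x y : X) : Set (Fin k → Ω) :=
  Set.univ.pi fun _ => {ω | h ω x = h ω y}

omit [MeasurableSpace Ω] in
theorem mem_collisionSet {h : Ω → X → U} {k : ℕ} {x y : X} {ω : Fin k → Ω} :
    ω ∈ collisionSet h k x y ↔ ∀ l, h (ω l) x = h (ω l) y := by
  simp [collisionSet]

theorem pi_collisionSet (ν : Measure Ω) [IsProbabilityMeasure ν] (h : Ω → X → U) (k : ℕ) (x y : X) :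
    Measure.pi (fun _ : Fin k => ν) (collisionSet h k x y) = ν {ω | h ω x = h ω y} ^ k := by
  rw [collisionSet, Measure.pi_pi]
  simp

open Classical in
/-- The hash functions are bad for the query `q` if in half of the groups there are too many
collisions with far points, or if one of the near points is missed in half of the groups. Both are
exponentially unlikely in the number `G` of groups. -/
theorem pi_bad_le [MetricSpace X] {ν : Measure Ω} [IsProbabilityMeasure ν] {h : Ω → X → U}
    {r R p₁ p₂ : ℝ} (hh : IsSensitive ν h r R p₁ p₂) (hp₁ : 0 ≤ p₁) (hp₁1 : p₁ ≤ 1) (hp₂ : 0 ≤ p₂)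
    {n k L : ℕ} (hk : n * p₂ ^ k ≤ 1) (hL : 1 ≤ L * p₁ ^ k) (hL0 : 0 < L) (P : Fin n ↪ X) (q : X)
    (G : ℕ) :
    Measure.pi (fun _ : Fin G => Measure.pi fun _ : Fin (3 * L) => Measure.pi fun _ : Fin k => ν)
      {ω | G ≤ 2 * (Finset.univ.filter fun j => 16 * (3 * L) < ∑ t,
            ((Finset.univ \ nbr P q R).filter fun b => ω j t ∈ collisionSet h k q (P b)).card).card ∨
          ∃ p ∈ nbr P q r, G ≤ 2 * (Finset.univ.filter fun j =>
            ∀ t, ω j t ∉ collisionSet h k q (P p)).card} ≤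
      ((n + 1 : ℕ) : ℝ≥0∞) * (2⁻¹ : ℝ≥0∞) ^ G := by
  set μ := Measure.pi fun _ : Fin k => ν with hμ
  set C : Fin n → Set (Fin k → Ω) := fun b => collisionSet h k q (P b) with hC
  have hCm : ∀ b, MeasurableSet (C b) := fun b =>
    MeasurableSet.univ_pi fun _ => hh.measurable_collision q (P b)
  have h1 := pi_majority_le (Measure.pi fun _ : Fin (3 * L) => μ)
    (pi_far_le μ (Finset.univ \ nbr P q R) C hCm (by
      calc ∑ p ∈ Finset.univ \ nbr P q R, μ (C p)
          ≤ ∑ p ∈ Finset.univ \ nbr P q R, ENNReal.ofReal (p₂ ^ k) := by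
            refine Finset.sum_le_sum fun p hp => ?_
            rw [hμ, hC, pi_collisionSet, ENNReal.ofReal_pow hp₂]
            refine pow_le_pow_left' (hh.far _ _ ?_) k
            simpa [nbr] using hp
        _ ≤ (n : ℝ≥0∞) * ENNReal.ofReal (p₂ ^ k) := by
            rw [Finset.sum_const, nsmul_eq_mul]
            gcongr
            exact (Finset.card_le_univ _).trans (by simp)
        _ ≤ 1 := by
            rw [← ENNReal.ofReal_natCast, ← ENNReal.ofReal_mul (by positivity)]
            exact ENNReal.ofReal_le_one.2 hk) (T := 3 * L) (by omega)) G
  have h2 : ∀ p ∈ nbr P q r, _ := fun p hp => pi_majority_le (Measure.pi fun _ : Fin (3 * L) => μ)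
    (pi_uncovered_le μ (hCm p) (x := p₁ ^ k) (by positivity) (pow_le_one₀ hp₁ hp₁1) (by
      rw [hμ, hC, pi_collisionSet, ENNReal.ofReal_pow hp₁]
      refine pow_le_pow_left' (hh.near _ _ ?_) k
      simpa [nbr] using hp) hL) G
  refine (measure_mono (t := _ ∪ ⋃ p ∈ nbr P q r, _) ?_).trans ((measure_union_le _ _).trans
    ((add_le_add h1 ((measure_biUnion_finset_le _ _).trans (Finset.sum_le_sum h2))).trans ?_))
  · rintro ω (hω | ⟨p, hp, hω⟩)
    · exact Or.inl hω
    · exact Or.inr (Set.mem_biUnion hp hω)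
  · rw [Finset.sum_const, nsmul_eq_mul, Nat.cast_add, Nat.cast_one, add_mul, one_mul, add_comm]
    gcongr
    exact (Finset.card_le_univ _).trans (by simp)

end Good

/-! ### The parameters -/

section Parameters

variable {n : ℕ} {p₁ p₂ : ℝ}

theorem lshTables_pos (hp₁ : 0 < p₁) : 0 < lshTables n p₁ p₂ :=
  Nat.ceil_pos.2 (by positivity)

/-- The number `L` of tables is large enough for a near point to be found in one of them on average. -/
theorem one_le_lshTables_mul (hp₁ : 0 < p₁) :
    1 ≤ (lshTables n p₁ p₂ : ℝ) * p₁ ^ lshConcat n p₂ := by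
  have h : (1 / p₁) ^ lshConcat n p₂ ≤ lshTables n p₁ p₂ := Nat.le_ceil _
  rw [one_div, inv_pow] at h
  have h1 : 0 < p₁ ^ lshConcat n p₂ := by positivity
  calc (1 : ℝ) = (p₁ ^ lshConcat n p₂)⁻¹ * p₁ ^ lshConcat n p₂ := (inv_mul_cancel₀ h1.ne').symm
    _ ≤ _ := by gcongr

/-- The number `k` of hash functions per table is large enough for the expected number of far points
that agree with the query to be at most `1`. -/
theorem mul_pow_lshConcat_le_one (hn : 0 < n) (hp₂ : 0 < p₂) (hp₂1 : p₂ < 1) :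
    (n : ℝ) * p₂ ^ lshConcat n p₂ ≤ 1 := by
  have hlog : 0 < Real.log (1 / p₂) := Real.log_pos (by rw [lt_div_iff₀ hp₂]; linarith)
  have h1 : Real.log n ≤ lshConcat n p₂ * Real.log (1 / p₂) := by
    rw [← div_le_iff₀ hlog]
    exact Nat.le_ceil _
  have h2 : (n : ℝ) ≤ (1 / p₂) ^ lshConcat n p₂ := by
    rw [← Real.log_le_log_iff (by positivity) (by positivity), Real.log_pow]
    exact h1
  calc (n : ℝ) * p₂ ^ lshConcat n p₂ ≤ (1 / p₂) ^ lshConcat n p₂ * p₂ ^ lshConcat n p₂ := by gcongr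
    _ = 1 := by rw [← mul_pow, one_div, inv_mul_cancel₀ hp₂.ne', one_pow]

theorem one_le_log_add_two (hn : 0 < n) : 1 ≤ Real.log ((n : ℝ) + 2) := by
  rw [Real.le_log_iff_exp_le (by positivity)]
  have h1 : (1 : ℝ) ≤ n := by exact_mod_cast hn
  have := Real.exp_one_lt_d9
  linarith

theorem size_le_log (hn : 0 < n) : (n.size : ℝ) ≤ 4 * Real.log ((n : ℝ) + 2) := by
  have h1 : 2 ^ (n.size - 1) ≤ n := by
    have : n.size - 1 < n.size := by
      have := Nat.size_pos.2 hn
      omega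
    exact Nat.lt_size.1 this
  have h2 : (2 : ℝ) ^ n.size ≤ 2 * n := by
    have h3 : 2 ^ n.size ≤ 2 * n := by
      have := Nat.size_pos.2 hn
      calc 2 ^ n.size = 2 * 2 ^ (n.size - 1) := by rw [← pow_succ']; congr 1; omega
        _ ≤ 2 * n := by omega
    exact_mod_cast h3
  have h3 : (1 : ℝ) ≤ n := by exact_mod_cast hn
  have h4 : (n.size : ℝ) * Real.log 2 ≤ Real.log (((n : ℝ) + 2) ^ 2) := by
    rw [← Real.log_pow]
    exact Real.log_le_log (by positivity) (h2.trans (by nlinarith))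
  rw [Real.log_pow] at h4
  have h5 := Real.log_two_gt_d9
  have h6 : (0 : ℝ) ≤ n.size := by positivity
  push_cast at h4
  nlinarith

/-- The number of groups per bit of `n`. Two groups more than `γ` pay for the union bound over the
points. -/
noncomputable def groupFactor (γ : ℝ) : ℕ := ⌈γ⌉₊ + 2

/-- The union bound over all near points, plus one for the far points, leaves a probability of at most
`n ^ (-γ)`. -/
theorem failure_le (hn : 2 ≤ n) (γ : ℝ) :
    ((n + 1 : ℕ) : ℝ≥0∞) * (2⁻¹ : ℝ≥0∞) ^ (groupFactor γ * n.size) ≤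
      ENNReal.ofReal ((n : ℝ) ^ (-γ)) := by
  have hn1 : (2 : ℝ) ≤ n := by exact_mod_cast hn
  have h1 : ((n : ℝ) + 1) * (2⁻¹ : ℝ) ^ (groupFactor γ * n.size) ≤ (n : ℝ) ^ (-γ) := by
    rw [inv_pow, Real.rpow_neg (by positivity), ← div_eq_mul_inv, div_le_iff₀ (by positivity),
      inv_mul_eq_div, le_div_iff₀ (by positivity)]
    have h2 : (n : ℝ) ^ γ ≤ (n : ℝ) ^ ⌈γ⌉₊ := by
      rw [← Real.rpow_natCast]
      exact Real.rpow_le_rpow_of_exponent_le (by linarith) (Nat.le_ceil _)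
    have h3 : (n : ℝ) ≤ 2 ^ n.size := by exact_mod_cast (Nat.lt_size_self n).le
    calc ((n : ℝ) + 1) * (n : ℝ) ^ γ ≤ (n : ℝ) ^ 2 * (n : ℝ) ^ ⌈γ⌉₊ := by
          gcongr
          nlinarith
      _ = (n : ℝ) ^ groupFactor γ := by rw [groupFactor, ← pow_add, add_comm]
      _ ≤ (2 ^ n.size) ^ groupFactor γ := by gcongr
      _ = 2 ^ (groupFactor γ * n.size) := by rw [← pow_mul, mul_comm]
  calc _ = ENNReal.ofReal (((n : ℝ) + 1) * (2⁻¹ : ℝ) ^ (groupFactor γ * n.size)) := by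
        rw [ENNReal.ofReal_mul (by positivity), ENNReal.ofReal_pow (by norm_num),
          ENNReal.ofReal_inv_of_pos (by norm_num)]
        congr 1
        · rw [← ENNReal.ofReal_natCast]
          push_cast
          rfl
        · norm_num
    _ ≤ _ := ENNReal.ofReal_le_ofReal h1

/-- The layout for `k` hash functions per table and `3 * L` tables per group. The factor `3` makes a
near point visible in a group with probability at least `15 / 16`; the room for `17` slots per table
suffices for `16` far points per table on average. -/
abbrev mainLayout (n k L G : ℕ) : Layout := ⟨n, k, 3 * L, G, 17 * (3 * L) + 1⟩

/-- The layout for a single table with all points. -/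
abbrev plainLayout (n : ℕ) : Layout := ⟨n, 0, 1, 1, 2⟩

/-- All numbers that the query program deals with are polynomial in `n + k + L + 2`, the exponent
depending on `γ` only through `g ≤ 2 ^ g`. -/
theorem mainLayout_word {k L g b w : ℕ} (hL : 0 < L) (hn : 2 ≤ n) (hg : 0 < g)
    (hb : g + 8 ≤ b) (hw : (n + k + L + 2) ^ b ≤ 2 ^ w) :
    let d := mainLayout n k L (g * n.size)
    d.tables * d.k + 1 < 2 ^ w ∧ d.size + 4 * d.n + 100 < 2 ^ w ∧
      d.G * d.cap * (2 * d.n) < 2 ^ w ∧ d.size + d.n + d.k + d.T < 2 ^ w := by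
  intro d
  set z := n + k + L + 2 with hz
  set G := g * n.size with hG
  have hz5 : 5 ≤ z := by omega
  have hgz : g ≤ z ^ g := (Nat.lt_pow_self (by omega)).le
  have hsz : n.size ≤ z := by
    have : n.size ≤ n := Nat.size_le.2 Nat.lt_two_pow_self
    omega
  have hGz : G ≤ z ^ (g + 1) := by
    rw [pow_succ]
    exact Nat.mul_le_mul hgz hsz
  have hmul : ∀ x y, x ≤ z → y ≤ z → G * x * y ≤ z ^ (g + 3) := by
    intro x y hx hy
    calc G * x * y ≤ z ^ (g + 1) * z * z := by gcongr
      _ = z ^ (g + 3) := by ring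
  have h1 : 1 ≤ z := by omega
  have hone : z ≤ z ^ (g + 3) := Nat.le_self_pow (by omega) z
  have e1 := hmul L n (by omega) (by omega)
  have e2 := hmul L k (by omega) (by omega)
  have e3 := hmul L 1 (by omega) h1
  have e4 := hmul 1 1 h1 h1
  have e5 := hmul n 1 (by omega) h1
  have hbig : 625 * z ^ (g + 3) ≤ 2 ^ w := by
    calc 625 * z ^ (g + 3) ≤ z ^ 4 * z ^ (g + 3) := by
          gcongr
          calc 625 = 5 ^ 4 := by norm_num
            _ ≤ z ^ 4 := Nat.pow_le_pow_left hz5 4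
      _ = z ^ (g + 7) := by ring
      _ ≤ z ^ b := Nat.pow_le_pow_right h1 (by omega)
      _ ≤ 2 ^ w := hw
  simp only [mul_one] at e3 e4 e5
  have t1 : d.tables * d.k = 3 * (G * L * k) := by
    simp only [d, Layout.tables]
    ring
  have t2 : d.size = 8 + 3 * (G * L * n) + G + 51 * (G * L) + G := by
    simp only [d, Layout.tables, Layout.size, Layout.slots, Layout.flags]
    ring
  have t3 : d.G * d.cap * (2 * d.n) = 102 * (G * L * n) + 2 * (G * n) := by
    simp only [d]
    ring
  have t4 : d.n = n := rfl
  have t5 : d.k = k := rfl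
  have t6 : d.T = 3 * L := rfl
  rw [t1, t2, t3, t4, t5, t6]
  generalize z ^ (g + 3) = Z at *
  generalize 2 ^ w = W at *
  generalize G * L * n = y1 at *
  generalize G * L * k = y2 at *
  generalize G * L = y3 at *
  generalize G * n = y4 at *
  omega

theorem plainLayout_word {k L b w : ℕ} (hn : 2 ≤ n) (hb : 8 ≤ b)
    (hw : (n + k + L + 2) ^ b ≤ 2 ^ w) :
    let d := plainLayout n
    d.tables * d.k + 1 < 2 ^ w ∧ d.size + 4 * d.n + 100 < 2 ^ w ∧
      d.G * d.cap * (2 * d.n) < 2 ^ w ∧ d.size + d.n + d.k + d.T < 2 ^ w := by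
  intro d
  set z := n + k + L + 2 with hz
  have hbig : 64 * z ≤ 2 ^ w := by
    calc 64 * z ≤ z ^ 3 * z := by
          gcongr
          calc 64 = 4 ^ 3 := by norm_num
            _ ≤ z ^ 3 := Nat.pow_le_pow_left (by omega) 3
      _ = z ^ 4 := by ring
      _ ≤ z ^ b := Nat.pow_le_pow_right (by omega) (by omega)
      _ ≤ 2 ^ w := hw
  simp only [d, Layout.tables, Layout.size, Layout.slots, Layout.flags]
  omega

theorem mainLayout_space {k L g : ℕ} (hL : 0 < L) (hn : 2 ≤ n) (hg : 0 < g) (hk : k ≤ n) :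
    let d := mainLayout n k L (g * n.size)
    (d.tables * d.k + d.n + d.size : ℕ) ≤ 68 * (n * L) * (g * n.size) := by
  intro d
  have hG : 0 < g * n.size := Nat.mul_pos hg (Nat.size_pos.2 (by omega))
  set G := g * n.size
  have t : d.tables * d.k + d.n + d.size =
      3 * (G * L * k) + n + 8 + 3 * (G * L * n) + 2 * G + 51 * (G * L) := by
    simp only [d, Layout.tables, Layout.size, Layout.slots, Layout.flags]
    ring
  have h1 : G * L * k ≤ G * L * n := Nat.mul_le_mul_left _ hk
  have hGL : 0 < G * L := Nat.mul_pos hG hL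
  have h2 : n ≤ G * L * n := Nat.le_mul_of_pos_left _ hGL
  have h3 : G * L ≤ G * L * n := Nat.le_mul_of_pos_right _ (by omega)
  have h4 : G ≤ G * L := Nat.le_mul_of_pos_right _ hL
  have h5 : 68 * (n * L) * G = 68 * (G * L * n) := by ring
  rw [t, h5]
  omega

theorem plainLayout_space {L : ℕ} (hL : 0 < L) (hn : 2 ≤ n) :
    let d := plainLayout n
    (d.tables * d.k + d.n + d.size : ℕ) ≤ 68 * (n * L) := by
  intro d
  have h2 : n ≤ n * L := Nat.le_mul_of_pos_right _ hL
  simp only [d, Layout.tables, Layout.size, Layout.slots, Layout.flags]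
  omega

/-- The constant factor in the bounds for space and time. -/
noncomputable def boundFactor (γ : ℝ) : ℝ := 208 * groupFactor γ * (16000 + 1000 * γ) + 1

theorem le_boundFactor {γ : ℝ} (hγ : 0 < γ) : 272 * (groupFactor γ : ℝ) ≤ boundFactor γ := by
  have : (0 : ℝ) ≤ groupFactor γ := by positivity
  rw [boundFactor]
  nlinarith

theorem one_le_groupFactor (γ : ℝ) : (1 : ℝ) ≤ groupFactor γ := by
  rw [groupFactor]
  push_cast
  have : (0 : ℝ) ≤ (⌈γ⌉₊ : ℝ) := by positivity
  linarith

/-- The bound of `queryProg_spec` on the running time with `δ = n ^ (-γ)`, rounded up, stays within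
the required bound. Here `Q` stands for the query time of LSH, `y` for the ratio of the numbers of
neighbors, and `e` for the factor that depends on `ε`. -/
theorem exists_time {γ x y Q e : ℝ} (hn : 2 ≤ n) (hγ : 0 < γ) (hx : 0 ≤ x)
    (hQ : 1 ≤ Q * y) (hy : 0 ≤ y) (he : 1 ≤ e)
    (hxQ : x * y ≤ 52 * groupFactor γ * n.size * (Q * y)) :
    ∃ τ : ℕ, (τ : ℝ) ≤ boundFactor γ * Q * y * e * Real.log ((n : ℝ) + 2) ^ 3 ∧
      x * y * (1000 * (n.size : ℝ) ^ 2 + 1000 * Real.log (1 / (n : ℝ) ^ (-γ))) ≤ τ := by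
  have hn0 : (0 : ℝ) < n := by exact_mod_cast (by omega : 0 < n)
  set ℓ := Real.log ((n : ℝ) + 2) with hℓ
  have hℓ1 : 1 ≤ ℓ := one_le_log_add_two (by omega)
  have hs : (n.size : ℝ) ≤ 4 * ℓ := size_le_log (by omega)
  have hlog : Real.log (1 / (n : ℝ) ^ (-γ)) = γ * Real.log n := by
    rw [Real.rpow_neg hn0.le, one_div, inv_inv, Real.log_rpow hn0]
  have hlogn : Real.log n ≤ ℓ := Real.log_le_log hn0 (by linarith)
  have hlogn0 : 0 ≤ Real.log n := Real.log_natCast_nonneg n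
  refine ⟨_, ?_, Nat.le_ceil _⟩
  rw [hlog]
  have hv0 : 0 ≤ 1000 * (n.size : ℝ) ^ 2 + 1000 * (γ * Real.log n) := by positivity
  have h1 : 1000 * (n.size : ℝ) ^ 2 + 1000 * (γ * Real.log n) ≤ (16000 + 1000 * γ) * ℓ ^ 2 := by
    have h2 : (n.size : ℝ) ^ 2 ≤ (4 * ℓ) ^ 2 := by gcongr
    have h3 : γ * Real.log n ≤ γ * ℓ ^ 2 := by
      gcongr
      nlinarith
    nlinarith
  have hg := one_le_groupFactor γ
  have h4 : x * y * (1000 * (n.size : ℝ) ^ 2 + 1000 * (γ * Real.log n)) ≤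
      (208 * groupFactor γ * (16000 + 1000 * γ)) * ((Q * y) * ℓ ^ 3) := by
    calc _ ≤ (52 * groupFactor γ * n.size * (Q * y)) * ((16000 + 1000 * γ) * ℓ ^ 2) := by
          gcongr
      _ ≤ (52 * groupFactor γ * (4 * ℓ) * (Q * y)) * ((16000 + 1000 * γ) * ℓ ^ 2) := by
          gcongr
      _ = _ := by ring
  have h5 : 1 ≤ (Q * y) * ℓ ^ 3 := one_le_mul_of_one_le_of_one_le hQ (one_le_pow₀ hℓ1)
  have h6 : (0 : ℝ) ≤ boundFactor γ := by
    have := le_boundFactor hγ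
    linarith
  calc _ ≤ x * y * (1000 * (n.size : ℝ) ^ 2 + 1000 * (γ * Real.log n)) + 1 :=
        (Nat.ceil_lt_add_one (by positivity)).le
    _ ≤ boundFactor γ * ((Q * y) * ℓ ^ 3) := by
        rw [boundFactor]
        linarith
    _ ≤ boundFactor γ * ((Q * y) * ℓ ^ 3) * e := by
        refine le_mul_of_one_le_right ?_ he
        positivity
    _ = _ := by ring

end Parameters

/-! ### The two cases of the construction -/

section Cases

variable {X : Type u} {U : Type v} {Ω : Type x} [MetricSpace X] [LinearOrder U] [MeasurableSpace Ω]
  {ν : Measure Ω} [IsProbabilityMeasure ν] {h : Ω → X → U} {n : ℕ} {P : Fin n ↪ X}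
  {r c p₁ p₂ : ℝ}

theorem nbr_card_le (hc : 1 < c) {q : X} (hne : (nbr P q r).Nonempty) :
    (nbr P q r).card ≤ (nbr P q (c * r)).card := by
  refine Finset.card_le_card fun p hp => ?_
  -- the radius is nonnegative because there is a near point
  obtain ⟨p₀, h₀⟩ := hne
  simp only [nbr, Finset.mem_filter, Finset.mem_univ, true_and] at hp h₀ ⊢
  have : 0 ≤ r := dist_nonneg.trans h₀
  nlinarith

theorem half_lt_of_not_half_le {G : ℕ} {Q R : Fin G → Prop} [DecidablePred Q] [DecidablePred R]
    (hQR : ∀ j, ¬ Q j → R j) (hQ : ¬ G ≤ 2 * (Finset.univ.filter Q).card) :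
    G < 2 * (Finset.univ.filter R).card := by
  have h1 : (Finset.univ.filter fun j => ¬ Q j).card ≤ (Finset.univ.filter R).card :=
    Finset.card_le_card (Finset.monotone_filter_right _ fun j _ hj => hQR j hj)
  have h2 := Finset.card_filter_add_card_filter_not (s := (Finset.univ : Finset (Fin G))) Q
  rw [Finset.card_univ, Fintype.card_fin] at h2
  omega

theorem one_le_one_add_log {ε : ℝ} (hε : 0 < ε) (hε1 : ε < 1) : 1 ≤ 1 + Real.log (1 / ε) := by
  have := Real.log_nonneg (x := 1 / ε) (by rw [le_div_iff₀ hε]; linarith)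
  linarith

/-- If `k > n`, a single table without hash functions, in which all points collide with the query, is
fast enough, as `n` is below the query time of LSH. -/
theorem plainLayout_answersFairly {γ ε : ℝ} {w k L : ℕ} (hγ : 0 < γ) (hn : 2 ≤ n) (hL : 0 < L)
    (hk : n < k) (hw : (n + k + L + 2) ^ 8 ≤ 2 ^ w) (hc : 1 < c)
    (f : Fin ((plainLayout n).tables * (plainLayout n).k) → X → U) (q : X)
    (hne : (nbr P q r).Nonempty) (hε : 0 < ε) (hε1 : ε < 1) :
    AnswersFairly queryProg w f P (memory (plainLayout n) f P) r c q ε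
      (boundFactor γ * ((k + 1) * L : ℕ) * (((nbr P q (c * r)).card : ℝ) / (nbr P q r).card) *
        (1 + Real.log (1 / ε)) * Real.log (n + 2) ^ 3) ((n : ℝ) ^ (-γ)) := by
  classical
  have hword := plainLayout_word hn le_rfl hw
  have hn1 : (1 : ℝ) ≤ n := by exact_mod_cast (by omega : 1 ≤ n)
  have hN0 : (0 : ℝ) < (nbr P q r).card := by exact_mod_cast hne.card_pos
  have hN : ((nbr P q r).card : ℝ) ≤ (nbr P q (c * r)).card := by exact_mod_cast nbr_card_le hc hne
  have hNn : (nbr P q r).card ≤ n := (Finset.card_le_univ _).trans (by simp)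
  have hy1 : 1 ≤ ((nbr P q (c * r)).card : ℝ) / (nbr P q r).card := (one_le_div hN0).2 hN
  have hQn : (n : ℝ) ≤ ((k + 1) * L : ℕ) := by
    have : n ≤ (k + 1) * L := (by omega : n ≤ k + 1).trans (Nat.le_mul_of_pos_right _ hL)
    exact_mod_cast this
  have hs1 : (1 : ℝ) ≤ n.size := by exact_mod_cast Nat.size_pos.2 (by omega : 0 < n)
  have hg := one_le_groupFactor γ
  obtain ⟨τ, hτB, hτ⟩ := exists_time (n := n) (γ := γ) (Q := ((k + 1) * L : ℕ))
    (x := 2 * n / (nbr P q (c * r)).card)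
    (y := ((nbr P q (c * r)).card : ℝ) / (nbr P q r).card) (e := 1 + Real.log (1 / ε)) hn hγ
    (by positivity) (one_le_mul_of_one_le_of_one_le (hn1.trans hQn) hy1) (by positivity)
    (one_le_one_add_log hε hε1) (by
      have h1 : (2 * n / (nbr P q (c * r)).card : ℝ) ≤ 2 * n :=
        div_le_self (by positivity) (hN.trans' (by exact_mod_cast hne.card_pos))
      have h2 : (1 : ℝ) ≤ groupFactor γ * n.size := one_le_mul_of_one_le_of_one_le hg hs1
      calc _ ≤ (2 * n : ℝ) * (((nbr P q (c * r)).card : ℝ) / (nbr P q r).card) := by gcongr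
        _ ≤ (2 * ((k + 1) * L : ℕ) : ℝ) * (((nbr P q (c * r)).card : ℝ) / (nbr P q r).card) := by
            gcongr
        _ = 2 * 1 * (((k + 1) * L : ℕ) * (((nbr P q (c * r)).card : ℝ) / (nbr P q r).card)) := by
            ring
        _ ≤ 52 * (groupFactor γ * n.size) *
            (((k + 1) * L : ℕ) * (((nbr P q (c * r)).card : ℝ) / (nbr P q r).card)) := by
            gcongr
            norm_num
        _ = _ := by ring)
  refine answersFairly_memory (d := plainLayout n) (F := ∅) (s₀ := n) f P q (by simp; omega)
    (by simp) (by simp) (by simp) hword.1 hword.2.1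
    hword.2.2.1 (by omega) le_rfl
    ((Finset.card_le_univ _).trans_eq (Fintype.card_fin n)) ?_ ?_ hne hNn hε (by positivity)
    (Real.rpow_le_one_of_one_le_of_nonpos hn1 (by linarith)) hτB ?_
  · have : ∀ j : Fin (plainLayout n).G, (plainLayout n).T +
        ∑ t, ((∅ : Finset (Fin n)).filter fun b => Collide (plainLayout n) f P q j t b).card <
        (plainLayout n).cap := fun j => by simp
    rw [Finset.filter_true_of_mem fun j _ => this j]
    simp
  · -- without hash functions, all points collide with the query
    intro p _
    have : ∀ j : Fin (plainLayout n).G, ∃ t, Collide (plainLayout n) f P q j t p :=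
      fun j => ⟨⟨0, by simp⟩, funext fun l => l.elim0⟩
    rw [Finset.filter_true_of_mem fun j _ => this j]
    simp
  · refine le_trans (le_of_eq ?_) hτ
    have hR0 : ((nbr P q (c * r)).card : ℝ) ≠ 0 := (hN0.trans_le hN).ne'
    simp only [plainLayout]
    push_cast
    field_simp

/-- The slot length need not exceed twice the number of points within distance `c * r`, since the
remaining points add at most `16` slots per table on average in most groups. -/
theorem mainLayout_answersFairly {γ ε : ℝ} {w k L : ℕ} (hγ : 0 < γ) (hn : 2 ≤ n) (hL : 0 < L)
    (hw : (n + k + L + 2) ^ (groupFactor γ + 8) ≤ 2 ^ w) (hc : 1 < c)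
    (f : Fin ((mainLayout n k L (groupFactor γ * n.size)).tables *
      (mainLayout n k L (groupFactor γ * n.size)).k) → X → U) (q : X)
    (hne : (nbr P q r).Nonempty) (hε : 0 < ε) (hε1 : ε < 1)
    [∀ j t b, Decidable (Collide (mainLayout n k L (groupFactor γ * n.size)) f P q j t b)]
    (hfar : ¬ groupFactor γ * n.size ≤ 2 * (Finset.univ.filter fun j => 16 * (3 * L) <
      ∑ t, ((Finset.univ \ nbr P q (c * r)).filter fun b =>
        Collide (mainLayout n k L (groupFactor γ * n.size)) f P q j t b).card).card)
    (hcov : ∀ p ∈ nbr P q r, ¬ groupFactor γ * n.size ≤ 2 * (Finset.univ.filter fun j =>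
      ∀ t, ¬ Collide (mainLayout n k L (groupFactor γ * n.size)) f P q j t p).card) :
    AnswersFairly queryProg w f P (memory (mainLayout n k L (groupFactor γ * n.size)) f P) r c q ε
      (boundFactor γ * ((k + 1) * L : ℕ) * (((nbr P q (c * r)).card : ℝ) / (nbr P q r).card) *
        (1 + Real.log (1 / ε)) * Real.log (n + 2) ^ 3) ((n : ℝ) ^ (-γ)) := by
  have hg0 : 0 < groupFactor γ := by simp [groupFactor]
  have hs0 : 0 < n.size := Nat.size_pos.2 (by omega)
  have hword := mainLayout_word (k := k) hL hn hg0 le_rfl hw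
  have hn1 : (1 : ℝ) ≤ n := by exact_mod_cast (by omega : 1 ≤ n)
  have hN0 : (0 : ℝ) < (nbr P q r).card := by exact_mod_cast hne.card_pos
  have hN : ((nbr P q r).card : ℝ) ≤ (nbr P q (c * r)).card := by exact_mod_cast nbr_card_le hc hne
  have hy1 : 1 ≤ ((nbr P q (c * r)).card : ℝ) / (nbr P q r).card := (one_le_div hN0).2 hN
  have hQ1 : (1 : ℝ) ≤ ((k + 1) * L : ℕ) := by
    exact_mod_cast (Nat.mul_pos (Nat.succ_pos k) hL : 0 < (k + 1) * L)
  have hG0 : 0 < groupFactor γ * n.size := Nat.mul_pos hg0 hs0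
  obtain ⟨τ, hτB, hτ⟩ := exists_time (n := n) (γ := γ) (Q := ((k + 1) * L : ℕ))
    (x := ((k + 1 : ℕ) : ℝ) * (groupFactor γ * n.size * (17 * (3 * L) + 1) : ℕ))
    (y := ((nbr P q (c * r)).card : ℝ) / (nbr P q r).card) (e := 1 + Real.log (1 / ε)) hn hγ
    (by positivity) (one_le_mul_of_one_le_of_one_le hQ1 hy1) (by positivity)
    (one_le_one_add_log hε hε1) (by
      rw [← mul_assoc (52 * (groupFactor γ : ℝ) * n.size)]
      refine mul_le_mul_of_nonneg_right ?_ (by positivity)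
      have : (k + 1) * (groupFactor γ * n.size * (17 * (3 * L) + 1)) ≤
          52 * groupFactor γ * n.size * ((k + 1) * L) := by
        calc (k + 1) * (groupFactor γ * n.size * (17 * (3 * L) + 1)) ≤
            (k + 1) * (groupFactor γ * n.size * (52 * L)) := by
              gcongr
              omega
          _ = _ := by ring
      exact_mod_cast this)
  refine answersFairly_memory (d := mainLayout n k L (groupFactor γ * n.size))
    (F := Finset.univ \ nbr P q (c * r)) (s₀ := (nbr P q (c * r)).card) f P q
    (by simp only; omega) (by simp only; omega) hG0
    (by simp only; omega) hword.1 hword.2.1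
    hword.2.2.1 (by exact_mod_cast hN0.trans_le hN) ((Finset.card_le_univ _).trans (by simp))
    (le_of_eq ?_) ?_ ?_ hne (nbr_card_le hc hne) hε (by positivity)
    (Real.rpow_le_one_of_one_le_of_nonpos hn1 (by linarith)) hτB hτ
  · rw [sdiff_sdiff_right_self, Finset.inf_eq_inter, Finset.univ_inter]
  · refine half_lt_of_not_half_le (fun j hj => ?_) hfar
    exact lt_of_le_of_lt (Nat.add_le_add_left (not_lt.1 hj) _) (by simp only; omega)
  · intro p hp
    refine half_lt_of_not_half_le (fun j hj => ?_) (hcov p hp)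
    exact not_forall_not.1 hj

omit [MetricSpace X] [LinearOrder U] in
/-- Collisions in terms of the hash functions drawn table by table. -/
theorem collide_iff {k L G : ℕ} (ω : Fin (G * (3 * L) * k) → Ω) (q : X) (j : Fin G)
    (t : Fin (3 * L)) (b : Fin n) :
    Collide (mainLayout n k L G) (fun i => h (ω i)) P q j t b ↔
      (flatten Ω G (3 * L) k).symm ω j t ∈ collisionSet h k q (P b) := by
  rw [Collide, mem_collisionSet]
  refine funext_iff.trans (forall_congr' fun l => ?_)
  have h1 : hashIndex G (3 * L) k ((j, t), l) = ⟨(j * (3 * L) + t) * k + l,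
      hashIndex_val j t l ▸ (hashIndex G (3 * L) k ((j, t), l)).2⟩ :=
    Fin.ext (hashIndex_val j t l)
  change _ ↔ h (ω (hashIndex G (3 * L) k ((j, t), l))) q =
    h (ω (hashIndex G (3 * L) k ((j, t), l))) (P b)
  rw [h1]
  rfl

/-- The answers are fair unless the hash functions are bad in the sense of `pi_bad_le`. -/
theorem mainLayout_failure {γ ε : ℝ} {w : ℕ} (hγ : 0 < γ) (hn : 2 ≤ n) (hc : 1 < c)
    (hp₂ : 0 < p₂) (hp : p₂ < p₁) (hp₁ : p₁ ≤ 1) (hh : IsSensitive ν h r (c * r) p₁ p₂)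
    (hw : (n + lshConcat n p₂ + lshTables n p₁ p₂ + 2) ^ (groupFactor γ + 8) ≤ 2 ^ w)
    (q : X) (hne : (nbr P q r).Nonempty) (hε : 0 < ε) (hε1 : ε < 1) :
    let d := mainLayout n (lshConcat n p₂) (lshTables n p₁ p₂) (groupFactor γ * n.size)
    Measure.pi (fun _ : Fin (d.tables * d.k) => ν)
      {ω | ¬ AnswersFairly queryProg w (fun j => h (ω j)) P (memory d (fun j => h (ω j)) P) r c q ε
        (boundFactor γ * lshQuery n p₁ p₂ *
          (((nbr P q (c * r)).card : ℝ) / (nbr P q r).card) * (1 + Real.log (1 / ε)) *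
          Real.log (n + 2) ^ 3) ((n : ℝ) ^ (-γ))} ≤ ENNReal.ofReal ((n : ℝ) ^ (-γ)) := by
  classical
  intro d
  set k := lshConcat n p₂
  set L := lshTables n p₁ p₂
  set G := groupFactor γ * n.size
  have hp₁0 : 0 < p₁ := hp₂.trans hp
  have hL : 0 < L := lshTables_pos hp₁0
  refine le_trans ?_ ((pi_bad_le hh hp₁0.le hp₁ hp₂.le
    (mul_pow_lshConcat_le_one (by omega) hp₂ (hp.trans_le hp₁)) (one_le_lshTables_mul hp₁0) hL P q
    G).trans (failure_le hn γ))
  refine pi_le_of_flatten ν G (3 * L) k fun ω hω => ?_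
  by_contra hbad
  refine hω ?_
  set ω' := flatten Ω G (3 * L) k ω with hω'
  have hinv : (flatten Ω G (3 * L) k).symm ω' = ω := (flatten Ω G (3 * L) k).symm_apply_apply ω
  have hcol := fun j t b => collide_iff (h := h) (P := P) ω' q j t b
  simp only [hinv] at hcol
  rw [Set.mem_ofPred_eq, not_or] at hbad
  refine mainLayout_answersFairly hγ hn hL hw hc _ q hne hε hε1 ?_ ?_
  · intro h1
    refine hbad.1 (h1.trans (Nat.mul_le_mul_left 2 (Finset.card_le_card fun j hj => ?_)))
    rw [Finset.mem_filter] at hj ⊢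
    refine ⟨hj.1, hj.2.trans_le (Finset.sum_le_sum fun t _ => Finset.card_le_card fun b hb => ?_)⟩
    rw [Finset.mem_filter] at hb ⊢
    exact ⟨hb.1, (hcol j t b).1 hb.2⟩
  · intro p hp h1
    refine hbad.2 ⟨p, hp, h1.trans (Nat.mul_le_mul_left 2 (Finset.card_le_card fun j hj => ?_))⟩
    rw [Finset.mem_filter] at hj ⊢
    exact ⟨hj.1, fun t ht => hj.2 t ((hcol j t p).2 ht)⟩

end Cases

theorem mainTheorem1 :
    ∃ a : ℕ, ∀ γ : ℝ, 0 < γ → ∃ (prog : Stmt) (A : ℝ) (b : ℕ),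
      ∀ (X : Type u) (U : Type v) (Ω : Type x) [MetricSpace X] [LinearOrder U] [MeasurableSpace Ω]
        (ν : Measure Ω) [IsProbabilityMeasure ν] (h : Ω → X → U)
        (n : ℕ) (P : Fin n ↪ X) (r c p₁ p₂ : ℝ),
        1 < c → 0 < p₂ → p₂ < p₁ → p₁ ≤ 1 → IsSensitive ν h r (c * r) p₁ p₂ →
        ∀ w : ℕ, (n + lshConcat n p₂ + lshTables n p₁ p₂ + 2) ^ b ≤ 2 ^ w →
        ∃ (m : ℕ) (build : (Fin m → Ω) → List ℕ),
          (∀ ω, (∀ v ∈ build ω, v < 2 ^ w) ∧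
            ((m + n + (build ω).length : ℕ) : ℝ) ≤
              A * lshSpace n p₁ p₂ * Real.log (n + 2) ^ a) ∧
          ∀ (q : X) (ε : ℝ), (nbr P q r).Nonempty → 0 < ε → ε < 1 →
            (accuracy ε + 2) ^ b ≤ 2 ^ w →
            Measure.pi (fun _ : Fin m => ν)
                {ω | ¬ AnswersFairly prog w (fun j => h (ω j)) P (build ω) r c q ε
                  (A * lshQuery n p₁ p₂ * (((nbr P q (c * r)).card : ℝ) / (nbr P q r).card) *
                    (1 + Real.log (1 / ε)) * Real.log (n + 2) ^ a)
                  ((n : ℝ) ^ (-γ))} ≤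
              ENNReal.ofReal ((n : ℝ) ^ (-γ)) := by
  refine ⟨3, fun γ hγ => ⟨queryProg, boundFactor γ, groupFactor γ + 8, ?_⟩⟩
  intro X U Ω _ _ _ ν _ h n P r c p₁ p₂ hc hp₂ hp hp₁ hh w hw
  have hg := one_le_groupFactor γ
  have hA := le_boundFactor hγ
  have hL : 0 < lshTables n p₁ p₂ := lshTables_pos (hp₂.trans hp)
  set L := lshTables n p₁ p₂ with hLdef
  rcases Nat.lt_or_ge n 2 with hn | hn
  · -- the bound `n ^ (-γ)` on the probability is `1` for a single point
    refine ⟨0, fun _ => [], fun _ => ⟨by simp, ?_⟩, fun q ε hne _ _ _ => ?_⟩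
    · rcases Nat.eq_zero_or_pos n with rfl | hn0
      · simp [lshSpace]
      · obtain rfl : n = 1 := by omega
        have h1 : (1 : ℝ) ≤ Real.log ((1 : ℕ) + 2) ^ 3 := one_le_pow₀ (one_le_log_add_two hn0)
        have h2 : (1 : ℝ) ≤ lshSpace 1 p₁ p₂ := by
          rw [lshSpace, one_mul]
          exact_mod_cast hL
        simpa using one_le_mul_of_one_le_of_one_le
          (one_le_mul_of_one_le_of_one_le (by linarith : 1 ≤ boundFactor γ) h2) h1
    · obtain rfl : n = 1 := by
        obtain ⟨p, -⟩ := hne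
        have := p.2
        omega
      rw [Nat.cast_one, Real.one_rpow, ENNReal.ofReal_one]
      exact prob_le_one
  have hℓ := one_le_log_add_two (n := n) (by omega)
  have hs := size_le_log (n := n) (by omega)
  have hspace : ∀ N : ℕ, N ≤ 68 * (n * L) * (groupFactor γ * n.size) →
      (N : ℝ) ≤ boundFactor γ * lshSpace n p₁ p₂ * Real.log (n + 2) ^ 3 := by
    intro N hN
    have h1 : (n.size : ℝ) ≤ 4 * Real.log ((n : ℝ) + 2) ^ 3 := hs.trans (by
      have := le_self_pow₀ hℓ (n := 3) (by norm_num)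
      linarith)
    calc (N : ℝ) ≤ (68 * (n * L) * (groupFactor γ * n.size) : ℕ) := by exact_mod_cast hN
      _ = 68 * groupFactor γ * (n * L) * n.size := by push_cast; ring
      _ ≤ 68 * groupFactor γ * (n * L) * (4 * Real.log ((n : ℝ) + 2) ^ 3) := by gcongr
      _ = 272 * groupFactor γ * (n * L) * Real.log ((n : ℝ) + 2) ^ 3 := by ring
      _ ≤ boundFactor γ * (n * L) * Real.log ((n : ℝ) + 2) ^ 3 := by gcongr
      _ = _ := by rw [lshSpace]; push_cast; rfl
  have hG0 : 0 < groupFactor γ * n.size :=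
    Nat.mul_pos (by exact_mod_cast hg) (Nat.size_pos.2 (by omega))
  rcases Nat.lt_or_ge n (lshConcat n p₂) with hk | hk
  · -- the tables of `k` hash functions would not fit, but there is time to look at all points
    have hw' : (n + lshConcat n p₂ + L + 2) ^ 8 ≤ 2 ^ w :=
      (Nat.pow_le_pow_right (by omega) (by omega)).trans hw
    refine ⟨(plainLayout n).tables * (plainLayout n).k,
      fun ω => memory (plainLayout n) (fun j => h (ω j)) P, fun ω =>
      ⟨mem_memory_lt _ _ _ (by simp) (plainLayout_word hn le_rfl hw').2.2.2, ?_⟩,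
      fun q ε hne hε hε1 _ => ?_⟩
    · refine hspace _ ?_
      rw [length_memory]
      exact (plainLayout_space hL hn).trans (Nat.le_mul_of_pos_right _ hG0)
    · have h1 := fun ω : Fin ((plainLayout n).tables * (plainLayout n).k) → Ω =>
        plainLayout_answersFairly hγ hn hL hk hw' hc (fun j => h (ω j)) q hne hε hε1 (P := P)
      refine le_of_eq_of_le ?_ zero_le
      convert measure_empty (μ := Measure.pi fun _ => ν)
      exact Set.eq_empty_of_forall_notMem fun ω hω => hω (h1 ω)
  · refine ⟨(mainLayout n (lshConcat n p₂) L (groupFactor γ * n.size)).tables * lshConcat n p₂,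
      fun ω => memory (mainLayout n (lshConcat n p₂) L (groupFactor γ * n.size))
        (fun j => h (ω j)) P, fun ω => ⟨mem_memory_lt _ _ _ hG0
        (mainLayout_word hL hn (by exact_mod_cast hg) le_rfl hw).2.2.2, ?_⟩,
      fun q ε hne hε hε1 _ => mainLayout_failure hγ hn hc hp₂ hp hp₁ hh hw q hne hε hε1⟩
    refine hspace _ ?_
    rw [length_memory]
    exact mainLayout_space hL hn (by exact_mod_cast hg) hk
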